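/- Let $M$ be a simply connected Riemann surface and let $g\colon M\to\mathbb{S}^5$ be an immersed pseudoholomorphic curve, that is, $g$ composed with a totally geodesic inclusion $\mathbb{S}^5\subset\mathbb{S}^6$ is a pseudoholomorphic curve in the nearly Kähler sphere $\mathbb{S}^6$ (a nonconstant smooth map whose differential is complex linear for the almost complex structure $v\mapsto p\cdot v$ of $T_p\mathbb{S}^6$ given by multiplication of imaginary Cayley numbers). Assume that the Gaussian curvature $K$ of the metric induced by $g$ satisfies $K<1$ everywhere. For $\theta\in[0,\pi)$ let $g_\theta\colon M\to\mathbb{S}^5$ be the member of the associated family of $g$ (unique up to congruence): the minimal surface isometric to $g$ whose second fundamental form is $\alpha^{g_\theta}(X,Y)=T_\theta\,\alpha^g(\cos\theta\,X+\sin\theta\,JX,\,Y)$ for some parallel isometry $T_\theta$ from the normal bundle of $g$ onto that of $g_\theta$, where $J$ is the complex structure of $M$. Let $m\ge 1$, let $a_1,\dots,a_m$ be nonzero real numbers with $\sum_j a_j^2=1$, and let $0\le\theta_1<\cdots<\theta_m<\pi$. Let $$\hat g=a_1g_{\theta_1}\oplus\cdots\oplus a_mg_{\theta_m}\colon M\to\mathbb{S}^{6m-1}\subset\mathbb{R}^{6m}=\mathbb{R}^6\oplus\cdots\oplus\mathbb{R}^6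 .$$ For $s\ge1$ let $\hat\alpha_{s+1}$ be the $(s+1)$-th fundamental form of $\hat g$: the projection of $\nabla^\perp_{X_{s+1}}\cdots\nabla^\perp_{X_3}\hat\alpha(X_2,X_1)$, where $\hat\alpha=\hat\alpha_2$ is the second fundamental form and $\nabla^\perp$ the normal connection, to the orthogonal complement in the normal bundle of the values of $\hat\alpha_2,\dots,\hat\alpha_s$. Let $\|\hat\alpha_{s+1}\|$ be its length. Let $\hat K_s^\perp$ be the $s$-th normal curvature of $\hat g$, which is $2/\pi$ times the area of the region bounded by the $s$-th curvature ellipse $\{\hat\alpha_{s+1}(Z,\dots,Z): |Z|=1\}$. Let $\hat\Phi_s=\langle\hat\alpha_{s+1}(\partial,\dots,\partial),\hat\alpha_{s+1}(\partial,\dots,\partial)\rangle\,dz^{2s+2}$ be the $s$-th Hopf differential of $\hat g$, where $z=x+iy$ is a complex coordinate, $\partial=\frac12(\partial_x-i\partial_y)$, and $\langle\cdot,\cdot\rangle$ is complex bilinear. Let $\Phi$ be the second Hopf differential of $g$, defined in the same way. Then $\hat g$ is a minimal surface in $\mathbb{S}^{6m-1}$, it is substantial (its image lies in no proper totally geodesic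 subsphere), it is isometric to $g$ (it induces the same metric on $M$), and it is exceptional: all its Hopf differentials $\hat\Phi_s$, $1\le s\le 3m-1$, are holomorphic. Moreover, put $\epsilon(s)=s/3$, $(s+2)/3$, $(s+1)/3$ according as $s\equiv 0,1,2 \bmod 3$. Then: (i) there are positive numbers $\hat b_s$ such that $\|\hat\alpha_{s+1}\|^2=\hat b_s(1-K)^{\epsilon(s)}$ on $M$ for all $1\le s\le 3m-1$; (ii) there are positive numbers $\hat c_s$ such that $\hat K^\perp_s=\hat c_s(1-K)^{\epsilon(s)}$ on $M$ for all $1\le s<3m-1$; (iii) there are complex numbers $\hat d_s$ such that, for all $1\le s\le 3m-1$, $\hat\Phi_s=\hat d_s\,\Phi^{(s+1)/3}$ if $s\equiv 2\bmod 3$, and $\hat\Phi_s=0$ otherwise. -/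

import Mathlib

open Complex MeasureTheory
open scoped Manifold ContDiff InnerProductSpace

noncomputable section

/-! ### Local geometry of a map `u : ℂ → E` into the unit sphere of a Euclidean space -/

section Local

variable {E : Type*} [NormedAddCommGroup E] [InnerProductSpace ℝ E] [FiniteDimensional ℝ E]

/-- Normal space at `z` of the immersion `u` into the unit sphere: the vectors of `E` orthogonal
to the position vector `u z` and to the tangent plane `du_z(ℂ)`. -/
def normalSpace (u : ℂ → E) (z : ℂ) : Submodule ℝ E :=
  (Submodule.span ℝ {u z} ⊔ (fderiv ℝ u z).range)ᗮ

/-- The iterated derivatives `∇^⊥_{X_r} ⋯ ∇^⊥_{X_2} α(X_1, X_0)` for constant coordinate vector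
fields `X_i`, where `α(X, Y)` is the normal component of `D_Y (du X)` and `∇^⊥` is the normal
component of the derivative of a normal field. For `r = 0` this is `du(X_0)`. -/
def preForm (u : ℂ → E) : (r : ℕ) → (Fin (r + 1) → ℂ) → ℂ → E
  | 0, X, z => fderiv ℝ u z (X 0)
  | r + 1, X, z =>
      (normalSpace u z).starProjection
        (fderiv ℝ (preForm u r (Fin.init X)) z (X (Fin.last (r + 1))))

/-- The sum `N_0 ⊕ N_1 ⊕ ⋯ ⊕ N_{r-1}`, with `N_0` the tangent plane and `N_k`, `k ≥ 1`, the
`k`-th normal space, spanned by the values of the `(k+1)`-th fundamental form. -/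
def lowerSpace (u : ℂ → E) : ℕ → ℂ → Submodule ℝ E
  | 0, _ => ⊥
  | r + 1, z => lowerSpace u r z ⊔
      Submodule.span ℝ (Set.range fun X : Fin (r + 1) → ℂ =>
        (lowerSpace u r z)ᗮ.starProjection (preForm u r X z))

/-- The `(r+1)`-th fundamental form `α_{r+1}`, `r ≥ 1`: the projection of
`∇^⊥_{X_r} ⋯ ∇^⊥_{X_2} α(X_1, X_0)` to the orthogonal complement of `N_1 ⊕ ⋯ ⊕ N_{r-1}` in the
normal space (projecting off the tangent plane `N_0` as well changes nothing, since this
derivative is already normal). For `r = 0` it is the differential `α_1 = du`. -/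
def fundForm (u : ℂ → E) (r : ℕ) (X : Fin (r + 1) → ℂ) (z : ℂ) : E :=
  (lowerSpace u r z)ᗮ.starProjection (preForm u r X z)

/-- The coefficient `⟨α_{r+1}(∂, …, ∂), α_{r+1}(∂, …, ∂)⟩` of `dz^{2r+2}` in the `r`-th Hopf
differential, where `∂ = (1/2) ∂_x - (i/2) ∂_y`, and where `α_{r+1}` and the metric are extended
complex multilinearly. -/
def hopfCoeff (u : ℂ → E) (r : ℕ) (z : ℂ) : ℂ :=
  let e : Fin 2 → ℂ := ![1, I]
  let c : Fin 2 → ℂ := ![1 / 2, -I / 2]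
  ∑ ε : Fin (r + 1) → Fin 2, ∑ δ : Fin (r + 1) → Fin 2,
    (∏ i, c (ε i)) * (∏ i, c (δ i)) *
      ((⟪fundForm u r (e ∘ ε) z, fundForm u r (e ∘ δ) z⟫_ℝ : ℝ) : ℂ)

end Local

/-! ### Surfaces: maps from a Riemann surface `M` -/

section Surfaces

variable {M : Type*} [TopologicalSpace M] [ChartedSpace ℂ M]
variable {E : Type*} [NormedAddCommGroup E] [InnerProductSpace ℝ E]

/-- The map `f` read in the complex coordinate of `M` around `p`. -/
def localRep {F : Type*} (f : M → F) (p : M) : ℂ → F := f ∘ (chartAt ℂ p).symm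

/-- The differential of `f` at `p`; the tangent space `T_p M` is identified with `ℂ` by the
complex coordinate around `p`, so that the complex structure `J` is multiplication by `i`. -/
def differential (f : M → E) (p : M) : ℂ →L[ℝ] E :=
  fderiv ℝ (localRep f p) (chartAt ℂ p p)

/-- `f` and `h` induce the same metric on `M`. -/
def SameMetric {F : Type*} [NormedAddCommGroup F] [InnerProductSpace ℝ F]
    (f : M → E) (h : M → F) : Prop :=
  ∀ (p : M) (X Y : ℂ),
    ⟪differential f p X, differential f p Y⟫_ℝ = ⟪differential h p X, differential h p Y⟫_ℝ

/-- `e` is an orthonormal basis of `T_p M` for the metric induced by `f`. -/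
def IsFrame (f : M → E) (p : M) (e : Fin 2 → ℂ) : Prop :=
  Orthonormal ℝ fun i => differential f p (e i)

/-- The factor `F = |f_x|²` of the metric `F |dz|²` induced by a conformal immersion `f`, in the
coordinate `z` around `p`. -/
def conformalFactor (f : M → E) (p : M) (z : ℂ) : ℝ :=
  ‖fderiv ℝ (localRep f p) z 1‖ ^ 2

/-- The Gaussian curvature `K = -(Δ₀ log F) / (2 F)` of the metric `F |dz|²` induced by a
conformal immersion `f`, with `Δ₀` the flat Laplacian in the (isothermal) coordinate `z`. -/
def gaussCurvature (f : M → E) (p : M) : ℝ :=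
  -Laplacian.laplacian (fun z => Real.log (conformalFactor f p z)) (chartAt ℂ p p) /
    (2 * conformalFactor f p (chartAt ℂ p p))

/-- `f` is a smooth immersion with values in the unit sphere of `E`. -/
structure IsImmersedSurface (f : M → E) : Prop where
  smooth : ContMDiff 𝓘(ℝ, ℂ) 𝓘(ℝ, E) ∞ f
  mem_sphere : ∀ p, f p ∈ Metric.sphere (0 : E) 1
  immersion : ∀ p, Function.Injective (differential f p)

/-- `f(M)` lies in no totally geodesic proper subsphere, that is, in no proper linear subspace. -/
def IsSubstantial (f : M → E) : Prop :=
  ∀ V : Submodule ℝ E, (∀ p, f p ∈ V) → V = ⊤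

variable [FiniteDimensional ℝ E]

/-- The normal space of the surface `f` at `p`. -/
def normalSpaceAt (f : M → E) (p : M) : Submodule ℝ E :=
  normalSpace (localRep f p) (chartAt ℂ p p)

/-- The `(r+1)`-th fundamental form of the surface `f` at `p`. -/
def fundFormAt (f : M → E) (r : ℕ) (p : M) (X : Fin (r + 1) → ℂ) : E :=
  fundForm (localRep f p) r X (chartAt ℂ p p)

/-- `f` is a minimal surface in the unit sphere of `E`: its mean curvature vector vanishes. -/
structure IsMinimalSurface (f : M → E) : Prop extends IsImmersedSurface f where
  minimal : ∀ (p : M) (e : Fin 2 → ℂ), IsFrame f p e →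
    ∑ i, fundFormAt f 1 p ![e i, e i] = 0

/-- The squared length `‖α_{r+1}‖²` at `p`, computed in the orthonormal frame `e`. -/
def fundFormNormSq (f : M → E) (r : ℕ) (p : M) (e : Fin 2 → ℂ) : ℝ :=
  ∑ ε : Fin (r + 1) → Fin 2, ‖fundFormAt f r p (e ∘ ε)‖ ^ 2

/-- The `r`-th curvature ellipse: the values `α_{r+1}(Z, …, Z)` at unit tangent vectors `Z`. -/
def curvatureEllipse (f : M → E) (r : ℕ) (p : M) : Set E :=
  {v | ∃ Z : ℂ, ‖differential f p Z‖ = 1 ∧ v = fundFormAt f r p fun _ => Z}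

/-- The `r`-th normal curvature: `2/π` times the area of the region bounded by the `r`-th
curvature ellipse. -/
def normalCurvature [MeasurableSpace E] [BorelSpace E] (f : M → E) (r : ℕ) (p : M) : ℝ :=
  2 / Real.pi * (μHE[2] (convexHull ℝ (curvatureEllipse f r p))).toReal

/-- The coefficient function, defined on the target of the coordinate `z` around `p`, of the
`r`-th Hopf differential `Φ_r = φ dz^{2r+2}`. -/
def hopfDifferential (f : M → E) (r : ℕ) (p : M) (z : ℂ) : ℂ :=
  hopfCoeff (localRep f p) r z

/-- The `r`-th Hopf differential is (defined and) holomorphic on all of `M`. -/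
def HasHolomorphicHopfDifferential (f : M → E) (r : ℕ) : Prop :=
  ∀ p : M, DifferentiableOn ℂ (hopfDifferential f r p) (chartAt ℂ p).target

/-- A minimal surface is `r`-exceptional if all its Hopf differentials up to order `r + 1` are
holomorphic. -/
def IsRExceptional (f : M → E) (r : ℕ) : Prop :=
  IsMinimalSurface f ∧ ∀ s, 1 ≤ s → s ≤ r + 1 → HasHolomorphicHopfDifferential f s

/-- A minimal surface in the `n`-sphere, `n = dim E - 1`, is exceptional if it is `r`-exceptional
for `r = [(n - 1)/2 - 1]`. -/
def IsExceptional (f : M → E) : Prop :=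
  IsRExceptional f ((Module.finrank ℝ E - 1 - 1) / 2 - 1)

/-- `T` is a parallel isometry from the normal bundle of `f` onto the normal bundle of `h`
(only the values of `T p` on the normal space of `f` at `p` matter). -/
structure IsParallelNormalIsometry (f h : M → E) (T : M → E →L[ℝ] E) : Prop where
  smooth : ContMDiff 𝓘(ℝ, ℂ) 𝓘(ℝ, E →L[ℝ] E) ∞ T
  onto : ∀ p, (normalSpaceAt f p).map (T p : E →ₗ[ℝ] E) = normalSpaceAt h p
  isometry : ∀ p, ∀ ξ ∈ normalSpaceAt f p, ‖T p ξ‖ = ‖ξ‖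
  parallel : ∀ (p : M) (η : M → E), ContMDiffAt 𝓘(ℝ, ℂ) 𝓘(ℝ, E) ∞ η p →
    (∀ᶠ q in nhds p, η q ∈ normalSpaceAt f q) → ∀ X : ℂ,
      (normalSpaceAt h p).starProjection (differential (fun q => T q (η q)) p X) =
        T p ((normalSpaceAt f p).starProjection (differential η p X))

/-- `h` is the member `f_θ` of the associated family of the minimal surface `f` (it is unique up
to isometries of the sphere): a minimal surface isometric to `f` whose second fundamental form is
`α^h(X, Y) = T α^f(J_θ X, Y)` with `J_θ = cos θ I + sin θ J` and a parallel isometry `T` of the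
normal bundles. -/
def IsAssociate (f : M → E) (θ : ℝ) (h : M → E) : Prop :=
  IsMinimalSurface h ∧ SameMetric f h ∧
    ∃ T : M → E →L[ℝ] E, IsParallelNormalIsometry f h T ∧
      ∀ (p : M) (X Y : ℂ), fundFormAt h 1 p ![X, Y] =
        T p (fundFormAt f 1 p ![(Real.cos θ : ℂ) * X + (Real.sin θ : ℂ) * (I * X), Y])

end Surfaces

/-! ### Cayley numbers and pseudoholomorphic curves -/

/-- Multiplication of Cayley numbers, as pairs of quaternions. -/
def cayleyMul (x y : Quaternion ℝ × Quaternion ℝ) : Quaternion ℝ × Quaternion ℝ :=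
  (x.1 * y.1 - star y.2 * x.2, y.2 * x.1 + x.2 * star y.1)

/-- The identification of `ℝ⁷` with the imaginary Cayley numbers. -/
def cayleyIm (v : EuclideanSpace ℝ (Fin 7)) : Quaternion ℝ × Quaternion ℝ :=
  (⟨0, v 0, v 1, v 2⟩, ⟨v 3, v 4, v 5, v 6⟩)

/-- A pseudoholomorphic curve in the nearly Kähler sphere `S⁶`: a nonconstant smooth map whose
differential is complex linear for the almost complex structure `v ↦ p · v` of `T_p S⁶`. -/
structure IsPseudoholomorphicCurve {M : Type*} [TopologicalSpace M] [ChartedSpace ℂ M]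
    (f : M → EuclideanSpace ℝ (Fin 7)) : Prop where
  smooth : ContMDiff 𝓘(ℝ, ℂ) 𝓘(ℝ, EuclideanSpace ℝ (Fin 7)) ∞ f
  mem_sphere : ∀ p, f p ∈ Metric.sphere (0 : EuclideanSpace ℝ (Fin 7)) 1
  nonconstant : ∃ p q, f p ≠ f q
  complexLinear : ∀ (p : M) (X : ℂ), cayleyIm (differential f p (I * X)) =
    cayleyMul (cayleyIm (f p)) (cayleyIm (differential f p X))

/-- A pseudoholomorphic curve in `S⁵`: the unit sphere of `ℝ⁶` is placed in `S⁶` as a totally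
geodesic hypersphere by a linear isometry `ℝ⁶ → ℝ⁷`. -/
def IsPseudoholomorphicCurveInS5 {M : Type*} [TopologicalSpace M] [ChartedSpace ℂ M]
    (g : M → EuclideanSpace ℝ (Fin 6)) : Prop :=
  ∃ ι : EuclideanSpace ℝ (Fin 6) →ₗᵢ[ℝ] EuclideanSpace ℝ (Fin 7),
    IsPseudoholomorphicCurve fun p => ι (g p)

/-- `ℝ^{6m}` with its orthogonal decomposition into `m` copies of `ℝ⁶`. -/
abbrev SumSpace (m : ℕ) : Type := PiLp 2 fun _ : Fin m => EuclideanSpace ℝ (Fin 6)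

/-- The direct sum `a_1 h_1 ⊕ ⋯ ⊕ a_m h_m`. -/
def directSumSurface {M : Type*} {m : ℕ} (a : Fin m → ℝ)
    (h : Fin m → M → EuclideanSpace ℝ (Fin 6)) (p : M) : SumSpace m :=
  WithLp.toLp 2 fun j => a j • h j p

/-- The exponent of `1 - K`. -/
def curvatureExponent (s : ℕ) : ℕ :=
  if s % 3 = 0 then s / 3 else if s % 3 = 1 then (s + 2) / 3 else (s + 1) / 3

end

/-!
The proof reduces every assertion to linear algebra in a constant model.

*The curve.* Write `×` for the cross product of imaginary Cayley numbers. For a pseudoholomorphic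
curve `u` in a coordinate, the differential `W₁ = du` and the second fundamental form
`α(X, Y) = W₂ (X Y)` are complex linear for `v ↦ u × v`, so both are conformal, with
`|W₁ c|² = ρ₁ |c|²` and `|W₂ c|² = ρ₂ |c|²`; the Gauss equation says `ρ₂ = ρ₁² (1 - K) / 2`. If
`ξ` is a unit normal of the hyperplane of `S⁵` in `ℝ⁷`, then `η = u × ξ` is a unit normal field
orthogonal to the values of `W₁` and `W₂`. The third fundamental form is `α₃(∂, ∂, ∂) = ψ η` with
`ψ` holomorphic by the Codazzi equation, the second Hopf differential is `ψ²`, and differentiating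
`η = u × ξ` gives `4 |ψ|² = ρ₁ ρ₂` (`IsPseudoholomorphicChart.exists_framedChart`). Hence
`|ψ|² = ρ₁³ (1 - K) / 8`.

*The periodic sequence.* In the frame `u, W₁, W₂, η` the successive derivatives `∂^k u` run, modulo
lower order terms and up to complex factors, through `u, W₁, W₂, η` and then the conjugates of `W₂`
and `W₁`, and return to `u` with the factor `-ψ²`. These terms form an osculating sequence: `∂` of
the `k`-th term is the `(k + 1)`-th modulo the `k`-th, and `∂̄` of it is a multiple of the
`(k - 1)`-th (`isOsculating_cycSeq`). For a map with such a sequence the `(s + 1)`-th fundamental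
form is the part of the term of order `s + 1` orthogonal to its predecessors
(`IsOsculating.fundForm_eq`).

*The direct sum.* The member `g_θ` of the associated family has the same `ρ₁` and `ρ₂`, and `ψ` is
replaced by `e^{iθ} ψ` (`IsAssociate.exists_framedChart`). The coefficients of the structure
equations depend on `ψ` only through its logarithmic derivative, so they are the same for all the
`g_θ`, and the direct sums of the sequences form again an osculating sequence
(`isOsculating_sumSeq`). A frame identifies it with a constant model sequence `modelMap a l k`,
`l_j = e^{iθ_j}`, multiplied by a complex factor `modelFactor ρ₁ ρ₂ ψ k`, whence
`fundForm_sumVec`. The squared modulus of the factor of order `s + 1` is a constant times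
`(1 - K) ^ ε(s) ρ₁ ^ (s + 1)`, which gives the lengths and the normal curvatures; for
`s + 1 = 3 n` its square is `4 (ψ²)^n`, which gives the Hopf differentials. Those of the other
orders vanish since a quarter turn of the tangent and first normal planes is a symmetry of the model
(`hopfForm_modelForm`).

*Positivity.* What remains is that the terms of the model sequence up to order `3 m - 1` are
injective and independent, and that the one of order `3 m` fills the remaining direction. The
nonzero slot of the `j`-th component of the `k`-th term is, up to conjugation and real parts, a
power of `l_j` times the argument, so a dependence is a polynomial of degree less than `m` that
vanishes at the `m` numbers `l_j²`. They are distinct because the angles lie in `[0, π)`, so the polynomial is zero (`eq_zero_of_modelMap_mem`, `exists_modelMap_notMem`).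
-/

noncomputable section

/-! ### Directional derivatives -/

section DirDeriv

variable {F G : Type*} [NormedAddCommGroup F] [NormedSpace ℝ F]
  [NormedAddCommGroup G] [NormedSpace ℝ G]

/-- `f` is real differentiable at `z` and `X ↦ f' X` are its directional derivatives. Linearity
of `f'` need not be bundled, which keeps formulas for derivatives readable. -/
def HasDirDeriv (f : ℂ → F) (f' : ℂ → F) (z : ℂ) : Prop :=
  DifferentiableAt ℝ f z ∧ ∀ X, fderiv ℝ f z X = f' X

namespace HasDirDeriv

variable {f g : ℂ → F} {f' g' : ℂ → F} {z : ℂ}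

theorem of_hasFDerivAt {L : ℂ →L[ℝ] F} (h : HasFDerivAt f L z) : HasDirDeriv f (fun X => L X) z :=
  ⟨h.differentiableAt, fun X => by rw [h.fderiv]⟩

theorem congr_deriv (h : HasDirDeriv f f' z) (e : ∀ X, f' X = g' X) : HasDirDeriv f g' z :=
  ⟨h.1, fun X => (h.2 X).trans (e X)⟩

theorem congr_of_eventuallyEq (h : HasDirDeriv f f' z) (e : g =ᶠ[nhds z] f) :
    HasDirDeriv g f' z :=
  ⟨h.1.congr_of_eventuallyEq e, fun X => by rw [e.fderiv_eq]; exact h.2 X⟩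

theorem unique (h : HasDirDeriv f f' z) (h' : HasDirDeriv f g' z) (X : ℂ) : f' X = g' X :=
  (h.2 X).symm.trans (h'.2 X)

theorem const (c : F) : HasDirDeriv (fun _ => c) (fun _ => 0) z :=
  ⟨differentiableAt_const c, fun X => by simp⟩

theorem add (hf : HasDirDeriv f f' z) (hg : HasDirDeriv g g' z) :
    HasDirDeriv (fun w => f w + g w) (fun X => f' X + g' X) z :=
  ⟨hf.1.add hg.1, fun X => by
    have := (hf.1.hasFDerivAt.add hg.1.hasFDerivAt).fderiv
    simp only [Pi.add_def] at this
    rw [this, add_apply, hf.2, hg.2]⟩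

theorem neg (hf : HasDirDeriv f f' z) :
    HasDirDeriv (fun w => -f w) (fun X => -f' X) z :=
  ⟨hf.1.neg, fun X => by
    have := (hf.1.hasFDerivAt.neg).fderiv
    simp only [Pi.neg_def] at this
    rw [this, neg_apply, hf.2]⟩

theorem sub (hf : HasDirDeriv f f' z) (hg : HasDirDeriv g g' z) :
    HasDirDeriv (fun w => f w - g w) (fun X => f' X - g' X) z := by
  simpa only [sub_eq_add_neg] using hf.add hg.neg

theorem clm (L : F →L[ℝ] G) (hf : HasDirDeriv f f' z) :
    HasDirDeriv (fun w => L (f w)) (fun X => L (f' X)) z :=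
  ⟨L.differentiableAt.comp z hf.1, fun X => by
    have := (L.hasFDerivAt.comp z hf.1.hasFDerivAt).fderiv
    simp only [Function.comp_def] at this
    rw [this, ContinuousLinearMap.comp_apply, hf.2]⟩

theorem smul {s : ℂ → ℝ} {s' : ℂ → ℝ} (hs : HasDirDeriv s s' z) (hf : HasDirDeriv f f' z) :
    HasDirDeriv (fun w => s w • f w) (fun X => s z • f' X + s' X • f z) z :=
  ⟨hs.1.smul hf.1, fun X => by
    have := (hs.1.hasFDerivAt.smul hf.1.hasFDerivAt).fderiv
    simp only [Pi.smul_def'] at this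
    rw [this]
    simp [hf.2, hs.2]⟩

theorem mul {s t : ℂ → ℂ} {s' t' : ℂ → ℂ} (hs : HasDirDeriv s s' z) (ht : HasDirDeriv t t' z) :
    HasDirDeriv (fun w => s w * t w) (fun X => s z * t' X + s' X * t z) z :=
  ⟨hs.1.mul ht.1, fun X => by
    have := (hs.1.hasFDerivAt.mul ht.1.hasFDerivAt).fderiv
    simp only [Pi.mul_def] at this
    rw [this]
    simp [ht.2, hs.2, mul_comm]⟩

theorem mulReal {s t : ℂ → ℝ} {s' t' : ℂ → ℝ} (hs : HasDirDeriv s s' z)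
    (ht : HasDirDeriv t t' z) :
    HasDirDeriv (fun w => s w * t w) (fun X => s z * t' X + s' X * t z) z := by
  simpa only [smul_eq_mul] using hs.smul ht

theorem re {s : ℂ → ℂ} {s' : ℂ → ℂ} (hs : HasDirDeriv s s' z) :
    HasDirDeriv (fun w => (s w).re) (fun X => (s' X).re) z := hs.clm reCLM

theorem im {s : ℂ → ℂ} {s' : ℂ → ℂ} (hs : HasDirDeriv s s' z) :
    HasDirDeriv (fun w => (s w).im) (fun X => (s' X).im) z := hs.clm imCLM

theorem ofReal {s : ℂ → ℝ} {s' : ℂ → ℝ} (hs : HasDirDeriv s s' z) :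
    HasDirDeriv (fun w => (s w : ℂ)) (fun X => (s' X : ℂ)) z := hs.clm ofRealCLM

theorem conj {s : ℂ → ℂ} {s' : ℂ → ℂ} (hs : HasDirDeriv s s' z) :
    HasDirDeriv (fun w => starRingEnd ℂ (s w)) (fun X => starRingEnd ℂ (s' X)) z :=
  hs.clm (conjCLE : ℂ →L[ℝ] ℂ)

theorem of_hasDerivAt {s : ℂ → ℂ} {s' : ℂ} (hs : HasDerivAt s s' z) :
    HasDirDeriv s (fun X => s' * X) z :=
  (of_hasFDerivAt (hs.hasFDerivAt.restrictScalars ℝ)).congr_deriv fun X => by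
    simp [mul_comm]

theorem inv {s : ℂ → ℝ} {s' : ℂ → ℝ} (hs : HasDirDeriv s s' z) (h0 : s z ≠ 0) :
    HasDirDeriv (fun w => (s w)⁻¹) (fun X => -s' X / s z ^ 2) z :=
  ⟨hs.1.inv h0, fun X => by
    have := ((hasDerivAt_inv h0).hasFDerivAt.comp z hs.1.hasFDerivAt).fderiv
    simp only [Function.comp_def] at this
    rw [this]
    simp [hs.2, div_eq_mul_inv]⟩

theorem inner {E : Type*} [NormedAddCommGroup E] [InnerProductSpace ℝ E] {f g f' g' : ℂ → E}
    (hf : HasDirDeriv f f' z) (hg : HasDirDeriv g g' z) :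
    HasDirDeriv (fun w => ⟪f w, g w⟫_ℝ) (fun X => ⟪f z, g' X⟫_ℝ + ⟪f' X, g z⟫_ℝ) z :=
  ⟨hf.1.inner ℝ hg.1, fun X => by rw [fderiv_inner_apply ℝ hf.1 hg.1, hf.2, hg.2]⟩

theorem sum {ι : Type*} (s : Finset ι) {f f' : ι → ℂ → F}
    (h : ∀ i ∈ s, HasDirDeriv (f i) (f' i) z) :
    HasDirDeriv (fun w => ∑ i ∈ s, f i w) (fun X => ∑ i ∈ s, f' i X) z := by
  classical
  induction s using Finset.induction_on with
  | empty => simpa using const (0 : F)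
  | insert a s ha ih =>
    simp only [Finset.sum_insert ha]
    exact (h a (by simp)).add (ih fun i hi => h i (by simp [hi]))

end HasDirDeriv

theorem LinearMap.apply_eq_re_im (L : ℂ →ₗ[ℝ] F) (c : ℂ) :
    L c = c.re • L 1 + c.im • L I := by
  conv_lhs => rw [show c = c.re • (1 : ℂ) + c.im • I by simp [Complex.re_add_im]]
  rw [map_add, map_smul, map_smul]

/-- Product rule for `z ↦ W z (c z)`, where `W z` is real linear. -/
theorem HasDirDeriv.linearMap_apply {W : ℂ → ℂ →ₗ[ℝ] F} {W' : ℂ → ℂ → F} {z : ℂ}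
    (hW : ∀ d, HasDirDeriv (fun w => W w d) (W' d) z) {c c' : ℂ → ℂ} (hc : HasDirDeriv c c' z) :
    HasDirDeriv (fun w => W w (c w)) (fun X => W' (c z) X + W z (c' X)) z := by
  have e : (fun w => W w (c w)) = fun w => (c w).re • W w 1 + (c w).im • W w I :=
    funext fun w => (W w).apply_eq_re_im _
  have hlin : ∀ X, W' (c z) X = (c z).re • W' 1 X + (c z).im • W' I X := fun X => by
    have h1 := (((HasDirDeriv.const ((c z).re)).smul (hW 1)).add
      ((HasDirDeriv.const ((c z).im)).smul (hW I)))
    have h2 := hW (c z)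
    have e2 : (fun w => W w (c z)) = fun w => (c z).re • W w 1 + (c z).im • W w I :=
      funext fun w => (W w).apply_eq_re_im _
    rw [e2] at h2
    simpa using h2.unique h1 X
  rw [e]
  refine ((hc.re.smul (hW 1)).add (hc.im.smul (hW I))).congr_deriv fun X => ?_
  rw [hlin, (W z).apply_eq_re_im (c' X)]
  abel

theorem ContDiffOn.linearMap_apply {W : ℂ → ℂ →ₗ[ℝ] F} {U : Set ℂ} {n : WithTop ℕ∞}
    (hW : ∀ d, ContDiffOn ℝ n (fun w => W w d) U) {c : ℂ → ℂ} (hc : ContDiffOn ℝ n c U) :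
    ContDiffOn ℝ n (fun w => W w (c w)) U := by
  have e : (fun w => W w (c w)) = fun w => (c w).re • W w 1 + (c w).im • W w I :=
    funext fun w => (W w).apply_eq_re_im _
  rw [e]
  exact ((reCLM.contDiff.comp_contDiffOn hc).smul (hW 1)).add
    ((imCLM.contDiff.comp_contDiffOn hc).smul (hW I))

theorem ContDiffOn.hasDirDeriv {f : ℂ → F} {U : Set ℂ} (hf : ContDiffOn ℝ ∞ f U) (hU : IsOpen U)
    {z : ℂ} (hz : z ∈ U) : HasDirDeriv f (fun X => fderiv ℝ f z X) z :=
  ⟨(hf.contDiffAt (hU.mem_nhds hz)).differentiableAt (by simp), fun _ => rfl⟩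

theorem ContDiffOn.fderiv_apply_smooth {f : ℂ → F} {U : Set ℂ} (hf : ContDiffOn ℝ ∞ f U)
    (hU : IsOpen U) (X : ℂ) : ContDiffOn ℝ ∞ (fun z => fderiv ℝ f z X) U :=
  (hf.fderiv_of_isOpen hU (m := ∞) (by simp)).clm_apply contDiffOn_const

end DirDeriv

/-! ### The higher fundamental forms along an osculating sequence -/

section Osculating

variable {E : Type*} [NormedAddCommGroup E] [InnerProductSpace ℝ E]

theorem Submodule.starProjection_orthogonal_sub_mem [FiniteDimensional ℝ E] (K : Submodule ℝ E)
    {x y : E} (h : x - y ∈ K) : Kᗮ.starProjection x = Kᗮ.starProjection y := by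
  rw [← sub_eq_zero, ← map_sub]
  simp [Submodule.starProjection_eq_self_iff.2 h]

/-- An osculating sequence of a conformal map `u` into the unit sphere. A vector `w` of the
complexification of `E` is represented by the real linear map `c ↦ 2 Re (c w)`; in these terms
`W 0` is `u`, `W 1` is `∂u`, and the equations say that `∂ W k ≡ W (k + 1)` modulo `W k` and that
`∂̄ W k` is a multiple of `W (k - 1)`. -/
structure IsOsculating (U : Set ℂ) (u : ℂ → E) (W : ℕ → ℂ → ℂ →ₗ[ℝ] E) (p q : ℕ → ℂ → ℂ)
    (ρ : ℂ → ℝ) : Prop where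
  isOpen : IsOpen U
  smooth_u : ContDiffOn ℝ ∞ u U
  smooth_W : ∀ k c, ContDiffOn ℝ ∞ (fun z => W k z c) U
  smooth_p : ∀ k, 1 ≤ k → ContDiffOn ℝ ∞ (p k) U
  smooth_q : ∀ k, 1 ≤ k → ContDiffOn ℝ ∞ (q k) U
  smooth_ρ : ContDiffOn ℝ ∞ ρ U
  norm_u : ∀ z ∈ U, ‖u z‖ = 1
  ρ_pos : ∀ z ∈ U, 0 < ρ z
  inner_W_one : ∀ z ∈ U, ∀ c d, ⟪W 1 z c, W 1 z d⟫_ℝ = ρ z * (c * starRingEnd ℂ d).re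
  W_zero : ∀ z ∈ U, ∀ c, W 0 z c = (2 * c.re) • u z
  deriv_u : ∀ z ∈ U, HasDirDeriv u (fun X => W 1 z X) z
  deriv_W : ∀ k, 1 ≤ k → ∀ z ∈ U, ∀ c, HasDirDeriv (fun w => W k w c)
    (fun X => W (k + 1) z (c * X) + W k z (p k z * c * X) +
      W (k - 1) z (q k z * c * starRingEnd ℂ X)) z

/-- The span of `u` and of the real and imaginary parts of `W 1, …, W r`. -/
def oscSpace (u : ℂ → E) (W : ℕ → ℂ → ℂ →ₗ[ℝ] E) : ℕ → ℂ → Submodule ℝ E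
  | 0, z => Submodule.span ℝ {u z}
  | r + 1, z => oscSpace u W r z ⊔ LinearMap.range (W (r + 1) z)

/-- `ξ` is on `U` a combination of `u, W 1, …, W r` with smooth coefficients. -/
def IsOscComb (U : Set ℂ) (u : ℂ → E) (W : ℕ → ℂ → ℂ →ₗ[ℝ] E) (r : ℕ) (ξ : ℂ → E) : Prop :=
  ∃ (s : ℂ → ℝ) (c : ℕ → ℂ → ℂ), ContDiffOn ℝ ∞ s U ∧ (∀ k, ContDiffOn ℝ ∞ (c k) U) ∧
    ∀ z ∈ U, ξ z = s z • u z + ∑ k ∈ Finset.range r, W (k + 1) z (c k z)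

namespace IsOscComb

variable {U : Set ℂ} {u : ℂ → E} {W : ℕ → ℂ → ℂ →ₗ[ℝ] E} {r : ℕ} {ξ ζ : ℂ → E}

theorem congr (h : IsOscComb U u W r ξ) (e : ∀ z ∈ U, ζ z = ξ z) : IsOscComb U u W r ζ := by
  obtain ⟨s, c, hs, hc, hξ⟩ := h
  exact ⟨s, c, hs, hc, fun z hz => (e z hz).trans (hξ z hz)⟩

theorem add (h : IsOscComb U u W r ξ) (h' : IsOscComb U u W r ζ) :
    IsOscComb U u W r (fun z => ξ z + ζ z) := by
  obtain ⟨s, c, hs, hc, hξ⟩ := h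
  obtain ⟨s', c', hs', hc', hζ⟩ := h'
  refine ⟨fun z => s z + s' z, fun k z => c k z + c' k z, hs.add hs', fun k => (hc k).add (hc' k),
    fun z hz => ?_⟩
  simp only [hξ z hz, hζ z hz, add_smul, map_add, Finset.sum_add_distrib]
  abel

theorem zero : IsOscComb U u W r (fun _ => 0) :=
  ⟨fun _ => 0, fun _ _ => 0, contDiffOn_const, fun _ => contDiffOn_const, fun z _ => by simp⟩

theorem smul_u {s : ℂ → ℝ} (hs : ContDiffOn ℝ ∞ s U) :
    IsOscComb U u W r (fun z => s z • u z) :=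
  ⟨s, fun _ _ => 0, hs, fun _ => contDiffOn_const, fun z _ => by simp⟩

theorem W_apply {k : ℕ} (hk : k + 1 ≤ r) {c : ℂ → ℂ} (hc : ContDiffOn ℝ ∞ c U) :
    IsOscComb U u W r (fun z => W (k + 1) z (c z)) := by
  refine ⟨fun _ => 0, fun j => if j = k then c else fun _ => 0, contDiffOn_const, fun j => ?_,
    fun z _ => ?_⟩
  · by_cases hj : j = k
    · simpa [hj] using hc
    · simpa [hj] using contDiffOn_const
  · rw [Finset.sum_eq_single k]
    · simp
    · intro j _ hj
      simp [hj]
    · intro h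
      simp at h
      omega

theorem sum {ι : Type*} (t : Finset ι) {ξ : ι → ℂ → E} (h : ∀ i ∈ t, IsOscComb U u W r (ξ i)) :
    IsOscComb U u W r (fun z => ∑ i ∈ t, ξ i z) := by
  classical
  induction t using Finset.induction_on with
  | empty => simpa using zero
  | insert a s ha ih =>
    simp only [Finset.sum_insert ha]
    exact (h a (by simp)).add (ih fun i hi => h i (by simp [hi]))

theorem mem_oscSpace (h : IsOscComb U u W r ξ) {z : ℂ} (hz : z ∈ U) : ξ z ∈ oscSpace u W r z := by
  obtain ⟨s, c, -, -, hξ⟩ := h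
  rw [hξ z hz]
  clear hξ
  induction r with
  | zero =>
    simpa [oscSpace] using Submodule.smul_mem _ _ (Submodule.mem_span_singleton_self (u z))
  | succ r ih =>
    rw [Finset.sum_range_succ, ← add_assoc]
    exact Submodule.add_mem_sup ih (LinearMap.mem_range_self _ _)

end IsOscComb

variable {U : Set ℂ} {u : ℂ → E} {W : ℕ → ℂ → ℂ →ₗ[ℝ] E} {p q : ℕ → ℂ → ℂ} {ρ : ℂ → ℝ}

theorem u_mem_oscSpace (u : ℂ → E) (W : ℕ → ℂ → ℂ →ₗ[ℝ] E) (r : ℕ) (z : ℂ) :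
    u z ∈ oscSpace u W r z := by
  induction r with
  | zero => exact Submodule.mem_span_singleton_self (u z)
  | succ r ih => exact Submodule.mem_sup_left ih

/-- For a map into the sphere, the derivatives are orthogonal to the position vector. -/
theorem HasDirDeriv.inner_eq_zero_of_norm {u u' : ℂ → E} {z : ℂ} (h : HasDirDeriv u u' z)
    (hn : ∀ᶠ w in nhds z, ‖u w‖ = 1) (X : ℂ) : ⟪u z, u' X⟫_ℝ = 0 := by
  have h1 := h.inner h
  have h2 : HasDirDeriv (fun w => ⟪u w, u w⟫_ℝ) (fun _ => 0) z :=
    (HasDirDeriv.const (1 : ℝ)).congr_of_eventuallyEq (by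
      filter_upwards [hn] with w hw
      rw [real_inner_self_eq_norm_sq, hw, one_pow])
  have := h1.unique h2 X
  rw [real_inner_comm (u z) (u' X)] at this
  linarith

namespace IsOsculating

theorem inner_u_W_one (h : IsOsculating U u W p q ρ) {z : ℂ} (hz : z ∈ U) (c : ℂ) :
    ⟪u z, W 1 z c⟫_ℝ = 0 :=
  (h.deriv_u z hz).inner_eq_zero_of_norm
    (Filter.mem_of_superset (h.isOpen.mem_nhds hz) fun w hw => h.norm_u w hw) c

/-- The derivative of a combination of `u, W 1, …, W r` is one of `u, W 1, …, W (r + 1)`. -/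
theorem comb_deriv (h : IsOsculating U u W p q ρ) {r : ℕ} {ξ : ℂ → E}
    (hξ : IsOscComb U u W r ξ) (X : ℂ) : IsOscComb U u W (r + 1) (fun z => fderiv ℝ ξ z X) := by
  obtain ⟨s, c, hs, hc, hξ⟩ := hξ
  have hD : ∀ z ∈ U, fderiv ℝ ξ z X = (s z • W 1 z X + fderiv ℝ s z X • u z) +
      ∑ k ∈ Finset.range r, ((W (k + 2) z (c k z * X) + W (k + 1) z (p (k + 1) z * c k z * X) +
        W k z (q (k + 1) z * c k z * starRingEnd ℂ X)) + W (k + 1) z (fderiv ℝ (c k) z X)) := by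
    intro z hz
    have h1 := ((hs.hasDirDeriv h.isOpen hz).smul (h.deriv_u z hz)).add
      (HasDirDeriv.sum (Finset.range r) (f := fun k w => W (k + 1) w (c k w)) fun k _ =>
        HasDirDeriv.linearMap_apply (fun d => h.deriv_W (k + 1) (by omega) z hz d)
          ((hc k).hasDirDeriv h.isOpen hz))
    exact (h1.congr_of_eventuallyEq
      (Filter.mem_of_superset (h.isOpen.mem_nhds hz) fun w hw => hξ w hw)).2 X
  refine IsOscComb.congr (((?_ : IsOscComb U u W (r + 1) fun z => s z • W 1 z X).add
    (IsOscComb.smul_u (hs.fderiv_apply_smooth h.isOpen X))).add (IsOscComb.sum _ fun k hk => ?_)) hD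
  · exact (IsOscComb.W_apply (k := 0) (c := fun z => s z • X) (by omega)
      (hs.smul contDiffOn_const)).congr fun z _ => by rw [map_smul]
  · have hk := Finset.mem_range.1 hk
    refine ((IsOscComb.W_apply (k := k + 1) (by omega) ((hc k).mul contDiffOn_const)).add
      (IsOscComb.W_apply (by omega)
        (((h.smooth_p (k + 1) (by omega)).mul (hc k)).mul contDiffOn_const)) |>.add ?_).add
      (IsOscComb.W_apply (by omega) ((hc k).fderiv_apply_smooth h.isOpen X))
    have hqc := ((h.smooth_q (k + 1) (by omega)).mul (hc k)).mul
      (contDiffOn_const (c := starRingEnd ℂ X))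
    rcases k with _ | k
    · refine (IsOscComb.smul_u (s := fun z => 2 * (q 1 z * c 0 z * starRingEnd ℂ X).re)
        (contDiffOn_const.mul (reCLM.contDiff.comp_contDiffOn hqc))).congr fun z hz => ?_
      rw [h.W_zero z hz]
    · exact IsOscComb.W_apply (by omega) hqc

theorem comb_smooth (h : IsOsculating U u W p q ρ) {r : ℕ} {ξ : ℂ → E}
    (hξ : IsOscComb U u W r ξ) : ContDiffOn ℝ ∞ ξ U := by
  obtain ⟨s, c, hs, hc, hξ⟩ := hξ
  exact ((hs.smul h.smooth_u).add (ContDiffOn.sum fun k _ =>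
    ContDiffOn.linearMap_apply (h.smooth_W (k + 1)) (hc k))).congr hξ

end IsOsculating

/-- For a conformal real linear map `L : ℂ → E` with `|L c|² = r |c|²`, the vector
`L (tangCoeff L r y)` is the orthogonal projection of `y` to the range of `L`. -/
def tangCoeff (L : ℂ →ₗ[ℝ] E) (r : ℝ) (y : E) : ℂ :=
  r⁻¹ • ((⟪y, L 1⟫_ℝ : ℂ) + (⟪y, L I⟫_ℝ : ℂ) * I)

theorem inner_tangCoeff {L : ℂ →ₗ[ℝ] E} {r : ℝ} (hr : 0 < r)
    (hL : ∀ c d, ⟪L c, L d⟫_ℝ = r * (c * starRingEnd ℂ d).re) (y : E) (c : ℂ) :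
    ⟪L (tangCoeff L r y), L c⟫_ℝ = ⟪y, L c⟫_ℝ := by
  rw [hL, L.apply_eq_re_im c, inner_add_right, inner_smul_right, inner_smul_right]
  simp [tangCoeff]
  field_simp

theorem normalSpace_starProjection [FiniteDimensional ℝ E] {u : ℂ → E} {z : ℂ} {L : ℂ →ₗ[ℝ] E}
    {r : ℝ} (hfd : ∀ X, fderiv ℝ u z X = L X) (hn : ‖u z‖ = 1) (hu : ∀ c, ⟪u z, L c⟫_ℝ = 0)
    (hr : 0 < r) (hL : ∀ c d, ⟪L c, L d⟫_ℝ = r * (c * starRingEnd ℂ d).re) (y : E) :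
    (normalSpace u z).starProjection y = y - ⟪u z, y⟫_ℝ • u z - L (tangCoeff L r y) := by
  have hfd' : (fderiv ℝ u z : ℂ →ₗ[ℝ] E) = L := LinearMap.ext hfd
  refine Submodule.eq_starProjection_of_mem_orthogonal ?_ ?_
  · refine (Submodule.mem_orthogonal _ _).2 fun v hv => ?_
    obtain ⟨a, ha, b, hb, rfl⟩ := Submodule.mem_sup.1 hv
    obtain ⟨t, rfl⟩ := Submodule.mem_span_singleton.1 ha
    obtain ⟨X, rfl⟩ := LinearMap.mem_range.1 hb
    rw [hfd']
    have h1 : ⟪L X, L (tangCoeff L r y)⟫_ℝ = ⟪L X, y⟫_ℝ := by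
      rw [real_inner_comm, inner_tangCoeff hr hL, real_inner_comm]
    have h2 : ⟪L X, u z⟫_ℝ = 0 := by rw [real_inner_comm, hu]
    simp [inner_add_left, inner_sub_right, inner_smul_left, inner_smul_right, hn, hu, h1, h2]
    ring
  · refine Submodule.le_orthogonal_orthogonal _ ?_
    rw [sub_sub, sub_sub_cancel]
    refine Submodule.add_mem_sup (Submodule.smul_mem _ _ (Submodule.mem_span_singleton_self _)) ?_
    exact ⟨tangCoeff L r y, hfd _⟩

namespace IsOsculating

variable [FiniteDimensional ℝ E]

/-- Projecting to the normal space changes a field only by multiples of `u` and `W 1`. -/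
theorem normalProj_sub_isOscComb (h : IsOsculating U u W p q ρ) {y : ℂ → E}
    (hy : ContDiffOn ℝ ∞ y U) {r : ℕ} (hr : 1 ≤ r) :
    IsOscComb U u W r (fun z => (normalSpace u z).starProjection (y z) - y z) := by
  have ht : ContDiffOn ℝ ∞ (fun z => -tangCoeff (W 1 z) (ρ z) (y z)) U := by
    refine (ContDiffOn.smul (h.smooth_ρ.inv fun z hz => (h.ρ_pos z hz).ne') ?_).neg
    exact (ofRealCLM.contDiff.comp_contDiffOn (hy.inner ℝ (h.smooth_W 1 1))).add
      ((ofRealCLM.contDiff.comp_contDiffOn (hy.inner ℝ (h.smooth_W 1 I))).mul contDiffOn_const)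
  refine ((IsOscComb.smul_u (h.smooth_u.inner ℝ hy).neg).add
    (IsOscComb.W_apply (k := 0) hr ht)).congr fun z hz => ?_
  rw [normalSpace_starProjection (h.deriv_u z hz).2 (h.norm_u z hz) (h.inner_u_W_one hz)
    (h.ρ_pos z hz) (h.inner_W_one z hz), map_neg, neg_smul]
  simp only [zero_add]
  abel

/-- The iterated normal derivatives are `W (r + 1)` up to terms of lower order. -/
theorem preForm_sub_isOscComb (h : IsOsculating U u W p q ρ) (r : ℕ) (X : Fin (r + 1) → ℂ) :
    IsOscComb U u W r (fun z => preForm u r X z - W (r + 1) z (∏ i, X i)) := by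
  induction r with
  | zero =>
    refine IsOscComb.zero.congr fun z hz => ?_
    simp [preForm, (h.deriv_u z hz).2]
  | succ r ih =>
    specialize ih (Fin.init X)
    set P : ℂ := ∏ i, Fin.init X i
    set x := X (Fin.last (r + 1))
    have hP : ∏ i, X i = P * x := Fin.prod_univ_castSucc X
    have hpre : ContDiffOn ℝ ∞ (preForm u r (Fin.init X)) U :=
      ((h.comb_smooth ih).add (h.smooth_W (r + 1) P)).congr fun z _ => by simp
    have hD : ∀ z ∈ U, fderiv ℝ (preForm u r (Fin.init X)) z x =
        W (r + 2) z (P * x) + W (r + 1) z (p (r + 1) z * P * x) +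
          W r z (q (r + 1) z * P * starRingEnd ℂ x) +
        fderiv ℝ (fun z => preForm u r (Fin.init X) z - W (r + 1) z P) z x := by
      intro z hz
      have h1 := (h.deriv_W (r + 1) (by omega) z hz P).add
        ((h.comb_smooth ih).hasDirDeriv h.isOpen hz)
      simpa using h1.2 x
    have hlow : IsOscComb U u W (r + 1) fun z => W r z (q (r + 1) z * P * starRingEnd ℂ x) := by
      have hqc := ((h.smooth_q (r + 1) (by omega)).mul (contDiffOn_const (c := P))).mul
        (contDiffOn_const (c := starRingEnd ℂ x))
      rcases r with _ | r
      · refine (IsOscComb.smul_u (s := fun z => 2 * (q 1 z * P * starRingEnd ℂ x).re)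
          (contDiffOn_const.mul (reCLM.contDiff.comp_contDiffOn hqc))).congr fun z hz => ?_
        rw [h.W_zero z hz]
      · exact IsOscComb.W_apply (by omega) hqc
    refine (((IsOscComb.W_apply (r := r + 1) (k := r) le_rfl
        (((h.smooth_p (r + 1) (by omega)).mul (contDiffOn_const (c := P))).mul
          (contDiffOn_const (c := x)))).add
        hlow).add (h.comb_deriv ih x)).add (h.normalProj_sub_isOscComb
          (hpre.fderiv_apply_smooth h.isOpen x) (Nat.le_add_left 1 r)) |>.congr fun z hz => ?_
    rw [hP]
    simp only [preForm]
    change (normalSpace u z).starProjection (fderiv ℝ (preForm u r (Fin.init X)) z x) -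
      W (r + 2) z (P * x) = _
    nth_rewrite 3 [hD z hz]
    abel

theorem inner_u_preForm (h : IsOsculating U u W p q ρ) {z : ℂ} (hz : z ∈ U) (r : ℕ)
    (X : Fin (r + 1) → ℂ) : ⟪u z, preForm u r X z⟫_ℝ = 0 := by
  cases r with
  | zero => rw [preForm, (h.deriv_u z hz).2]; exact h.inner_u_W_one hz _
  | succ r =>
    exact (Submodule.mem_orthogonal _ _).1 (Submodule.starProjection_apply_mem _ _) _
      (Submodule.mem_sup_left (Submodule.mem_span_singleton_self _))

theorem _root_.starProjection_sup_span {K L : Submodule ℝ E} {v y : E} (hK : K ≤ (ℝ ∙ v)ᗮ)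
    (hL : K ⊔ ℝ ∙ v = L) (hy : ⟪v, y⟫_ℝ = 0) : Kᗮ.starProjection y = Lᗮ.starProjection y := by
  subst hL
  symm
  refine Submodule.eq_starProjection_of_mem_orthogonal ?_ ?_
  · rw [← Submodule.inf_orthogonal]
    refine ⟨Submodule.starProjection_apply_mem _ _,
      Submodule.mem_orthogonal_singleton_iff_inner_right.2 ?_⟩
    have := Submodule.mem_orthogonal_singleton_iff_inner_right.1
      (hK (Submodule.starProjection_apply_mem K y))
    simp [inner_sub_right, hy, this]
  · refine Submodule.le_orthogonal_orthogonal _ (Submodule.mem_sup_left ?_)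
    simp

theorem _root_.sup_range_starProjection {K : Submodule ℝ E} (L : ℂ →ₗ[ℝ] E) :
    K ⊔ LinearMap.range ((Kᗮ.starProjection : E →ₗ[ℝ] E) ∘ₗ L) = K ⊔ LinearMap.range L := by
  apply le_antisymm
  · refine sup_le le_sup_left ?_
    rintro _ ⟨c, rfl⟩
    simp only [LinearMap.comp_apply, ContinuousLinearMap.coe_coe,
      Submodule.starProjection_orthogonal_val]
    exact sub_mem (Submodule.mem_sup_right ⟨c, rfl⟩)
      (Submodule.mem_sup_left (Submodule.starProjection_apply_mem _ _))
  · refine sup_le le_sup_left ?_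
    rintro _ ⟨c, rfl⟩
    rw [show L c = K.starProjection (L c) + Kᗮ.starProjection (L c) by simp]
    exact Submodule.add_mem_sup (Submodule.starProjection_apply_mem _ _) ⟨c, rfl⟩

/-- The sum of the tangent plane and the lower normal spaces differs from the osculating space only
by the position vector; this and the formula for the fundamental form imply one another, order by
order. -/
theorem lowerSpace_aux (h : IsOsculating U u W p q ρ) {z : ℂ} (hz : z ∈ U) (r : ℕ) :
    (lowerSpace u r z ≤ (ℝ ∙ u z)ᗮ ∧ lowerSpace u r z ⊔ (ℝ ∙ u z) = oscSpace u W r z) ∧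
    ∀ X, fundForm u r X z = (oscSpace u W r z)ᗮ.starProjection (W (r + 1) z (∏ i, X i)) := by
  have key : ∀ r, (lowerSpace u r z ≤ (ℝ ∙ u z)ᗮ ∧
      lowerSpace u r z ⊔ (ℝ ∙ u z) = oscSpace u W r z) →
      ∀ X, fundForm u r X z =
        (oscSpace u W r z)ᗮ.starProjection (W (r + 1) z (∏ i, X i)) := by
    rintro r ⟨h1, h2⟩ X
    rw [fundForm, starProjection_sup_span h1 h2 (h.inner_u_preForm hz r X)]
    exact Submodule.starProjection_orthogonal_sub_mem _
      ((h.preForm_sub_isOscComb r X).mem_oscSpace hz)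
  have hlow : lowerSpace u r z ≤ (ℝ ∙ u z)ᗮ ∧
      lowerSpace u r z ⊔ (ℝ ∙ u z) = oscSpace u W r z := by
    induction r with
    | zero => exact ⟨bot_le, by simp [lowerSpace, oscSpace]⟩
    | succ r ih =>
      have hspan : Submodule.span ℝ (Set.range fun X : Fin (r + 1) → ℂ =>
          (lowerSpace u r z)ᗮ.starProjection (preForm u r X z)) =
          LinearMap.range (((oscSpace u W r z)ᗮ.starProjection : E →ₗ[ℝ] E) ∘ₗ W (r + 1) z) := by
        rw [← Submodule.span_eq (LinearMap.range _)]
        congr 1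
        ext v
        constructor
        · rintro ⟨X, rfl⟩
          exact ⟨∏ i, X i, (key r ih X).symm⟩
        · rintro ⟨c, rfl⟩
          exact ⟨Fin.cons c fun _ => 1, (key r ih _).trans (by simp [Fin.prod_univ_succ])⟩
      constructor
      · rw [lowerSpace, hspan]
        refine sup_le ih.1 ?_
        rintro _ ⟨c, rfl⟩
        refine Submodule.mem_orthogonal_singleton_iff_inner_right.2 ?_
        exact (Submodule.mem_orthogonal _ _).1 (Submodule.starProjection_apply_mem _ _) _
          (u_mem_oscSpace u W r z)
      · rw [lowerSpace, hspan, sup_right_comm, ih.2, sup_range_starProjection, oscSpace]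
  exact ⟨hlow, key r hlow⟩

/-- The `(r+1)`-th fundamental form is the part of `W (r + 1)` orthogonal to
`u, W 1, …, W r`. -/
theorem fundForm_eq (h : IsOsculating U u W p q ρ) {z : ℂ} (hz : z ∈ U) (r : ℕ)
    (X : Fin (r + 1) → ℂ) :
    fundForm u r X z = (oscSpace u W r z)ᗮ.starProjection (W (r + 1) z (∏ i, X i)) :=
  (h.lowerSpace_aux hz r).2 X

end IsOsculating

end Osculating

/-! ### Invariants of a fundamental form of type `X ↦ L (∏ X)` -/

section Invariants

variable {E : Type*} [NormedAddCommGroup E] [InnerProductSpace ℝ E]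

/-- The Hopf differential of a form that depends only on the product of its arguments: the products
of the coefficients of `∂` sum to the components `1/2` and `-i/2` of `∂` itself. -/
theorem hopfCoeff_of_fundForm_eq [FiniteDimensional ℝ E] {u : ℂ → E} {z : ℂ} {r : ℕ}
    (L : ℂ →ₗ[ℝ] E) (h : ∀ X, fundForm u r X z = L (∏ i, X i)) :
    hopfCoeff u r z =
      ((⟪L 1, L 1⟫_ℝ : ℂ) - (⟪L I, L I⟫_ℝ : ℂ) - 2 * I * (⟪L 1, L I⟫_ℝ : ℂ)) / 4 := by
  obtain ⟨e, he⟩ : ∃ e : Fin 2 → ℂ, e = ![1, I] := ⟨_, rfl⟩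
  obtain ⟨c, hc⟩ : ∃ c : Fin 2 → ℂ, c = ![1 / 2, -I / 2] := ⟨_, rfl⟩
  obtain ⟨A, hA⟩ : ∃ A : ℂ, A = ∑ ε : Fin (r + 1) → Fin 2,
    (∏ i, c (ε i)) * ((∏ i, e (ε i)).re : ℂ) := ⟨_, rfl⟩
  obtain ⟨B, hB⟩ : ∃ B : ℂ, B = ∑ ε : Fin (r + 1) → Fin 2,
    (∏ i, c (ε i)) * ((∏ i, e (ε i)).im : ℂ) := ⟨_, rfl⟩
  -- `A` and `B` are the components of `∂^{r+1}` along `1` and `i`; the two relations are the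
  -- expansions of `(∂ z)^{r+1} = 1` and `(∂ z̄)^{r+1} = 0`
  have h1 : A + B * I = 1 := by
    rw [hA, hB, Finset.sum_mul, ← Finset.sum_add_distrib]
    calc _ = ∑ ε : Fin (r + 1) → Fin 2, ∏ i, c (ε i) * e (ε i) := by
          refine Finset.sum_congr rfl fun ε _ => ?_
          rw [Finset.prod_mul_distrib, mul_assoc, ← mul_add, re_add_im]
      _ = (∑ j, c j * e j) ^ (r + 1) := (Fintype.sum_pow (fun j => c j * e j) _).symm
      _ = 1 := by
          have : ∑ j, c j * e j = 1 := by
            rw [Fin.sum_univ_two, hc, he]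
            simp only [Matrix.cons_val_zero, Matrix.cons_val_one]
            linear_combination (-1 / 2 : ℂ) * I_sq
          simp [this]
  have h2 : A - B * I = 0 := by
    rw [hA, hB, Finset.sum_mul, ← Finset.sum_sub_distrib]
    calc _ = ∑ ε : Fin (r + 1) → Fin 2, ∏ i, c (ε i) * starRingEnd ℂ (e (ε i)) := by
          refine Finset.sum_congr rfl fun ε _ => ?_
          rw [Finset.prod_mul_distrib, mul_assoc, ← mul_sub, ← map_prod]
          congr 1
          generalize ∏ i, e (ε i) = w
          apply Complex.ext <;> simp
      _ = (∑ j, c j * starRingEnd ℂ (e j)) ^ (r + 1) :=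
          (Fintype.sum_pow (fun j => c j * starRingEnd ℂ (e j)) _).symm
      _ = 0 := by
          have : ∑ j, c j * starRingEnd ℂ (e j) = 0 := by
            rw [Fin.sum_univ_two, hc, he]
            simp only [Matrix.cons_val_zero, Matrix.cons_val_one, map_one, conj_I]
            linear_combination (1 / 2 : ℂ) * I_sq
          simp [this]
  have hAv : A = 1 / 2 := by linear_combination (h1 + h2) / 2
  have hBv : B = -I / 2 := by linear_combination (-I / 2) * (h1 - h2) + B * I_sq
  have key : hopfCoeff u r z = A * A * (⟪L 1, L 1⟫_ℝ : ℂ) + 2 * (A * B) * (⟪L 1, L I⟫_ℝ : ℂ) +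
      B * B * (⟪L I, L I⟫_ℝ : ℂ) := by
    have expand : ∀ a b : ℂ, (⟪L a, L b⟫_ℝ : ℂ) = (a.re : ℂ) * b.re * (⟪L 1, L 1⟫_ℝ : ℂ) +
        ((a.re : ℂ) * b.im + (a.im : ℂ) * b.re) * (⟪L 1, L I⟫_ℝ : ℂ) +
        (a.im : ℂ) * b.im * (⟪L I, L I⟫_ℝ : ℂ) := by
      intro a b
      rw [L.apply_eq_re_im a, L.apply_eq_re_im b]
      simp only [inner_add_left, inner_add_right, inner_smul_left, inner_smul_right,
        real_inner_comm (L 1) (L I)]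
      push_cast
      simp
      ring
    have : hopfCoeff u r z = ∑ ε : Fin (r + 1) → Fin 2, ∑ δ : Fin (r + 1) → Fin 2,
        (∏ i, c (ε i)) * (∏ i, c (δ i)) *
          (⟪L (∏ i, e (ε i)), L (∏ i, e (δ i))⟫_ℝ : ℂ) := by
      subst he hc
      refine Finset.sum_congr rfl fun ε _ => Finset.sum_congr rfl fun δ _ => ?_
      rw [h, h]
      rfl
    rw [this, show 2 * (A * B) = A * B + B * A by ring, hA, hB]
    simp only [Finset.sum_mul_sum]
    simp only [Finset.sum_mul, ← Finset.sum_add_distrib]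
    refine Finset.sum_congr rfl fun ε _ => Finset.sum_congr rfl fun δ _ => ?_
    rw [expand (∏ i, e (ε i)) (∏ i, e (δ i))]
    ring
  rw [key, hAv, hBv]
  linear_combination ((⟪L I, L I⟫_ℝ : ℂ) / 4) * I_sq

theorem LinearMap.norm_sq_add_norm_sq_I_mul (L : ℂ →ₗ[ℝ] E) (c : ℂ) :
    ‖L c‖ ^ 2 + ‖L (I * c)‖ ^ 2 = (‖L 1‖ ^ 2 + ‖L I‖ ^ 2) * normSq c := by
  rw [L.apply_eq_re_im c, L.apply_eq_re_im (I * c), norm_add_sq_real, norm_add_sq_real]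
  simp only [norm_smul, inner_smul_left, inner_smul_right, mul_pow, normSq_apply, Real.norm_eq_abs,
    sq_abs]
  simp
  ring

/-- An orthonormal pair for the metric `r |dz|²` consists of `e₀` and `± i e₀`. -/
theorem frame_eq {e : Fin 2 → ℂ} {r : ℝ} (hr : 0 < r)
    (he : ∀ i j, r * (e i * starRingEnd ℂ (e j)).re = if i = j then 1 else 0) :
    normSq (e 0) = r⁻¹ ∧ (e 1 = I * e 0 ∨ e 1 = -(I * e 0)) := by
  have h0 : normSq (e 0) = r⁻¹ := by
    have := he 0 0
    rw [mul_conj] at this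
    simp only [ofReal_re, if_true] at this
    field_simp
    linarith
  have h1 : normSq (e 1) = r⁻¹ := by
    have := he 1 1
    rw [mul_conj] at this
    simp only [ofReal_re, if_true] at this
    field_simp
    linarith
  have h2 : (e 0 * starRingEnd ℂ (e 1)).re = 0 := by
    have := he 0 1
    simpa [hr.ne'] using this
  refine ⟨h0, ?_⟩
  have h3 : (e 1 - I * e 0) * (e 1 + I * e 0) = 0 := by
    have ha : normSq (e 1) = normSq (e 0) := h1.trans h0.symm
    rw [normSq_apply, normSq_apply] at ha
    simp only [mul_re, conj_re, conj_im] at h2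
    have hpos : 0 < (e 0).re ^ 2 + (e 0).im ^ 2 := by
      rw [normSq_apply] at h0
      have := inv_pos.2 hr
      nlinarith
    -- a vector orthogonal to `e₀` is a real multiple of `i e₀`
    obtain ⟨t, ht⟩ : ∃ t : ℝ, (e 1).re = -t * (e 0).im ∧ (e 1).im = t * (e 0).re := by
      refine ⟨((e 0).re * (e 1).im - (e 0).im * (e 1).re) / ((e 0).re ^ 2 + (e 0).im ^ 2), ?_, ?_⟩
      · field_simp
        linear_combination (e 0).re * h2
      · field_simp
        linear_combination (e 0).im * h2
    have ht2 : t ^ 2 = 1 := by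
      rw [ht.1, ht.2] at ha
      have : (t ^ 2 - 1) * ((e 0).re ^ 2 + (e 0).im ^ 2) = 0 := by linear_combination ha
      have := (mul_eq_zero.1 this).resolve_right hpos.ne'
      linarith
    have he1 : e 1 = t * (I * e 0) := by
      apply Complex.ext <;> simp [ht.1, ht.2]
    rw [he1]
    have : ((t : ℂ)) ^ 2 = 1 := by exact_mod_cast ht2
    linear_combination (I * e 0) ^ 2 * this
  rcases mul_eq_zero.1 h3 with h | h
  · exact Or.inl (sub_eq_zero.1 h)
  · exact Or.inr (eq_neg_of_add_eq_zero_left h)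

/-- By `frame_eq` the two choices of the first frame vector give values `L c` and `± L (i c)`, whose
squared norms add up to a quantity that depends only on `|c|`. -/
theorem sum_norm_sq_prod_frame {e : Fin 2 → ℂ} {r : ℝ} (hr : 0 < r)
    (he : ∀ i j, r * (e i * starRingEnd ℂ (e j)).re = if i = j then 1 else 0) (L : ℂ →ₗ[ℝ] E)
    (s : ℕ) :
    ∑ ε : Fin (s + 1) → Fin 2, ‖L (∏ i, (e ∘ ε) i)‖ ^ 2 =
      2 ^ s * (‖L 1‖ ^ 2 + ‖L I‖ ^ 2) / r ^ (s + 1) := by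
  obtain ⟨h0, h1⟩ := frame_eq hr he
  have hn : ∀ i, normSq (e i) = r⁻¹ := by
    intro i
    fin_cases i
    · exact h0
    · rcases h1 with h | h <;> simp [h, h0]
  rw [← (Fin.consEquiv fun _ : Fin (s + 1) => Fin 2).sum_comp, Fintype.sum_prod_type_right]
  have : ∀ δ : Fin s → Fin 2, ∑ i : Fin 2,
      ‖L (∏ j, (e ∘ (Fin.consEquiv fun _ : Fin (s + 1) => Fin 2) (i, δ)) j)‖ ^ 2 =
      (‖L 1‖ ^ 2 + ‖L I‖ ^ 2) / r ^ (s + 1) := by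
    intro δ
    have hp : normSq (∏ j, e (δ j)) = (r⁻¹) ^ s := by
      rw [map_prod]
      simp [hn]
    have hk := L.norm_sq_add_norm_sq_I_mul (e 0 * ∏ j, e (δ j))
    rw [normSq_mul, h0, hp] at hk
    have h2 : ‖L (e 1 * ∏ j, e (δ j))‖ = ‖L (I * (e 0 * ∏ j, e (δ j)))‖ := by
      rcases h1 with h | h
      · rw [h, mul_assoc]
      · rw [h, neg_mul, map_neg, norm_neg, mul_assoc]
    simp only [Fin.sum_univ_two, Fin.prod_univ_succ, Function.comp_apply, Fin.consEquiv_apply,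
      Fin.cons_zero, Fin.cons_succ]
    rw [h2, hk, pow_succ' r, div_eq_mul_inv, mul_inv, inv_pow]
  simp only [this]
  simp
  ring

theorem convexHull_image_sphere (L : ℂ →ₗ[ℝ] E) {R : ℝ} (hR : 0 ≤ R) :
    convexHull ℝ (L '' Metric.sphere 0 R) = L '' Metric.closedBall 0 R := by
  rw [← L.image_convexHull, convexHull_sphere_eq_closedBall _ hR]

/-- The area of the region bounded by an ellipse, given as the image of a circle. -/
theorem measure_convexHull_image_sphere [MeasurableSpace E] [BorelSpace E] (L : ℂ →ₗ[ℝ] E)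
    {R : ℝ} (hR : 0 ≤ R) :
    (μHE[2] (convexHull ℝ (L '' Metric.sphere 0 R))).toReal = L.normDet * (Real.pi * R ^ 2) := by
  rw [convexHull_image_sphere L hR]
  have := L.euclideanHausdorffMeasure_image_eq_normDet_mul_volume (Metric.closedBall 0 R)
  rw [Complex.finrank_real_complex] at this
  rw [this, ENNReal.toReal_mul, ENNReal.toReal_ofReal L.normDet_nonneg, Complex.volume_closedBall]
  simp [ENNReal.toReal_ofReal hR, NNReal.coe_real_pi, mul_comm]

/-- The powers of the unit vectors of the metric `r |dz|²` fill a circle. -/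
theorem image_unit_eq_sphere (L : ℂ →ₗ[ℝ] E) {r : ℝ} (hr : 0 < r) (s : ℕ) :
    {v | ∃ Z : ℂ, r * normSq Z = 1 ∧ v = L (Z ^ (s + 1))} =
      L '' Metric.sphere 0 (Real.sqrt r ^ (s + 1))⁻¹ := by
  ext v
  constructor
  · rintro ⟨Z, hZ, rfl⟩
    refine ⟨_, ?_, rfl⟩
    have : ‖Z‖ = (Real.sqrt r)⁻¹ := by
      rw [normSq_eq_norm_sq] at hZ
      have h1 : (Real.sqrt r * ‖Z‖) ^ 2 = 1 := by rw [mul_pow, Real.sq_sqrt hr.le, hZ]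
      have h2 : Real.sqrt r * ‖Z‖ = 1 := by
        exact (pow_eq_one_iff_of_nonneg (by positivity) two_ne_zero).1 h1
      field_simp
      linarith
    simp [this]
  · rintro ⟨w, hw, rfl⟩
    obtain ⟨Z, hZ⟩ := IsAlgClosed.exists_pow_nat_eq w (Nat.succ_pos s)
    refine ⟨Z, ?_, by rw [← hZ]⟩
    have hw' : ‖w‖ = (Real.sqrt r ^ (s + 1))⁻¹ := by simpa using hw
    rw [← hZ, norm_pow, ← inv_pow] at hw'
    have : ‖Z‖ = (Real.sqrt r)⁻¹ :=
      (pow_left_inj₀ (norm_nonneg _) (by positivity) (Nat.succ_ne_zero s)).1 hw'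
    rw [normSq_eq_norm_sq, this, inv_pow, Real.sq_sqrt hr.le, mul_inv_cancel₀ hr.ne']

end Invariants

/-! ### Structure equations of a minimal surface with circular first curvature ellipse -/

section Structure

variable {E : Type*} [NormedAddCommGroup E] [InnerProductSpace ℝ E]

/-- The complex derivative `∂ log ρ`. -/
def dLog (ρ : ℂ → ℝ) (z : ℂ) : ℂ :=
  (2 * ρ z)⁻¹ • ((fderiv ℝ ρ z 1 : ℂ) - (fderiv ℝ ρ z I : ℂ) * I)

theorem dLog_spec {ρ : ℂ → ℝ} {z : ℂ} (h : 0 < ρ z) (X : ℂ) :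
    fderiv ℝ ρ z X = 2 * ρ z * (dLog ρ z * X).re := by
  have h1 : fderiv ℝ ρ z X = X.re • fderiv ℝ ρ z 1 + X.im • fderiv ℝ ρ z I :=
    LinearMap.apply_eq_re_im (fderiv ℝ ρ z : ℂ →ₗ[ℝ] ℝ) X
  rw [h1, dLog]
  simp
  field_simp

theorem dLog_smooth {U : Set ℂ} (hU : IsOpen U) {ρ : ℂ → ℝ} (hρ : ContDiffOn ℝ ∞ ρ U)
    (h : ∀ z ∈ U, 0 < ρ z) : ContDiffOn ℝ ∞ (dLog ρ) U := by
  refine ContDiffOn.smul ((contDiffOn_const.mul hρ).inv fun z hz => by simp [(h z hz).ne']) ?_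
  exact (ofRealCLM.contDiff.comp_contDiffOn (hρ.fderiv_apply_smooth hU 1)).sub
    ((ofRealCLM.contDiff.comp_contDiffOn (hρ.fderiv_apply_smooth hU I)).mul contDiffOn_const)

theorem tangCoeff_eq {L : ℂ →ₗ[ℝ] E} {r : ℝ} (hr : 0 < r) {y : E} {a : ℂ}
    (h : ∀ d, ⟪y, L d⟫_ℝ = r * (a * starRingEnd ℂ d).re) : tangCoeff L r y = a := by
  rw [tangCoeff, h, h]
  apply Complex.ext <;> simp <;> field_simp

theorem fderiv_fderiv_symm {F : Type*} [NormedAddCommGroup F] [NormedSpace ℝ F] {f : ℂ → F}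
    {U : Set ℂ} (hU : IsOpen U) (hf : ContDiffOn ℝ ∞ f U) {z : ℂ} (hz : z ∈ U) (a b : ℂ) :
    fderiv ℝ (fun w => fderiv ℝ f w a) z b = fderiv ℝ (fun w => fderiv ℝ f w b) z a := by
  have hsymm : IsSymmSndFDerivAt ℝ f z :=
    (hf.contDiffAt (hU.mem_nhds hz)).isSymmSndFDerivAt
      (by simpa using! WithTop.coe_le_coe.2 (le_top : (2 : ℕ∞) ≤ ⊤))
  have hd : DifferentiableAt ℝ (fderiv ℝ f) z :=
    ((hf.fderiv_of_isOpen hU (m := ∞) (by simp)).contDiffAt (hU.mem_nhds hz)).differentiableAt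
      (by simp)
  have key : ∀ a b, fderiv ℝ (fun w => fderiv ℝ f w a) z b = fderiv ℝ (fderiv ℝ f) z b a := by
    intro a b
    have := (hd.hasFDerivAt.clm_apply (hasFDerivAt_const a z)).fderiv
    rw [this]
    simp
  rw [key, key]
  exact hsymm.eq b a

/-- A minimal surface in the unit sphere whose first curvature ellipse is a circle, in a complex
coordinate: `W₁` is the differential, `W₂` is the second fundamental form, as a function of the
product of its arguments, and both are conformal. -/
structure IsIsotropicChart [FiniteDimensional ℝ E] (U : Set ℂ) (u : ℂ → E)
    (W₁ W₂ : ℂ → ℂ →ₗ[ℝ] E) (ρ₁ ρ₂ : ℂ → ℝ) : Prop where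
  isOpen : IsOpen U
  smooth_u : ContDiffOn ℝ ∞ u U
  norm_u : ∀ z ∈ U, ‖u z‖ = 1
  deriv_u : ∀ z ∈ U, HasDirDeriv u (fun X => W₁ z X) z
  ρ₁_pos : ∀ z ∈ U, 0 < ρ₁ z
  inner_W₁ : ∀ z ∈ U, ∀ c d, ⟪W₁ z c, W₁ z d⟫_ℝ = ρ₁ z * (c * starRingEnd ℂ d).re
  normal_W₁ : ∀ z ∈ U, ∀ c X,
    (normalSpace u z).starProjection (fderiv ℝ (fun w => W₁ w c) z X) = W₂ z (c * X)
  inner_W₂ : ∀ z ∈ U, ∀ c d, ⟪W₂ z c, W₂ z d⟫_ℝ = ρ₂ z * (c * starRingEnd ℂ d).re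

namespace IsIsotropicChart

variable [FiniteDimensional ℝ E] {U : Set ℂ} {u : ℂ → E} {W₁ W₂ : ℂ → ℂ →ₗ[ℝ] E} {ρ₁ ρ₂ : ℂ → ℝ}

theorem smooth_W₁ (h : IsIsotropicChart U u W₁ W₂ ρ₁ ρ₂) (c : ℂ) :
    ContDiffOn ℝ ∞ (fun z => W₁ z c) U :=
  (h.smooth_u.fderiv_apply_smooth h.isOpen c).congr fun z hz => ((h.deriv_u z hz).2 c).symm

theorem smooth_ρ₁ (h : IsIsotropicChart U u W₁ W₂ ρ₁ ρ₂) : ContDiffOn ℝ ∞ ρ₁ U :=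
  ((h.smooth_W₁ 1).inner ℝ (h.smooth_W₁ 1)).congr fun z hz => by
    rw [h.inner_W₁ z hz]; simp

theorem eventually_mem (h : IsIsotropicChart U u W₁ W₂ ρ₁ ρ₂) {z : ℂ} (hz : z ∈ U) :
    ∀ᶠ w in nhds z, w ∈ U := h.isOpen.mem_nhds hz

theorem inner_u_u (h : IsIsotropicChart U u W₁ W₂ ρ₁ ρ₂) {z : ℂ} (hz : z ∈ U) :
    ⟪u z, u z⟫_ℝ = 1 := by rw [real_inner_self_eq_norm_sq, h.norm_u z hz, one_pow]

theorem inner_u_W₁ (h : IsIsotropicChart U u W₁ W₂ ρ₁ ρ₂) {z : ℂ} (hz : z ∈ U) (c : ℂ) :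
    ⟪u z, W₁ z c⟫_ℝ = 0 :=
  (h.deriv_u z hz).inner_eq_zero_of_norm
    ((h.eventually_mem hz).mono fun w hw => h.norm_u w hw) c

theorem W₂_mem (h : IsIsotropicChart U u W₁ W₂ ρ₁ ρ₂) {z : ℂ} (hz : z ∈ U) (c : ℂ) :
    W₂ z c ∈ normalSpace u z := by
  have := h.normal_W₁ z hz c 1
  rw [mul_one] at this
  rw [← this]
  exact Submodule.starProjection_apply_mem _ _

theorem inner_u_W₂ (h : IsIsotropicChart U u W₁ W₂ ρ₁ ρ₂) {z : ℂ} (hz : z ∈ U) (c : ℂ) :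
    ⟪u z, W₂ z c⟫_ℝ = 0 :=
  (Submodule.mem_orthogonal _ _).1 (h.W₂_mem hz c) _
    (Submodule.mem_sup_left (Submodule.mem_span_singleton_self _))

theorem inner_W₁_W₂ (h : IsIsotropicChart U u W₁ W₂ ρ₁ ρ₂) {z : ℂ} (hz : z ∈ U) (c d : ℂ) :
    ⟪W₁ z c, W₂ z d⟫_ℝ = 0 :=
  (Submodule.mem_orthogonal _ _).1 (h.W₂_mem hz d) _
    (Submodule.mem_sup_right ⟨c, (h.deriv_u z hz).2 c⟩)

theorem fderiv_W₁_symm (h : IsIsotropicChart U u W₁ W₂ ρ₁ ρ₂) {z : ℂ} (hz : z ∈ U) (c X : ℂ) :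
    fderiv ℝ (fun w => W₁ w c) z X = fderiv ℝ (fun w => W₁ w X) z c := by
  have e : ∀ c, (fun w => W₁ w c) =ᶠ[nhds z] fun w => fderiv ℝ u w c := fun c =>
    (h.eventually_mem hz).mono fun w hw => ((h.deriv_u w hw).2 c).symm
  rw [(e c).fderiv_eq, (e X).fderiv_eq]
  exact fderiv_fderiv_symm h.isOpen h.smooth_u hz c X

/-- Koszul's formula: the tangential part of the second derivatives. -/
theorem inner_fderiv_W₁ (h : IsIsotropicChart U u W₁ W₂ ρ₁ ρ₂) {z : ℂ} (hz : z ∈ U)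
    (c X d : ℂ) :
    ⟪fderiv ℝ (fun w => W₁ w c) z X, W₁ z d⟫_ℝ =
      ρ₁ z * (dLog ρ₁ z * c * X * starRingEnd ℂ d).re := by
  obtain ⟨a, ha⟩ : ∃ a : ℂ → ℂ → ℂ → ℝ, a = fun c X d =>
    ⟪fderiv ℝ (fun w => W₁ w c) z X, W₁ z d⟫_ℝ := ⟨_, rfl⟩
  have hs : ∀ c X d, a c X d = a X c d := fun c X d => by
    simp only [ha, h.fderiv_W₁_symm hz c X]
  have key : ∀ c d X, a d X c + a c X d =
      2 * ρ₁ z * (dLog ρ₁ z * X).re * (c * starRingEnd ℂ d).re := by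
    intro c d X
    have h1 := (((h.smooth_W₁ c).hasDirDeriv h.isOpen hz).inner
      ((h.smooth_W₁ d).hasDirDeriv h.isOpen hz))
    have h2 := (h.smooth_ρ₁.hasDirDeriv h.isOpen hz).mulReal
      (HasDirDeriv.const ((c * starRingEnd ℂ d).re))
    have h3 := h2.congr_of_eventuallyEq
      ((h.eventually_mem hz).mono fun w hw => h.inner_W₁ w hw c d)
    have h4 := h1.unique h3 X
    rw [dLog_spec (h.ρ₁_pos z hz), real_inner_comm] at h4
    simp only [ha]
    linarith
  have h2 : 2 * a c X d = 2 * ρ₁ z * (dLog ρ₁ z * X).re * (c * starRingEnd ℂ d).re +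
      2 * ρ₁ z * (dLog ρ₁ z * c).re * (X * starRingEnd ℂ d).re -
      2 * ρ₁ z * (dLog ρ₁ z * d).re * (c * starRingEnd ℂ X).re := by
    linarith [key c d X, key X d c, key c X d, hs c X d, hs X d c, hs c d X]
  have h3 : a c X d = ρ₁ z * (dLog ρ₁ z * c * X * starRingEnd ℂ d).re := by
    have : 2 * a c X d = 2 * (ρ₁ z * (dLog ρ₁ z * c * X * starRingEnd ℂ d).re) := by
      rw [h2]
      simp
      ring
    linarith
  simpa only [ha] using h3

theorem deriv_W₁ (h : IsIsotropicChart U u W₁ W₂ ρ₁ ρ₂) {z : ℂ} (hz : z ∈ U) (c : ℂ) :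
    HasDirDeriv (fun w => W₁ w c) (fun X => W₂ z (c * X) + W₁ z (dLog ρ₁ z * c * X) -
      (ρ₁ z * (c * starRingEnd ℂ X).re) • u z) z := by
  refine ((h.smooth_W₁ c).hasDirDeriv h.isOpen hz).congr_deriv fun X => ?_
  rw [← h.normal_W₁ z hz c X, normalSpace_starProjection (h.deriv_u z hz).2 (h.norm_u z hz)
    (h.inner_u_W₁ hz) (h.ρ₁_pos z hz) (h.inner_W₁ z hz),
    tangCoeff_eq (h.ρ₁_pos z hz) (h.inner_fderiv_W₁ hz c X)]
  have h1 := (h.deriv_u z hz).inner ((h.smooth_W₁ c).hasDirDeriv h.isOpen hz)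
  have h2 : HasDirDeriv (fun w => ⟪u w, W₁ w c⟫_ℝ) (fun _ => 0) z :=
    (HasDirDeriv.const (0 : ℝ)).congr_of_eventuallyEq
      ((h.eventually_mem hz).mono fun w hw => h.inner_u_W₁ hw c)
  have h3 := h1.unique h2 X
  rw [h.inner_W₁ z hz] at h3
  have h4 : ⟪u z, fderiv ℝ (fun w => W₁ w c) z X⟫_ℝ = -(ρ₁ z * (c * starRingEnd ℂ X).re) := by
    rw [eq_neg_iff_add_eq_zero, ← h3]
    simp only [mul_re, conj_re, conj_im]
    ring
  rw [h4, neg_smul]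
  abel

theorem smooth_dLog (h : IsIsotropicChart U u W₁ W₂ ρ₁ ρ₂) : ContDiffOn ℝ ∞ (dLog ρ₁) U :=
  dLog_smooth h.isOpen h.smooth_ρ₁ h.ρ₁_pos

theorem smooth_W₂ (h : IsIsotropicChart U u W₁ W₂ ρ₁ ρ₂) (c : ℂ) :
    ContDiffOn ℝ ∞ (fun z => W₂ z c) U := by
  have h1 : ContDiffOn ℝ ∞ (fun z => fderiv ℝ (fun w => W₁ w c) z 1 - W₁ z (dLog ρ₁ z * c) +
      (ρ₁ z * c.re) • u z) U :=
    (((h.smooth_W₁ c).fderiv_apply_smooth h.isOpen 1).sub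
      (ContDiffOn.linearMap_apply h.smooth_W₁ (h.smooth_dLog.mul contDiffOn_const))).add
      ((h.smooth_ρ₁.mul contDiffOn_const).smul h.smooth_u)
  refine h1.congr fun z hz => ?_
  rw [(h.deriv_W₁ hz c).2]
  simp only [mul_one, map_one]
  abel

theorem smooth_ρ₂ (h : IsIsotropicChart U u W₁ W₂ ρ₁ ρ₂) : ContDiffOn ℝ ∞ ρ₂ U :=
  ((h.smooth_W₂ 1).inner ℝ (h.smooth_W₂ 1)).congr fun z hz => by
    rw [h.inner_W₂ z hz]; simp

theorem inner_u_fderiv_W₂ (h : IsIsotropicChart U u W₁ W₂ ρ₁ ρ₂) {z : ℂ} (hz : z ∈ U) (c X : ℂ) :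
    ⟪u z, fderiv ℝ (fun w => W₂ w c) z X⟫_ℝ = 0 := by
  have h1 := (h.deriv_u z hz).inner ((h.smooth_W₂ c).hasDirDeriv h.isOpen hz)
  have h2 : HasDirDeriv (fun w => ⟪u w, W₂ w c⟫_ℝ) (fun _ => 0) z :=
    (HasDirDeriv.const (0 : ℝ)).congr_of_eventuallyEq
      ((h.eventually_mem hz).mono fun w hw => h.inner_u_W₂ hw c)
  have h3 := h1.unique h2 X
  rwa [h.inner_W₁_W₂ hz, add_zero] at h3

theorem inner_W₁_fderiv_W₂ (h : IsIsotropicChart U u W₁ W₂ ρ₁ ρ₂) {z : ℂ} (hz : z ∈ U)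
    (c d X : ℂ) :
    ⟪W₁ z d, fderiv ℝ (fun w => W₂ w c) z X⟫_ℝ =
      -(ρ₂ z * (c * starRingEnd ℂ X * starRingEnd ℂ d).re) := by
  have h1 := (h.deriv_W₁ hz d).inner ((h.smooth_W₂ c).hasDirDeriv h.isOpen hz)
  have h2 : HasDirDeriv (fun w => ⟪W₁ w d, W₂ w c⟫_ℝ) (fun _ => 0) z :=
    (HasDirDeriv.const (0 : ℝ)).congr_of_eventuallyEq
      ((h.eventually_mem hz).mono fun w hw => h.inner_W₁_W₂ hw d c)
  have h3 := h1.unique h2 X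
  rw [inner_sub_left, inner_add_left, inner_smul_left, h.inner_W₂ z hz, h.inner_W₁_W₂ hz,
    h.inner_u_W₂ hz] at h3
  rw [eq_neg_iff_add_eq_zero, ← h3]
  simp only [mul_re, mul_im, conj_re, conj_im, mul_zero]
  ring

/-- Symmetry of the second derivatives of `W₁`, from which the Gauss and Codazzi equations are
read off. -/
theorem snd_fderiv_W₁ (h : IsIsotropicChart U u W₁ W₂ ρ₁ ρ₂) {z : ℂ} (hz : z ∈ U) (c X : ℂ) :
    HasDirDeriv (fun w => fderiv ℝ (fun w' => W₁ w' c) w X) (fun Y =>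
      fderiv ℝ (fun w => W₂ w (c * X)) z Y +
      ((W₂ z (dLog ρ₁ z * c * X * Y) + W₁ z (dLog ρ₁ z * (dLog ρ₁ z * c * X) * Y) -
        (ρ₁ z * (dLog ρ₁ z * c * X * starRingEnd ℂ Y).re) • u z) +
        W₁ z (fderiv ℝ (dLog ρ₁) z Y * c * X)) -
      ((ρ₁ z * (c * starRingEnd ℂ X).re) • W₁ z Y +
        (fderiv ℝ ρ₁ z Y * (c * starRingEnd ℂ X).re) • u z)) z := by
  have hp := h.smooth_dLog.hasDirDeriv h.isOpen hz
  have hr := h.smooth_ρ₁.hasDirDeriv h.isOpen hz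
  have h1 := (((h.smooth_W₂ (c * X)).hasDirDeriv h.isOpen hz).add
    (HasDirDeriv.linearMap_apply (fun d => h.deriv_W₁ hz d)
      ((hp.mul (HasDirDeriv.const c)).mul (HasDirDeriv.const X)))).sub
    ((hr.mulReal (HasDirDeriv.const ((c * starRingEnd ℂ X).re))).smul (h.deriv_u z hz))
  refine (h1.congr_of_eventuallyEq ((h.eventually_mem hz).mono fun w hw =>
    (h.deriv_W₁ hw c).2 X)).congr_deriv fun Y => ?_
  simp

theorem snd_fderiv_W₁_symm (h : IsIsotropicChart U u W₁ W₂ ρ₁ ρ₂) {z : ℂ} (hz : z ∈ U)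
    (c X Y : ℂ) : fderiv ℝ (fun w => fderiv ℝ (fun w' => W₁ w' c) w X) z Y =
      fderiv ℝ (fun w => fderiv ℝ (fun w' => W₁ w' c) w Y) z X :=
  fderiv_fderiv_symm h.isOpen (h.smooth_W₁ c) hz X Y

/-- The Gauss equation, in terms of `∂̄ ∂ log ρ₁`. -/
theorem gauss (h : IsIsotropicChart U u W₁ W₂ ρ₁ ρ₂) {z : ℂ} (hz : z ∈ U) :
    fderiv ℝ (dLog ρ₁) z 1 + fderiv ℝ (dLog ρ₁) z I * I =
      ((2 * ρ₂ z / ρ₁ z - ρ₁ z : ℝ) : ℂ) := by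
  have key : ∀ d, ⟪W₁ z d, fderiv ℝ (fun w => fderiv ℝ (fun w' => W₁ w' 1) w 1) z I⟫_ℝ =
      ⟪W₁ z d, fderiv ℝ (fun w => fderiv ℝ (fun w' => W₁ w' 1) w I) z 1⟫_ℝ := fun d => by
    rw [h.snd_fderiv_W₁_symm hz]
  simp only [(h.snd_fderiv_W₁ hz _ _).2, inner_add_right, inner_sub_right, inner_smul_right,
    h.inner_W₁_fderiv_W₂ hz, h.inner_W₁ z hz, h.inner_W₁_W₂ hz, real_inner_comm (u z),
    h.inner_u_W₁ hz] at key
  have hρ := h.ρ₁_pos z hz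
  have k1 := key 1
  have k2 := key I
  simp at k1 k2
  apply Complex.ext
  · simp
    field_simp
    linarith
  · simp
    refine mul_left_cancel₀ hρ.ne' ?_
    linarith

end IsIsotropicChart

/-- An isotropic chart of a surface in `S⁵` without totally geodesic points, with a unit normal
field `η` orthogonal to the first normal bundle. -/
structure IsFramedChart [FiniteDimensional ℝ E] (U : Set ℂ) (u : ℂ → E)
    (W₁ W₂ : ℂ → ℂ →ₗ[ℝ] E) (η : ℂ → E) (ρ₁ ρ₂ : ℂ → ℝ) : Prop
    extends IsIsotropicChart U u W₁ W₂ ρ₁ ρ₂ where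
  finrank_eq : Module.finrank ℝ E = 6
  ρ₂_pos : ∀ z ∈ U, 0 < ρ₂ z
  smooth_η : ContDiffOn ℝ ∞ η U
  norm_η : ∀ z ∈ U, ‖η z‖ = 1
  inner_u_η : ∀ z ∈ U, ⟪u z, η z⟫_ℝ = 0
  inner_W₁_η : ∀ z ∈ U, ∀ c, ⟪W₁ z c, η z⟫_ℝ = 0
  inner_W₂_η : ∀ z ∈ U, ∀ c, ⟪W₂ z c, η z⟫_ℝ = 0

/-- The coefficient of the third fundamental form: `α₃(∂, ∂, ∂) = thirdCoeff W₂ η • η`. -/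
def thirdCoeff (W₂ : ℂ → ℂ →ₗ[ℝ] E) (η : ℂ → E) (z : ℂ) : ℂ :=
  (2 : ℝ)⁻¹ • ((⟪fderiv ℝ (fun w => W₂ w 1) z 1, η z⟫_ℝ : ℂ) -
    (⟪fderiv ℝ (fun w => W₂ w I) z 1, η z⟫_ℝ : ℂ) * I)

namespace IsFramedChart

variable [FiniteDimensional ℝ E] {U : Set ℂ} {u : ℂ → E} {W₁ W₂ : ℂ → ℂ →ₗ[ℝ] E} {η : ℂ → E}
  {ρ₁ ρ₂ : ℂ → ℝ}

/-- `u z`, `η z` and the ranges of `W₁ z` and `W₂ z` span the ambient space. -/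
theorem exists_decomp (h : IsFramedChart U u W₁ W₂ η ρ₁ ρ₂) {z : ℂ} (hz : z ∈ U) (y : E) :
    ∃ (s t : ℝ) (a b : ℂ), y = s • u z + t • η z + W₁ z a + W₂ z b := by
  have huu := h.inner_u_u hz
  have hηη : ⟪η z, η z⟫_ℝ = 1 := by rw [real_inner_self_eq_norm_sq, h.norm_η z hz, one_pow]
  let T : (ℝ × ℝ) × (ℂ × ℂ) →ₗ[ℝ] E :=
    ((LinearMap.toSpanSingleton ℝ E (u z)).coprod (LinearMap.toSpanSingleton ℝ E (η z))).coprod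
      ((W₁ z).coprod (W₂ z))
  have hT : ∀ x, T x = x.1.1 • u z + x.1.2 • η z + (W₁ z x.2.1 + W₂ z x.2.2) := fun x => by
    simp [T]
  have hinj : Function.Injective T := by
    refine (injective_iff_map_eq_zero T).2 fun x hx => ?_
    have hn : ⟪T x, T x⟫_ℝ =
        x.1.1 ^ 2 + x.1.2 ^ 2 + (ρ₁ z * normSq x.2.1 + ρ₂ z * normSq x.2.2) := by
      rw [hT]
      simp only [inner_add_left, inner_add_right, inner_smul_left, inner_smul_right, huu, hηη,
        h.inner_u_η z hz, h.inner_W₁_η z hz, h.inner_W₂_η z hz, h.inner_u_W₁ hz, h.inner_u_W₂ hz,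
        h.inner_W₁_W₂ hz, h.inner_W₁ z hz, h.inner_W₂ z hz,
        real_inner_comm (u z) (W₁ z _), real_inner_comm (u z) (W₂ z _),
        real_inner_comm (u z) (η z), real_inner_comm (W₁ z _) (η z),
        real_inner_comm (W₂ z _) (η z), real_inner_comm (W₁ z _) (W₂ z _), mul_conj]
      simp
      ring
    rw [hx, inner_zero_left] at hn
    have h1 := mul_nonneg (h.ρ₁_pos z hz).le (normSq_nonneg x.2.1)
    have h2 := mul_nonneg (h.ρ₂_pos z hz).le (normSq_nonneg x.2.2)
    have e1 : x.1.1 = 0 := by nlinarith [sq_nonneg x.1.1, sq_nonneg x.1.2]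
    have e2 : x.1.2 = 0 := by nlinarith [sq_nonneg x.1.1, sq_nonneg x.1.2]
    have e3 : x.2.1 = 0 := normSq_eq_zero.1 <| by
      have : ρ₁ z * normSq x.2.1 = 0 := by nlinarith [sq_nonneg x.1.1, sq_nonneg x.1.2]
      exact (mul_eq_zero.1 this).resolve_left (h.ρ₁_pos z hz).ne'
    have e4 : x.2.2 = 0 := normSq_eq_zero.1 <| by
      have : ρ₂ z * normSq x.2.2 = 0 := by nlinarith [sq_nonneg x.1.1, sq_nonneg x.1.2]
      exact (mul_eq_zero.1 this).resolve_left (h.ρ₂_pos z hz).ne'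
    exact Prod.ext (Prod.ext e1 e2) (Prod.ext e3 e4)
  have hfin : Module.finrank ℝ ((ℝ × ℝ) × (ℂ × ℂ)) = Module.finrank ℝ E := by
    simp [h.finrank_eq]
  obtain ⟨x, hx⟩ := (LinearMap.injective_iff_surjective_of_finrank_eq_finrank hfin).1 hinj y
  exact ⟨x.1.1, x.1.2, x.2.1, x.2.2, by rw [← hx, hT]; abel⟩

/-- A vector is determined by its inner products with the frame. -/
theorem eq_of_inner (h : IsFramedChart U u W₁ W₂ η ρ₁ ρ₂) {z : ℂ} (hz : z ∈ U) {x y : E}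
    (h0 : ⟪u z, x⟫_ℝ = ⟪u z, y⟫_ℝ) (h1 : ∀ d, ⟪W₁ z d, x⟫_ℝ = ⟪W₁ z d, y⟫_ℝ)
    (h2 : ∀ d, ⟪W₂ z d, x⟫_ℝ = ⟪W₂ z d, y⟫_ℝ) (h3 : ⟪η z, x⟫_ℝ = ⟪η z, y⟫_ℝ) : x = y := by
  refine ext_inner_left ℝ fun v => ?_
  obtain ⟨s, t, a, b, rfl⟩ := h.exists_decomp hz v
  simp only [inner_add_left, inner_smul_left, h0, h1, h2, h3]

theorem inner_η_η (h : IsFramedChart U u W₁ W₂ η ρ₁ ρ₂) {z : ℂ} (hz : z ∈ U) :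
    ⟪η z, η z⟫_ℝ = 1 := by rw [real_inner_self_eq_norm_sq, h.norm_η z hz, one_pow]

/-- The Codazzi equation: the symmetry of the second derivatives of `W₁`, in normal directions. -/
theorem inner_fderiv_W₂_symm (h : IsFramedChart U u W₁ W₂ η ρ₁ ρ₂) {z : ℂ} (hz : z ∈ U)
    (c X Y : ℂ) {v : E} (hu : ⟪u z, v⟫_ℝ = 0) (h1 : ∀ d, ⟪W₁ z d, v⟫_ℝ = 0) :
    ⟪fderiv ℝ (fun w => W₂ w (c * X)) z Y, v⟫_ℝ =
      ⟪fderiv ℝ (fun w => W₂ w (c * Y)) z X, v⟫_ℝ := by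
  have key := congrArg (fun y => ⟪y, v⟫_ℝ) (h.snd_fderiv_W₁_symm hz c X Y)
  simp only [(h.snd_fderiv_W₁ hz _ _).2, inner_add_left, inner_sub_left, inner_smul_left, hu,
    h1] at key
  rw [show dLog ρ₁ z * c * Y * X = dLog ρ₁ z * c * X * Y by ring] at key
  simpa using key

theorem inner_W₂_fderiv_W₂ (h : IsFramedChart U u W₁ W₂ η ρ₁ ρ₂) {z : ℂ} (hz : z ∈ U)
    (c X d : ℂ) :
    ⟪fderiv ℝ (fun w => W₂ w c) z X, W₂ z d⟫_ℝ =
      ρ₂ z * (dLog ρ₂ z * c * X * starRingEnd ℂ d).re := by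
  obtain ⟨e, he⟩ : ∃ e : ℂ → ℂ → ℂ → ℝ, e = fun X c d =>
    ⟪fderiv ℝ (fun w => W₂ w c) z X, W₂ z d⟫_ℝ := ⟨_, rfl⟩
  have hsym : ∀ c X Y d, e Y (c * X) d = e X (c * Y) d := fun c X Y d => by
    simp only [he]
    exact h.inner_fderiv_W₂_symm hz c X Y (h.inner_u_W₂ hz d) fun a => h.inner_W₁_W₂ hz a d
  have hone : ∀ X c d, e X c d = e 1 (c * X) d := fun X c d => by
    simpa using hsym c 1 X d
  have key : ∀ c d X, e X c d + e X d c =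
      2 * ρ₂ z * (dLog ρ₂ z * X).re * (c * starRingEnd ℂ d).re := by
    intro c d X
    have h1 := (((h.smooth_W₂ c).hasDirDeriv h.isOpen hz).inner
      ((h.smooth_W₂ d).hasDirDeriv h.isOpen hz))
    have h2 := (h.smooth_ρ₂.hasDirDeriv h.isOpen hz).mulReal
      (HasDirDeriv.const ((c * starRingEnd ℂ d).re))
    have h3 := h2.congr_of_eventuallyEq
      ((h.eventually_mem hz).mono fun w hw => h.inner_W₂ w hw c d)
    have h4 := h1.unique h3 X
    rw [dLog_spec (h.ρ₂_pos z hz), real_inner_comm] at h4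
    simp only [he]
    linarith
  have k1 : ∀ Z, e 1 Z 1 = ρ₂ z * (dLog ρ₂ z * Z).re := fun Z => by
    have := key 1 1 Z
    rw [hone Z, one_mul] at this
    simp at this
    rw [mul_re]
    linarith
  have k2 : ∀ Z, e 1 Z I = ρ₂ z * (dLog ρ₂ z * Z * starRingEnd ℂ I).re := fun Z => by
    have := key 1 I Z
    rw [hone Z, hone Z, one_mul, k1] at this
    simp at this
    simp
    linarith
  have k3 : e X c d = d.re * e X c 1 + d.im * e X c I := by
    simp only [he]
    rw [(W₂ z).apply_eq_re_im d, inner_add_right, inner_smul_right, inner_smul_right]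
  have : e X c d = ρ₂ z * (dLog ρ₂ z * c * X * starRingEnd ℂ d).re := by
    rw [k3, hone X c 1, hone X c I, k1, k2]
    simp
    ring
  simpa only [he] using this

theorem inner_η_fderiv_W₂ (h : IsFramedChart U u W₁ W₂ η ρ₁ ρ₂) {z : ℂ} (hz : z ∈ U)
    (c X : ℂ) : ⟪fderiv ℝ (fun w => W₂ w c) z X, η z⟫_ℝ = 2 * (thirdCoeff W₂ η z * c * X).re := by
  have h1 := h.inner_fderiv_W₂_symm hz c 1 X (h.inner_u_η z hz) (h.inner_W₁_η z hz)
  rw [mul_one] at h1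
  have e : HasDirDeriv (fun w => W₂ w (c * X))
      (fun Y => (c * X).re • fderiv ℝ (fun w => W₂ w 1) z Y +
      (c * X).im • fderiv ℝ (fun w => W₂ w I) z Y) z := by
    have h2 := ((HasDirDeriv.const (c * X).re).smul ((h.smooth_W₂ 1).hasDirDeriv h.isOpen hz)).add
      ((HasDirDeriv.const (c * X).im).smul ((h.smooth_W₂ I).hasDirDeriv h.isOpen hz))
    refine (h2.congr_of_eventuallyEq (.of_forall fun w =>
      (W₂ w).apply_eq_re_im (c * X))).congr_deriv fun Y => by simp
  rw [h1, e.2, inner_add_left, inner_smul_left, inner_smul_left, mul_assoc (thirdCoeff W₂ η z)]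
  generalize c * X = w
  simp [thirdCoeff]
  ring

theorem deriv_W₂ (h : IsFramedChart U u W₁ W₂ η ρ₁ ρ₂) {z : ℂ} (hz : z ∈ U) (c : ℂ) :
    HasDirDeriv (fun w => W₂ w c) (fun X => (2 * (thirdCoeff W₂ η z * c * X).re) • η z +
      W₂ z (dLog ρ₂ z * c * X) - W₁ z ((ρ₂ z / ρ₁ z : ℝ) * c * starRingEnd ℂ X)) z := by
  refine ((h.smooth_W₂ c).hasDirDeriv h.isOpen hz).congr_deriv fun X => ?_
  have hρ := h.ρ₁_pos z hz
  refine h.eq_of_inner hz ?_ (fun d => ?_) (fun d => ?_) ?_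
  · simp [inner_add_right, inner_sub_right, inner_smul_right, h.inner_u_fderiv_W₂ hz,
      h.inner_u_η z hz, h.inner_u_W₁ hz, h.inner_u_W₂ hz]
  · rw [h.inner_W₁_fderiv_W₂ hz, inner_sub_right, inner_add_right, inner_smul_right,
      h.inner_W₁_η z hz, h.inner_W₁_W₂ hz, h.inner_W₁ z hz]
    simp
    field_simp
    ring
  · rw [real_inner_comm, h.inner_W₂_fderiv_W₂ hz, inner_sub_right, inner_add_right,
      inner_smul_right, h.inner_W₂_η z hz, real_inner_comm (W₁ z _), h.inner_W₁_W₂ hz,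
      h.inner_W₂ z hz]
    simp only [mul_re, mul_im, conj_re, conj_im, mul_zero, sub_zero, zero_add]
    ring
  · rw [real_inner_comm, h.inner_η_fderiv_W₂ hz, inner_sub_right, inner_add_right,
      inner_smul_right, h.inner_η_η hz, real_inner_comm (W₂ z _), h.inner_W₂_η z hz,
      real_inner_comm (W₁ z _), h.inner_W₁_η z hz]
    simp

theorem deriv_η (h : IsFramedChart U u W₁ W₂ η ρ₁ ρ₂) {z : ℂ} (hz : z ∈ U) :
    HasDirDeriv η (fun X => -W₂ z ((2 / ρ₂ z : ℝ) * starRingEnd ℂ (thirdCoeff W₂ η z * X))) z := by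
  have hη := h.smooth_η.hasDirDeriv h.isOpen hz
  refine hη.congr_deriv fun X => ?_
  have hρ := h.ρ₂_pos z hz
  have zero_of : ∀ {f f' : ℂ → E}, HasDirDeriv f f' z → (∀ w ∈ U, ⟪f w, η w⟫_ℝ = 0) →
      ⟪f z, fderiv ℝ η z X⟫_ℝ = -⟪f' X, η z⟫_ℝ := by
    intro f f' hf h0
    have h1 := hf.inner hη
    have h2 : HasDirDeriv (fun w => ⟪f w, η w⟫_ℝ) (fun _ => 0) z :=
      (HasDirDeriv.const (0 : ℝ)).congr_of_eventuallyEq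
        ((h.eventually_mem hz).mono fun w hw => h0 w hw)
    linarith [h1.unique h2 X]
  refine h.eq_of_inner hz ?_ (fun d => ?_) (fun d => ?_) ?_
  · rw [zero_of (h.deriv_u z hz) h.inner_u_η, h.inner_W₁_η z hz, inner_neg_right, h.inner_u_W₂ hz]
  · rw [zero_of (h.deriv_W₁ hz d) fun w hw => h.inner_W₁_η w hw d, inner_neg_right,
      h.inner_W₁_W₂ hz, inner_sub_left, inner_add_left, inner_smul_left, h.inner_W₁_η z hz,
      h.inner_W₂_η z hz, h.inner_u_η z hz]
    simp
  · rw [zero_of (h.deriv_W₂ hz d) fun w hw => h.inner_W₂_η w hw d, inner_neg_right,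
      h.inner_W₂ z hz, inner_sub_left, inner_add_left, inner_smul_left, h.inner_W₁_η z hz,
      h.inner_W₂_η z hz, h.inner_η_η hz]
    simp
    field_simp
    ring
  · rw [hη.inner_eq_zero_of_norm ((h.eventually_mem hz).mono fun w hw => h.norm_η w hw),
      inner_neg_right, real_inner_comm, h.inner_W₂_η z hz, neg_zero]

theorem smooth_thirdCoeff (h : IsFramedChart U u W₁ W₂ η ρ₁ ρ₂) :
    ContDiffOn ℝ ∞ (thirdCoeff W₂ η) U := by
  refine ContDiffOn.smul (f := fun _ => (2 : ℝ)⁻¹) contDiffOn_const ?_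
  exact (ofRealCLM.contDiff.comp_contDiffOn
      (((h.smooth_W₂ 1).fderiv_apply_smooth h.isOpen 1).inner ℝ h.smooth_η)).sub
    ((ofRealCLM.contDiff.comp_contDiffOn
      (((h.smooth_W₂ I).fderiv_apply_smooth h.isOpen 1).inner ℝ h.smooth_η)).mul contDiffOn_const)

/-- The coefficient of the third fundamental form is holomorphic: this is the symmetry of the
second derivatives of `W₂`, in the direction of `η`. -/
theorem hasDerivAt_thirdCoeff (h : IsFramedChart U u W₁ W₂ η ρ₁ ρ₂) {z : ℂ} (hz : z ∈ U) :
    HasDerivAt (thirdCoeff W₂ η) (fderiv ℝ (thirdCoeff W₂ η) z 1) z := by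
  have hψd := h.smooth_thirdCoeff.hasDirDeriv h.isOpen hz
  set ψ := thirdCoeff W₂ η with hψ
  have hp := (dLog_smooth h.isOpen h.smooth_ρ₂ h.ρ₂_pos).hasDirDeriv h.isOpen hz
  have hq : HasDirDeriv (fun w => ρ₂ w / ρ₁ w) (fun X => fderiv ℝ (fun w => ρ₂ w / ρ₁ w) z X) z :=
    (h.smooth_ρ₂.div h.smooth_ρ₁ fun w hw => (h.ρ₁_pos w hw).ne').hasDirDeriv h.isOpen hz
  have key : ∀ c X Y, ⟪fderiv ℝ (fun w => fderiv ℝ (fun w' => W₂ w' c) w X) z Y, η z⟫_ℝ =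
      2 * (fderiv ℝ ψ z Y * c * X).re + 2 * (ψ z * (dLog ρ₂ z * c * X) * Y).re := by
    intro c X Y
    have h1 := ((((HasDirDeriv.const (2 : ℝ)).mulReal
      (((hψd.mul (HasDirDeriv.const c)).mul (HasDirDeriv.const X)).re)).smul (h.deriv_η hz)).add
      (HasDirDeriv.linearMap_apply (fun d => h.deriv_W₂ hz d)
        ((hp.mul (HasDirDeriv.const c)).mul (HasDirDeriv.const X)))).sub
      (HasDirDeriv.linearMap_apply (fun d => h.deriv_W₁ hz d)
        ((hq.ofReal.mul (HasDirDeriv.const c)).mul (HasDirDeriv.const (starRingEnd ℂ X))))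
    have h2 := h1.congr_of_eventuallyEq ((h.eventually_mem hz).mono fun w hw =>
      (h.deriv_W₂ hw c).2 X)
    rw [h2.2]
    simp only [inner_add_left, inner_sub_left, inner_smul_left, inner_neg_left, h.inner_W₁_η z hz,
      h.inner_W₂_η z hz, h.inner_η_η hz, h.inner_u_η z hz]
    simp
    ring
  have hsymm : ∀ c X Y, (fderiv ℝ ψ z Y * c * X).re = (fderiv ℝ ψ z X * c * Y).re := by
    intro c X Y
    have h1 := congrArg (fun y => ⟪y, η z⟫_ℝ) (fderiv_fderiv_symm h.isOpen (h.smooth_W₂ c) hz X Y)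
    simp only [key] at h1
    rw [show ψ z * (dLog ρ₂ z * c * Y) * X = ψ z * (dLog ρ₂ z * c * X) * Y by ring] at h1
    linarith
  have hlin : ∀ Y, fderiv ℝ ψ z Y = Y * fderiv ℝ ψ z 1 := by
    intro Y
    have h1 := hsymm 1 1 Y
    have h2 := hsymm I 1 Y
    apply Complex.ext
    · simp at h1 ⊢
      linarith
    · simp at h2 ⊢
      linarith
  rw [hasDerivAt_iff_hasFDerivAt]
  refine hasFDerivAt_of_restrictScalars ℝ hψd.1.hasFDerivAt ?_
  ext Y
  simpa using (hlin Y).symm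

end IsFramedChart

end Structure

/-! ### The periodic osculating sequence of a surface in `S⁵` -/

section Cyclic

variable {E : Type*} [NormedAddCommGroup E] [InnerProductSpace ℝ E]

/-- The scalar data shared by all the members of the associated family: the norms of `∂u` and of
the second fundamental form, and the coefficient of the third fundamental form. -/
structure IsScalarData (U : Set ℂ) (ρ₁ ρ₂ : ℂ → ℝ) (ψ : ℂ → ℂ) : Prop where
  isOpen : IsOpen U
  smooth_ρ₁ : ContDiffOn ℝ ∞ ρ₁ U
  smooth_ρ₂ : ContDiffOn ℝ ∞ ρ₂ U
  ρ₁_pos : ∀ z ∈ U, 0 < ρ₁ z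
  ρ₂_pos : ∀ z ∈ U, 0 < ρ₂ z
  holo : DifferentiableOn ℂ ψ U
  normSq_ψ : ∀ z ∈ U, 4 * normSq (ψ z) = ρ₁ z * ρ₂ z

/-- The real linear map `c ↦ 2 Re c • v`, which represents the real vector `v`. -/
def twoReSmul (v : E) : ℂ →ₗ[ℝ] E := (LinearMap.toSpanSingleton ℝ E v) ∘ₗ (2 • reLm)

theorem twoReSmul_apply (v : E) (c : ℂ) : twoReSmul v c = (2 * c.re) • v := by
  simp [twoReSmul]

/-- The six directions `∂^0 u, …, ∂^5 u` of a surface in `S⁵`, up to complex factors: the last two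
are conjugate to the third and to the second one. -/
def cycBase (u : ℂ → E) (W₁ W₂ : ℂ → ℂ →ₗ[ℝ] E) (η : ℂ → E) (z : ℂ) : ℕ → ℂ →ₗ[ℝ] E
  | 0 => twoReSmul (u z)
  | 1 => W₁ z
  | 2 => W₂ z
  | 3 => twoReSmul (η z)
  | 4 => W₂ z ∘ₗ conjAe.toLinearMap
  | _ => W₁ z ∘ₗ conjAe.toLinearMap

/-- The complex factors that accompany `cycBase`; `κ` is the coefficient of the third fundamental
form, and one period multiplies by `-κ²`. -/
def cycCoeff (ρ₁ ρ₂ : ℝ) (κ : ℂ) (q : ℕ) : ℕ → ℂ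
  | 0 => (-κ ^ 2) ^ q
  | 1 => (-κ ^ 2) ^ q
  | 2 => (-κ ^ 2) ^ q
  | 3 => κ * (-κ ^ 2) ^ q
  | 4 => (2 / ρ₂ : ℝ) * (-κ ^ 2) ^ (q + 1)
  | _ => -(2 / ρ₁ : ℝ) * (-κ ^ 2) ^ (q + 1)

/-- The osculating sequence of a framed chart. -/
def cycSeq (ρ₁ ρ₂ : ℂ → ℝ) (κ : ℂ → ℂ) (u : ℂ → E) (W₁ W₂ : ℂ → ℂ →ₗ[ℝ] E) (η : ℂ → E) (k : ℕ)
    (z : ℂ) : ℂ →ₗ[ℝ] E :=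
  cycBase u W₁ W₂ η z (k % 6) ∘ₗ
    LinearMap.mulLeft ℝ (cycCoeff (ρ₁ z) (ρ₂ z) (κ z) (k / 6) (k % 6))

/-- The coefficient of `W k` in `∂ (W k)`. -/
def cycP (ρ₁ ρ₂ : ℂ → ℝ) (ψ : ℂ → ℂ) (k : ℕ) (z : ℂ) : ℂ :=
  let l := deriv ψ z / ψ z
  match k % 6 with
  | 0 => 2 * (k / 6 : ℕ) * l
  | 1 => dLog ρ₁ z + 2 * (k / 6 : ℕ) * l
  | 2 => dLog ρ₂ z + 2 * (k / 6 : ℕ) * l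
  | 3 => (2 * (k / 6 : ℕ) + 1) * l
  | 4 => -dLog ρ₂ z + (2 * (k / 6 : ℕ) + 2) * l
  | _ => -dLog ρ₁ z + (2 * (k / 6 : ℕ) + 2) * l

/-- The coefficient of `W (k - 1)` in `∂̄ (W k)`. -/
def cycQ (ρ₁ ρ₂ : ℂ → ℝ) (k : ℕ) (z : ℂ) : ℂ :=
  if k % 3 = 2 then -(ρ₂ z / ρ₁ z : ℝ) else -(ρ₁ z / 2 : ℝ)

theorem IsScalarData.ψ_ne {U : Set ℂ} {ρ₁ ρ₂ : ℂ → ℝ} {ψ : ℂ → ℂ} (hd : IsScalarData U ρ₁ ρ₂ ψ)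
    {z : ℂ} (hz : z ∈ U) : ψ z ≠ 0 := by
  intro h
  have := hd.normSq_ψ z hz
  rw [h] at this
  simp [(hd.ρ₁_pos z hz).ne', (hd.ρ₂_pos z hz).ne'] at this

theorem IsScalarData.smooth_ψ {U : Set ℂ} {ρ₁ ρ₂ : ℂ → ℝ} {ψ : ℂ → ℂ}
    (hd : IsScalarData U ρ₁ ρ₂ ψ) : ContDiffOn ℝ ∞ ψ U :=
  (hd.holo.contDiffOn hd.isOpen).restrict_scalars ℝ

theorem IsScalarData.smooth_cycP {U : Set ℂ} {ρ₁ ρ₂ : ℂ → ℝ} {ψ : ℂ → ℂ}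
    (hd : IsScalarData U ρ₁ ρ₂ ψ) (k : ℕ) : ContDiffOn ℝ ∞ (cycP ρ₁ ρ₂ ψ k) U := by
  have hl : ContDiffOn ℝ ∞ (fun z => deriv ψ z / ψ z) U :=
    ((((hd.holo.deriv hd.isOpen).contDiffOn hd.isOpen (n := ∞)).div
      (hd.holo.contDiffOn hd.isOpen) fun z hz => hd.ψ_ne hz)).restrict_scalars ℝ
  have h1 := dLog_smooth hd.isOpen hd.smooth_ρ₁ hd.ρ₁_pos
  have h2 := dLog_smooth hd.isOpen hd.smooth_ρ₂ hd.ρ₂_pos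
  unfold cycP
  have : k % 6 < 6 := Nat.mod_lt _ (by norm_num)
  interval_cases k % 6
  · exact contDiffOn_const.mul hl
  · exact h1.add (contDiffOn_const.mul hl)
  · exact h2.add (contDiffOn_const.mul hl)
  · exact contDiffOn_const.mul hl
  · exact h2.neg.add (contDiffOn_const.mul hl)
  · exact h1.neg.add (contDiffOn_const.mul hl)

theorem IsScalarData.smooth_cycQ {U : Set ℂ} {ρ₁ ρ₂ : ℂ → ℝ} {ψ : ℂ → ℂ}
    (hd : IsScalarData U ρ₁ ρ₂ ψ) (k : ℕ) : ContDiffOn ℝ ∞ (cycQ ρ₁ ρ₂ k) U := by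
  unfold cycQ
  split_ifs
  · exact (ofRealCLM.contDiff.comp_contDiffOn
      (hd.smooth_ρ₂.div hd.smooth_ρ₁ fun z hz => (hd.ρ₁_pos z hz).ne')).neg
  · exact (ofRealCLM.contDiff.comp_contDiffOn (hd.smooth_ρ₁.div_const 2)).neg

section

variable {U : Set ℂ} {u : ℂ → E} {W₁ W₂ : ℂ → ℂ →ₗ[ℝ] E} {η : ℂ → E} {ρ₁ ρ₂ : ℂ → ℝ}
  {ψ : ℂ → ℂ} {lam : ℂ}

/-- Logarithmic derivative of a power of `-κ²`. -/
theorem hasDirDeriv_neg_sq_pow (hd : IsScalarData U ρ₁ ρ₂ ψ) {z : ℂ} (hz : z ∈ U) (lam : ℂ)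
    (n : ℕ) : HasDirDeriv (fun w => (-(lam * ψ w) ^ 2) ^ n)
      (fun X => 2 * n * (deriv ψ z / ψ z) * (-(lam * ψ z) ^ 2) ^ n * X) z := by
  have h1 : HasDerivAt ψ (deriv ψ z) z :=
    ((hd.holo z hz).differentiableAt (hd.isOpen.mem_nhds hz)).hasDerivAt
  refine (HasDirDeriv.of_hasDerivAt ((((h1.const_mul lam).pow 2).neg).pow n)).congr_deriv
    fun X => ?_
  rcases n with _ | n
  · simp
  · simp only [Nat.add_sub_cancel, pow_succ]
    push_cast
    field_simp
    simp
    ring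

variable [FiniteDimensional ℝ E]

theorem smooth_cycSeq (h : IsFramedChart U u W₁ W₂ η ρ₁ ρ₂) (hd : IsScalarData U ρ₁ ρ₂ ψ)
    (lam : ℂ) (k : ℕ) (c : ℂ) :
    ContDiffOn ℝ ∞ (fun z => cycSeq ρ₁ ρ₂ (fun z => lam * ψ z) u W₁ W₂ η k z c) U := by
  have hψ : ContDiffOn ℝ ∞ (fun z => lam * ψ z) U := contDiffOn_const.mul hd.smooth_ψ
  have hpow : ∀ n : ℕ, ContDiffOn ℝ ∞ (fun z => (-(lam * ψ z) ^ 2) ^ n) U := fun n =>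
    ((hψ.pow 2).neg).pow n
  have h1 : ContDiffOn ℝ ∞ (fun z => ((2 / ρ₁ z : ℝ) : ℂ)) U := ofRealCLM.contDiff.comp_contDiffOn
    (contDiffOn_const.div hd.smooth_ρ₁ fun z hz => (hd.ρ₁_pos z hz).ne')
  have h2 : ContDiffOn ℝ ∞ (fun z => ((2 / ρ₂ z : ℝ) : ℂ)) U := ofRealCLM.contDiff.comp_contDiffOn
    (contDiffOn_const.div hd.smooth_ρ₂ fun z hz => (hd.ρ₂_pos z hz).ne')
  have hre : ∀ {f : ℂ → ℂ} {v : ℂ → E}, ContDiffOn ℝ ∞ f U → ContDiffOn ℝ ∞ v U →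
      ContDiffOn ℝ ∞ (fun z => twoReSmul (v z) (f z)) U := by
    intro f v hf hv
    simp only [twoReSmul_apply]
    exact (contDiffOn_const.mul (reCLM.contDiff.comp_contDiffOn hf)).smul hv
  have hconj : ∀ {f : ℂ → ℂ}, ContDiffOn ℝ ∞ f U → ContDiffOn ℝ ∞ (fun z => conjAe (f z)) U :=
    fun hf => (conjCLE : ℂ →L[ℝ] ℂ).contDiff.comp_contDiffOn hf
  unfold cycSeq
  have : k % 6 < 6 := Nat.mod_lt _ (by norm_num)
  generalize k / 6 = q
  interval_cases k % 6
  · exact hre ((hpow q).mul contDiffOn_const) h.smooth_u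
  · exact ContDiffOn.linearMap_apply h.smooth_W₁ ((hpow q).mul contDiffOn_const)
  · exact ContDiffOn.linearMap_apply h.smooth_W₂ ((hpow q).mul contDiffOn_const)
  · exact hre ((hψ.mul (hpow q)).mul contDiffOn_const) h.smooth_η
  · exact ContDiffOn.linearMap_apply h.smooth_W₂
      (hconj ((h2.mul (hpow (q + 1))).mul contDiffOn_const))
  · exact ContDiffOn.linearMap_apply h.smooth_W₁
      (hconj ((h1.neg.mul (hpow (q + 1))).mul contDiffOn_const))

theorem hasDirDeriv_two_div {ρ : ℂ → ℝ} (hU : IsOpen U) (hρ : ContDiffOn ℝ ∞ ρ U) {z : ℂ}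
    (hz : z ∈ U) (h0 : 0 < ρ z) : HasDirDeriv (fun w => 2 / ρ w)
      (fun X => -(2 / ρ z) * (2 * (dLog ρ z * X).re)) z := by
  have h1 := (HasDirDeriv.const (2 : ℝ)).mulReal ((hρ.hasDirDeriv hU hz).inv h0.ne')
  simp only [← div_eq_mul_inv] at h1
  refine h1.congr_deriv fun X => ?_
  rw [dLog_spec h0]
  field_simp
  simp

omit [FiniteDimensional ℝ E] in
theorem cycSeq_eq (q r : ℕ) (hr : r < 6) (κ : ℂ → ℂ) (z c : ℂ) :
    cycSeq ρ₁ ρ₂ κ u W₁ W₂ η (6 * q + r) z c =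
      cycBase u W₁ W₂ η z r (cycCoeff (ρ₁ z) (ρ₂ z) (κ z) q r * c) := by
  have h1 : (6 * q + r) % 6 = r := by omega
  have h2 : (6 * q + r) / 6 = q := by omega
  simp [cycSeq, h1, h2]

/-- The structure equations of the periodic sequence. The two real coefficients in `cycCoeff` are
those for which `∂` of one term is the next one modulo that term, by `4 |κ|² = ρ₁ ρ₂`. The sequence
depends on `lam`, the coefficients `cycP` and `cycQ` do not. -/
theorem deriv_cycSeq (h : IsFramedChart U u W₁ W₂ η ρ₁ ρ₂) (hd : IsScalarData U ρ₁ ρ₂ ψ)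
    (hlam : normSq lam = 1) (hκ : ∀ z ∈ U, thirdCoeff W₂ η z = lam * ψ z) {k : ℕ} (hk : 1 ≤ k)
    {z : ℂ} (hz : z ∈ U) (c : ℂ) :
    HasDirDeriv (fun w => cycSeq ρ₁ ρ₂ (fun z => lam * ψ z) u W₁ W₂ η k w c)
      (fun X => cycSeq ρ₁ ρ₂ (fun z => lam * ψ z) u W₁ W₂ η (k + 1) z (c * X) +
        cycSeq ρ₁ ρ₂ (fun z => lam * ψ z) u W₁ W₂ η k z (cycP ρ₁ ρ₂ ψ k z * c * X) +
        cycSeq ρ₁ ρ₂ (fun z => lam * ψ z) u W₁ W₂ η (k - 1) z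
          (cycQ ρ₁ ρ₂ k z * c * starRingEnd ℂ X)) z := by
  obtain ⟨q, r, hr, rfl⟩ : ∃ q r, r < 6 ∧ k = 6 * q + r :=
    ⟨k / 6, k % 6, Nat.mod_lt _ (by norm_num), (Nat.div_add_mod k 6).symm⟩
  have h1 := hd.ρ₁_pos z hz
  have h2 := hd.ρ₂_pos z hz
  have hχ := hasDirDeriv_neg_sq_pow hd hz lam
  have hκn : 4 * normSq (lam * ψ z) = ρ₁ z * ρ₂ z := by
    rw [normSq_mul, hlam, one_mul, hd.normSq_ψ z hz]
  have hκc : lam * ψ z * starRingEnd ℂ (lam * ψ z) = ((ρ₁ z * ρ₂ z / 4 : ℝ) : ℂ) := by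
    rw [mul_conj, ← hκn]
    push_cast
    ring
  have hmod : (6 * q + r) % 6 = r := by omega
  have hdiv : (6 * q + r) / 6 = q := by omega
  have hmod3 : (6 * q + r) % 3 = r % 3 := by omega
  have hr1 : ((ρ₁ z : ℝ) : ℂ) ≠ 0 := by exact_mod_cast h1.ne'
  have hr2 : ((ρ₂ z : ℝ) : ℂ) ≠ 0 := by exact_mod_cast h2.ne'
  simp only [cycSeq_eq q r hr, cycP, cycQ, hmod, hdiv, hmod3]
  have two_re : ∀ w : ℂ, ((2 * w.re : ℝ) : ℂ) = w + starRingEnd ℂ w := fun w => by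
    rw [add_conj]
  -- the real coefficients and their relations, kept as atoms in the computations below
  have hDB : ((2 / ρ₁ z : ℝ) : ℂ) * ((ρ₁ z / 2 : ℝ) : ℂ) = 1 := by push_cast; field_simp
  have hAC : ((2 / ρ₂ z : ℝ) : ℂ) * ((ρ₂ z / ρ₁ z : ℝ) : ℂ) = ((2 / ρ₁ z : ℝ) : ℂ) := by
    push_cast; field_simp
  have hAB : lam * ψ z * starRingEnd ℂ (lam * ψ z) * ((2 / ρ₂ z : ℝ) : ℂ) =
      ((ρ₁ z / 2 : ℝ) : ℂ) := by
    rw [hκc]; push_cast; field_simp; ring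
  interval_cases r
  · obtain ⟨q, rfl⟩ : ∃ q', q = q' + 1 := ⟨q - 1, by omega⟩
    rw [show 6 * (q + 1) + 0 - 1 = 6 * q + 5 by omega]
    simp only [cycSeq_eq (q + 1) 1 (by norm_num), cycSeq_eq q 5 (by norm_num)]
    specialize hχ (q + 1)
    simp only [cycBase, cycCoeff, twoReSmul_apply, LinearMap.comp_apply, AlgEquiv.toLinearMap_apply,
      conjAe_coe]
    refine (((HasDirDeriv.const (2 : ℝ)).mulReal (hχ.mul (HasDirDeriv.const c)).re).smul
      (h.deriv_u z hz)).congr_deriv fun X => ?_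
    generalize (-(lam * ψ z) ^ 2) ^ (q + 1) = χ
    rw [add_right_comm, ← map_smul, ← map_add]
    congr 2
    · rw [real_smul, two_re, if_neg (by norm_num)]
      simp only [map_mul, map_neg, conj_ofReal, conj_conj]
      linear_combination (-starRingEnd ℂ χ * starRingEnd ℂ c * X) * hDB
    · simp only [mul_zero, zero_add, zero_mul, add_zero]
      congr 2
      ring
  · simp only [show 6 * q + 1 - 1 = 6 * q + 0 by omega, show 6 * q + 1 + 1 = 6 * q + 2 by omega,
      cycSeq_eq q 2 (by norm_num), cycSeq_eq q 0 (by norm_num)]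
    specialize hχ q
    simp only [cycBase, cycCoeff, twoReSmul_apply]
    refine (HasDirDeriv.linearMap_apply (fun d => h.deriv_W₁ hz d)
      (hχ.mul (HasDirDeriv.const c))).congr_deriv fun X => ?_
    generalize (-(lam * ψ z) ^ 2) ^ q = χ
    have e1 : (2 * (χ * (-((ρ₁ z / 2 : ℝ) : ℂ) * c * starRingEnd ℂ X)).re) =
        -(ρ₁ z * (χ * c * starRingEnd ℂ X).re) := by
      rw [show χ * (-((ρ₁ z / 2 : ℝ) : ℂ) * c * starRingEnd ℂ X) =
        ((-(ρ₁ z / 2) : ℝ) : ℂ) * (χ * c * starRingEnd ℂ X) by push_cast; ring, re_ofReal_mul]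
      ring
    have e2 : χ * ((dLog ρ₁ z + 2 * q * (deriv ψ z / ψ z)) * c * X) =
      dLog ρ₁ z * (χ * c) * X + (χ * 0 + 2 * q * (deriv ψ z / ψ z) * χ * X * c) := by ring
    rw [if_neg (by norm_num), e1, e2, (W₁ z).map_add (dLog ρ₁ z * (χ * c) * X), neg_smul,
      ← mul_assoc χ c X]
    abel
  · simp only [show 6 * q + 2 - 1 = 6 * q + 1 by omega, show 6 * q + 2 + 1 = 6 * q + 3 by omega,
      cycSeq_eq q 3 (by norm_num), cycSeq_eq q 1 (by norm_num)]
    specialize hχ q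
    simp only [cycBase, cycCoeff, twoReSmul_apply]
    refine (HasDirDeriv.linearMap_apply (fun d => h.deriv_W₂ hz d)
      (hχ.mul (HasDirDeriv.const c))).congr_deriv fun X => ?_
    rw [hκ z hz]
    generalize (-(lam * ψ z) ^ 2) ^ q = χ
    have e1 : χ * ((dLog ρ₂ z + 2 * q * (deriv ψ z / ψ z)) * c * X) =
      dLog ρ₂ z * (χ * c) * X + (χ * 0 + 2 * q * (deriv ψ z / ψ z) * χ * X * c) := by ring
    have e2 : χ * (-((ρ₂ z / ρ₁ z : ℝ) : ℂ) * c * starRingEnd ℂ X) =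
      -(((ρ₂ z / ρ₁ z : ℝ) : ℂ) * (χ * c) * starRingEnd ℂ X) := by ring
    simp only [if_true]
    rw [e1, e2, (W₂ z).map_add (dLog ρ₂ z * (χ * c) * X), map_neg,
      show lam * ψ z * (χ * c) * X = lam * ψ z * χ * (c * X) by ring]
    abel
  · simp only [show 6 * q + 3 - 1 = 6 * q + 2 by omega, show 6 * q + 3 + 1 = 6 * q + 4 by omega,
      cycSeq_eq q 4 (by norm_num), cycSeq_eq q 2 (by norm_num)]
    have hψ' : HasDirDeriv (fun w => lam * ψ w) (fun X => lam * deriv ψ z * X) z :=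
      HasDirDeriv.of_hasDerivAt
        (((hd.holo z hz).differentiableAt (hd.isOpen.mem_nhds hz)).hasDerivAt.const_mul lam)
    specialize hχ q
    simp only [cycBase, cycCoeff, twoReSmul_apply, LinearMap.comp_apply, AlgEquiv.toLinearMap_apply,
      conjAe_coe]
    refine (((HasDirDeriv.const (2 : ℝ)).mulReal ((hψ'.mul hχ).mul (HasDirDeriv.const c)).re).smul
      (h.deriv_η hz)).congr_deriv fun X => ?_
    rw [hκ z hz, add_right_comm, ← map_neg, ← map_smul, ← map_add, if_neg (by norm_num)]
    have hψ0 := hd.ψ_ne hz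
    simp only [pow_succ _ q]
    generalize (-(lam * ψ z) ^ 2) ^ q = χ
    congr 2
    · rw [real_smul, two_re]
      generalize lam * ψ z = κ at *
      simp only [map_mul, map_neg, map_pow, conj_ofReal]
      linear_combination (-χ * c * starRingEnd ℂ X) * hAB
    · simp only [mul_zero, zero_add, zero_mul, add_zero]
      congr 2
      field_simp
  · simp only [show 6 * q + 4 - 1 = 6 * q + 3 by omega, show 6 * q + 4 + 1 = 6 * q + 5 by omega,
      cycSeq_eq q 5 (by norm_num), cycSeq_eq q 3 (by norm_num)]
    specialize hχ (q + 1)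
    simp only [cycBase, cycCoeff, twoReSmul_apply, LinearMap.comp_apply, AlgEquiv.toLinearMap_apply,
      conjAe_coe]
    refine (HasDirDeriv.linearMap_apply (fun d => h.deriv_W₂ hz d)
      ((((hasDirDeriv_two_div hd.isOpen hd.smooth_ρ₂ hz h2).ofReal.mul hχ).mul
        (HasDirDeriv.const c)).conj)).congr_deriv fun X => ?_
    rw [hκ z hz, if_neg (by norm_num)]
    simp only [pow_succ _ q]
    generalize (-(lam * ψ z) ^ 2) ^ q = χ
    generalize lam * ψ z = κ at *
    have e1 : (κ * starRingEnd ℂ (((2 / ρ₂ z : ℝ) : ℂ) * (χ * -κ ^ 2) * c) * X).re =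
        (κ * χ * (-((ρ₁ z / 2 : ℝ) : ℂ) * c * starRingEnd ℂ X)).re := by
      rw [← conj_re (κ * χ * _)]
      congr 1
      simp only [map_mul, map_neg, map_pow, conj_ofReal, conj_conj]
      linear_combination (-starRingEnd ℂ κ * starRingEnd ℂ χ * starRingEnd ℂ c * X) * hAB
    have e2 : -(((ρ₂ z / ρ₁ z : ℝ) : ℂ) * starRingEnd ℂ (((2 / ρ₂ z : ℝ) : ℂ) * (χ * -κ ^ 2) * c) *
        starRingEnd ℂ X) =
        starRingEnd ℂ (-((2 / ρ₁ z : ℝ) : ℂ) * (χ * -κ ^ 2) * (c * X)) := by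
      simp only [map_mul, map_neg, map_pow, conj_ofReal]
      linear_combination (starRingEnd ℂ χ * starRingEnd ℂ κ ^ 2 * starRingEnd ℂ c *
        starRingEnd ℂ X) * hAC
    have e3 : starRingEnd ℂ (((2 / ρ₂ z : ℝ) : ℂ) * (χ * -κ ^ 2) *
          ((-dLog ρ₂ z + (2 * q + 2) * (deriv ψ z / ψ z)) * c * X)) =
        dLog ρ₂ z * starRingEnd ℂ (((2 / ρ₂ z : ℝ) : ℂ) * (χ * -κ ^ 2) * c) * X +
        starRingEnd ℂ (((2 / ρ₂ z : ℝ) : ℂ) * (χ * -κ ^ 2) * 0 +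
          (((2 / ρ₂ z : ℝ) : ℂ) * (2 * ((q + 1 : ℕ) : ℂ) * (deriv ψ z / ψ z) * (χ * -κ ^ 2) * X) +
            ((-(2 / ρ₂ z) * (2 * (dLog ρ₂ z * X).re) : ℝ) : ℂ) * (χ * -κ ^ 2)) * c) := by
      rw [show 2 * ((q + 1 : ℕ) : ℂ) * (deriv ψ z / ψ z) = (2 * q + 2) * (deriv ψ z / ψ z) by
        push_cast; ring, ofReal_mul, two_re, ofReal_neg]
      generalize (2 * (q : ℂ) + 2) * (deriv ψ z / ψ z) = l
      simp only [map_mul, map_neg, map_pow, map_add, map_zero, conj_ofReal, conj_conj]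
      ring
    rw [e1, sub_eq_add_neg, ← map_neg, e2, e3, (W₂ z).map_add (dLog ρ₂ z * _ * X)]
    abel
  · simp only [show 6 * q + 5 - 1 = 6 * q + 4 by omega,
      show 6 * q + 5 + 1 = 6 * (q + 1) + 0 by omega,
      cycSeq_eq (q + 1) 0 (by norm_num), cycSeq_eq q 4 (by norm_num)]
    specialize hχ (q + 1)
    simp only [cycBase, cycCoeff, twoReSmul_apply, LinearMap.comp_apply, AlgEquiv.toLinearMap_apply,
      conjAe_coe]
    refine (HasDirDeriv.linearMap_apply (fun d => h.deriv_W₁ hz d)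
      ((((hasDirDeriv_two_div hd.isOpen hd.smooth_ρ₁ hz h1).ofReal.neg.mul hχ).mul
        (HasDirDeriv.const c)).conj)).congr_deriv fun X => ?_
    rw [if_pos (by norm_num)]
    generalize (-(lam * ψ z) ^ 2) ^ (q + 1) = χ
    have e1 : ρ₁ z * (starRingEnd ℂ (-((2 / ρ₁ z : ℝ) : ℂ) * χ * c) * starRingEnd ℂ X).re =
        -(2 * (χ * (c * X)).re) := by
      rw [← map_mul, conj_re, show -((2 / ρ₁ z : ℝ) : ℂ) * χ * c * X =
        ((-(2 / ρ₁ z) : ℝ) : ℂ) * (χ * (c * X)) by push_cast; ring, re_ofReal_mul]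
      field_simp
    have e2 : starRingEnd ℂ (-((2 / ρ₁ z : ℝ) : ℂ) * χ * c) * X =
        starRingEnd ℂ (((2 / ρ₂ z : ℝ) : ℂ) * χ *
          (-((ρ₂ z / ρ₁ z : ℝ) : ℂ) * c * starRingEnd ℂ X)) := by
      simp only [map_mul, map_neg, conj_ofReal, conj_conj]
      linear_combination (starRingEnd ℂ χ * starRingEnd ℂ c * X) * hAC
    have e3 : starRingEnd ℂ (-((2 / ρ₁ z : ℝ) : ℂ) * χ *
          ((-dLog ρ₁ z + (2 * q + 2) * (deriv ψ z / ψ z)) * c * X)) =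
        dLog ρ₁ z * starRingEnd ℂ (-((2 / ρ₁ z : ℝ) : ℂ) * χ * c) * X +
        starRingEnd ℂ (-((2 / ρ₁ z : ℝ) : ℂ) * χ * 0 +
          (-((2 / ρ₁ z : ℝ) : ℂ) * (2 * ((q + 1 : ℕ) : ℂ) * (deriv ψ z / ψ z) * χ * X) +
            -((-(2 / ρ₁ z) * (2 * (dLog ρ₁ z * X).re) : ℝ) : ℂ) * χ) * c) := by
      rw [show 2 * ((q + 1 : ℕ) : ℂ) * (deriv ψ z / ψ z) = (2 * q + 2) * (deriv ψ z / ψ z) by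
        push_cast; ring, ofReal_mul, two_re, ofReal_neg]
      generalize (2 * (q : ℂ) + 2) * (deriv ψ z / ψ z) = l
      simp only [map_mul, map_neg, map_add, map_zero, conj_ofReal, conj_conj]
      ring
    rw [e1, e2, e3, (W₁ z).map_add (dLog ρ₁ z * _ * X), neg_smul]
    abel

theorem isOsculating_cycSeq (h : IsFramedChart U u W₁ W₂ η ρ₁ ρ₂) (hd : IsScalarData U ρ₁ ρ₂ ψ)
    (hlam : normSq lam = 1) (hκ : ∀ z ∈ U, thirdCoeff W₂ η z = lam * ψ z) :
    IsOsculating U u (cycSeq ρ₁ ρ₂ (fun z => lam * ψ z) u W₁ W₂ η) (cycP ρ₁ ρ₂ ψ) (cycQ ρ₁ ρ₂)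
      ρ₁ := by
  have e1 : ∀ z c, cycSeq ρ₁ ρ₂ (fun z => lam * ψ z) u W₁ W₂ η 1 z c = W₁ z c := fun z c =>
    (cycSeq_eq 0 1 (by norm_num) _ z c).trans (by simp [cycBase, cycCoeff])
  exact
  { isOpen := hd.isOpen
    smooth_u := h.smooth_u
    smooth_W := smooth_cycSeq h hd lam
    smooth_p := fun k _ => hd.smooth_cycP k
    smooth_q := fun k _ => hd.smooth_cycQ k
    smooth_ρ := hd.smooth_ρ₁
    norm_u := h.norm_u
    ρ_pos := hd.ρ₁_pos
    inner_W_one := fun z hz c d => by rw [e1, e1, h.inner_W₁ z hz]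
    W_zero := fun z hz c => (cycSeq_eq 0 0 (by norm_num) _ z c).trans
      (by simp [cycBase, cycCoeff, twoReSmul_apply])
    deriv_u := fun z hz => (h.deriv_u z hz).congr_deriv fun X => (e1 z X).symm
    deriv_W := fun k hk z hz c => deriv_cycSeq h hd hlam hκ hk hz c }

end

end Cyclic

/-! ### Direct sums -/

section DirectSum

variable {E : Type*} [NormedAddCommGroup E] [InnerProductSpace ℝ E] {ι : Type*}

/-- The vector `⊕ⱼ aⱼ vⱼ`. -/
def sumVec (a : ι → ℝ) (v : ι → E) : PiLp 2 fun _ : ι => E := WithLp.toLp 2 fun j => a j • v j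

/-- The linear map `⊕ⱼ aⱼ Lⱼ`. -/
def sumLin (a : ι → ℝ) (L : ι → ℂ →ₗ[ℝ] E) : ℂ →ₗ[ℝ] PiLp 2 fun _ : ι => E where
  toFun c := sumVec a fun j => L j c
  map_add' c d := by ext j; simp [sumVec]
  map_smul' s c := by
    ext j
    change a j • L j (s • c) = s • a j • L j c
    rw [map_smul, smul_comm]

theorem sumLin_apply (a : ι → ℝ) (L : ι → ℂ →ₗ[ℝ] E) (c : ℂ) :
    sumLin a L c = sumVec a fun j => L j c := rfl

variable [Fintype ι]

theorem inner_sumVec (a : ι → ℝ) (v w : ι → E) :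
    ⟪sumVec a v, sumVec a w⟫_ℝ = ∑ j, a j ^ 2 * ⟪v j, w j⟫_ℝ := by
  simp only [sumVec, PiLp.inner_apply, inner_smul_left, inner_smul_right, conj_trivial]
  exact Finset.sum_congr rfl fun j _ => by ring

theorem ContDiffOn.sumVec {U : Set ℂ} (a : ι → ℝ) {v : ι → ℂ → E}
    (h : ∀ j, ContDiffOn ℝ ∞ (v j) U) : ContDiffOn ℝ ∞ (fun z => sumVec a fun j => v j z) U :=
  contDiffOn_piLp' 2 fun j => contDiffOn_const.smul (h j)

theorem HasDirDeriv.sumVec (a : ι → ℝ) {v v' : ι → ℂ → E} {z : ℂ}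
    (h : ∀ j, HasDirDeriv (v j) (v' j) z) :
    HasDirDeriv (fun w => sumVec a fun j => v j w) (fun X => sumVec a fun j => v' j X) z := by
  have hd : DifferentiableAt ℝ (fun w => _root_.sumVec a fun j => v j w) z :=
    (differentiableAt_piLp 2).2 fun j => (h j).1.const_smul (a j)
  refine ⟨hd, fun X => ?_⟩
  ext j
  have h1 := ((PiLp.proj 2 (fun _ : ι => E) j : _ →L[ℝ] E).hasFDerivAt.comp z hd.hasFDerivAt)
  have h2 : HasFDerivAt (fun w => a j • v j w) (a j • fderiv ℝ (v j) z) z :=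
    (h j).1.hasFDerivAt.const_smul (a j)
  have := congrArg (fun L : ℂ →L[ℝ] E => L X) (h1.unique h2)
  simpa [(h j).2 X, _root_.sumVec] using this

/-- The direct sum of maps whose osculating sequences satisfy the same structure equations. -/
theorem IsOsculating.sum {U : Set ℂ} {a : ι → ℝ} (ha : ∑ j, a j ^ 2 = 1) {u : ι → ℂ → E}
    {W : ι → ℕ → ℂ → ℂ →ₗ[ℝ] E} {p q : ℕ → ℂ → ℂ} {ρ : ℂ → ℝ} (i₀ : ι)
    (h : ∀ j, IsOsculating U (u j) (W j) p q ρ) :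
    IsOsculating U (fun z => sumVec a fun j => u j z)
      (fun k z => sumLin a fun j => W j k z) p q ρ where
  isOpen := (h i₀).isOpen
  smooth_u := ContDiffOn.sumVec a fun j => (h j).smooth_u
  smooth_W k c := ContDiffOn.sumVec a fun j => (h j).smooth_W k c
  smooth_p := (h i₀).smooth_p
  smooth_q := (h i₀).smooth_q
  smooth_ρ := (h i₀).smooth_ρ
  norm_u z hz := by
    have : ‖sumVec a fun j => u j z‖ ^ 2 = 1 := by
      rw [← real_inner_self_eq_norm_sq, inner_sumVec, ← ha]
      exact Finset.sum_congr rfl fun j _ => by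
        rw [real_inner_self_eq_norm_sq, (h j).norm_u z hz]; ring
    exact (pow_eq_one_iff_of_nonneg (norm_nonneg _) two_ne_zero).1 this
  ρ_pos := (h i₀).ρ_pos
  inner_W_one z hz c d := by
    simp only [sumLin_apply, inner_sumVec, (h _).inner_W_one z hz, ← Finset.sum_mul, ha, one_mul]
  W_zero z hz c := by
    ext j
    simpa [sumLin_apply, sumVec, (h j).W_zero z hz] using smul_comm (a j) (2 * c.re) (u j z)
  deriv_u z hz := HasDirDeriv.sumVec a fun j => (h j).deriv_u z hz
  deriv_W k hk z hz c := (HasDirDeriv.sumVec a fun j => (h j).deriv_W k hk z hz c).congr_deriv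
    fun X => by
      ext j
      simp [sumLin_apply, sumVec]

end DirectSum

/-! ### The curvature of an isotropic chart -/

section Curvature

variable {E : Type*} [NormedAddCommGroup E] [InnerProductSpace ℝ E] [FiniteDimensional ℝ E]
  {M : Type*} [TopologicalSpace M] [ChartedSpace ℂ M]

/-- The Gauss equation, in terms of the norm of the second fundamental form. -/
theorem IsIsotropicChart.gaussCurvature_eq {U : Set ℂ} {f : M → E} {p : M}
    {W₁ W₂ : ℂ → ℂ →ₗ[ℝ] E} {ρ₁ ρ₂ : ℂ → ℝ}
    (h : IsIsotropicChart U (localRep f p) W₁ W₂ ρ₁ ρ₂) (hp : chartAt ℂ p p ∈ U) :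
    gaussCurvature f p =
      1 - 2 * ρ₂ (chartAt ℂ p p) / ρ₁ (chartAt ℂ p p) ^ 2 := by
  set z := chartAt ℂ p p
  have hF : ∀ w ∈ U, conformalFactor f p w = ρ₁ w := fun w hw => by
    rw [conformalFactor, (h.deriv_u w hw).2, ← real_inner_self_eq_norm_sq, h.inner_W₁ w hw]
    simp
  have hev : (fun w => Real.log (conformalFactor f p w)) =ᶠ[nhds z] fun w => Real.log (ρ₁ w) := by
    filter_upwards [h.isOpen.mem_nhds hp] with w hw
    rw [hF w hw]
  have hlog : ∀ w ∈ U, ∀ Y, fderiv ℝ (fun w => Real.log (ρ₁ w)) w Y = 2 * (dLog ρ₁ w * Y).re := by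
    intro w hw Y
    have h0 := h.ρ₁_pos w hw
    have := ((h.smooth_ρ₁.hasDirDeriv h.isOpen hw).1.hasFDerivAt.log h0.ne').fderiv
    rw [this]
    simp only [smul_apply, dLog_spec h0, smul_eq_mul]
    field_simp
  have hsm : ContDiffOn ℝ ∞ (fun w => Real.log (ρ₁ w)) U :=
    h.smooth_ρ₁.log fun w hw => (h.ρ₁_pos w hw).ne'
  have h2 : ∀ X, iteratedFDeriv ℝ 2 (fun w => Real.log (ρ₁ w)) z ![X, X] =
      2 * (fderiv ℝ (dLog ρ₁) z X * X).re := by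
    intro X
    rw [iteratedFDeriv_two_apply]
    have hd : DifferentiableAt ℝ (fderiv ℝ fun w => Real.log (ρ₁ w)) z :=
      ((hsm.fderiv_of_isOpen h.isOpen (m := 1) (by norm_cast)).contDiffAt
        (h.isOpen.mem_nhds hp)).differentiableAt (by norm_num)
    have e1 : fderiv ℝ (fun w => fderiv ℝ (fun w => Real.log (ρ₁ w)) w X) z X =
        fderiv ℝ (fderiv ℝ fun w => Real.log (ρ₁ w)) z X X := by
      rw [fderiv_clm_apply hd (differentiableAt_const X)]
      simp
    have e2 : HasDirDeriv (fun w => 2 * (dLog ρ₁ w * X).re)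
        (fun Y => 2 * (fderiv ℝ (dLog ρ₁) z Y * X).re) z :=
      ((HasDirDeriv.const (2 : ℝ)).mulReal
        ((h.smooth_dLog.hasDirDeriv h.isOpen hp).mul (HasDirDeriv.const X)).re).congr_deriv
          fun Y => by simp
    have e3 := e2.congr_of_eventuallyEq (g := fun w => fderiv ℝ (fun w => Real.log (ρ₁ w)) w X)
      (by filter_upwards [h.isOpen.mem_nhds hp] with w hw using hlog w hw X)
    simp only [Matrix.cons_val_zero, Matrix.cons_val_one]
    rw [← e1, e3.2]
  have hg := congrArg re (h.gauss hp)
  rw [add_re, ofReal_re] at hg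
  have h0 := h.ρ₁_pos z hp
  rw [gaussCurvature, Filter.EventuallyEq.eq_of_nhds (InnerProductSpace.laplacian_congr_nhds hev),
    hF z hp, InnerProductSpace.laplacian_eq_iteratedFDeriv_complexPlane]
  simp only [h2]
  rw [← mul_add, mul_one, hg]
  field_simp
  ring

end Curvature

/-! ### The constant model of the osculating sequence -/

section SumIsometry

variable {E F : Type*} [NormedAddCommGroup E] [InnerProductSpace ℝ E] [NormedAddCommGroup F]
  [InnerProductSpace ℝ F] {ι : Type*} [Fintype ι]

/-- The direct sum of linear isometries. -/
def sumIsometry (φ : ι → E →ₗᵢ[ℝ] F) : (PiLp 2 fun _ : ι => E) →ₗᵢ[ℝ] PiLp 2 fun _ : ι => F where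
  toFun x := WithLp.toLp 2 fun j => φ j (x j)
  map_add' x y := by ext j; simp
  map_smul' s x := by ext j; simp
  norm_map' x := by
    rw [← sq_eq_sq₀ (norm_nonneg _) (norm_nonneg _), PiLp.norm_sq_eq_of_L2, PiLp.norm_sq_eq_of_L2]
    simp

theorem sumIsometry_sumVec (φ : ι → E →ₗᵢ[ℝ] F) (a : ι → ℝ) (v : ι → E) :
    sumIsometry φ (sumVec a v) = sumVec a fun j => φ j (v j) := by
  ext j
  simp [sumIsometry, sumVec]

end SumIsometry

section Model

/-- The model of `ℝ⁶`: the first slot stands for the span of `u` and `η`, the other two for the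
tangent plane and the first normal plane. -/
abbrev ModelFiber : Type := PiLp 2 fun _ : Fin 3 => ℂ

/-- The `k`-th term of the model sequence in one copy of `ℝ⁶`, for the angle with `l = e^{iθ}`: the
term is concentrated in one slot, visited in the order of `u, W₁, W₂, η` and of the conjugates of
`W₂` and `W₁`, and carries one factor `l` for each coefficient `κ = l ψ` picked up before. -/
def modelFiberMap (l : ℂ) (k : ℕ) : ℂ →ₗ[ℝ] ModelFiber where
  toFun c := WithLp.toLp 2 ![
    if k % 6 = 0 then ((l ^ (k / 3) * c).re : ℂ) else
      if k % 6 = 3 then I * ((l ^ (k / 3) * c).re : ℂ) else 0,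
    if k % 6 = 1 then l ^ (k / 3) * c else
      if k % 6 = 5 then starRingEnd ℂ (l ^ (k / 3 + 1) * c) else 0,
    if k % 6 = 2 then l ^ (k / 3) * c else
      if k % 6 = 4 then starRingEnd ℂ (l ^ (k / 3 + 1) * c) else 0]
  map_add' c d := by
    ext i
    fin_cases i <;> simp [mul_add] <;> split_ifs <;> simp
  map_smul' s c := by
    ext i
    fin_cases i <;> simp <;> split_ifs <;> ring

/-- Multiplication by `i` in the last two slots. -/
def fiberRot : ModelFiber →ₗᵢ[ℝ] ModelFiber where
  toFun x := WithLp.toLp 2 ![x 0, I * x 1, I * x 2]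
  map_add' x y := by
    ext i
    fin_cases i <;> simp [mul_add]
  map_smul' s x := by
    ext i
    fin_cases i <;> simp <;> ring
  norm_map' x := by
    rw [← sq_eq_sq₀ (norm_nonneg _) (norm_nonneg _), PiLp.norm_sq_eq_of_L2, PiLp.norm_sq_eq_of_L2]
    simp [Fin.sum_univ_three]

theorem fiberRot_modelFiberMap_of_zero (l : ℂ) {k : ℕ} (hk : k % 3 = 0) (c : ℂ) :
    fiberRot (modelFiberMap l k c) = modelFiberMap l k c := by
  ext i
  have : k % 6 = 0 ∨ k % 6 = 3 := by omega
  rcases this with h | h <;> fin_cases i <;> simp [fiberRot, modelFiberMap, h]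

theorem fiberRot_modelFiberMap_of_lt (l : ℂ) {k : ℕ} (hk : k % 6 = 1 ∨ k % 6 = 2) (c : ℂ) :
    fiberRot (modelFiberMap l k c) = modelFiberMap l k (I * c) := by
  ext i
  rcases hk with h | h <;> fin_cases i <;> simp [fiberRot, modelFiberMap, h] <;> ring

theorem fiberRot_modelFiberMap_of_gt (l : ℂ) {k : ℕ} (hk : k % 6 = 4 ∨ k % 6 = 5) (c : ℂ) :
    fiberRot (modelFiberMap l k c) = modelFiberMap l k (-(I * c)) := by
  ext i
  rcases hk with h | h <;> fin_cases i <;> simp [fiberRot, modelFiberMap, h] <;> ring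

variable {m : ℕ}

/-- The model sequence of the direct sum. -/
def modelMap (a : Fin m → ℝ) (l : Fin m → ℂ) (k : ℕ) : ℂ →ₗ[ℝ] PiLp 2 fun _ : Fin m => ModelFiber :=
  sumLin a fun j => modelFiberMap (l j) k

/-- The span of the first terms of the model sequence. -/
def modelSpace (a : Fin m → ℝ) (l : Fin m → ℂ) :
    ℕ → Submodule ℝ (PiLp 2 fun _ : Fin m => ModelFiber)
  | 0 => LinearMap.range (modelMap a l 0)
  | r + 1 => modelSpace a l r ⊔ LinearMap.range (modelMap a l (r + 1))

/-- The `s`-th term of the model sequence, projected off its predecessors: the model of the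
`s`-th fundamental form. -/
def modelForm (a : Fin m → ℝ) (l : Fin m → ℂ) (s : ℕ) :
    ℂ →ₗ[ℝ] PiLp 2 fun _ : Fin m => ModelFiber :=
  ((modelSpace a l s)ᗮ.starProjection : _ →ₗ[ℝ] _) ∘ₗ modelMap a l (s + 1)

theorem modelMap_range_le (a : Fin m → ℝ) (l : Fin m → ℂ) {k r : ℕ} (h : k ≤ r) :
    LinearMap.range (modelMap a l k) ≤ modelSpace a l r := by
  induction r with
  | zero => obtain rfl : k = 0 := by omega
            exact le_rfl
  | succ r ih =>
    rcases Nat.lt_or_ge r k with h' | h'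
    · obtain rfl : k = r + 1 := by omega
      exact le_sup_right
    · exact (ih h').trans le_sup_left

theorem modelSpace_le {a : Fin m → ℝ} {l : Fin m → ℂ} {r : ℕ}
    {V : Submodule ℝ (PiLp 2 fun _ : Fin m => ModelFiber)}
    (h : ∀ k ≤ r, ∀ c, modelMap a l k c ∈ V) : modelSpace a l r ≤ V := by
  induction r with
  | zero => rintro _ ⟨c, rfl⟩; exact h 0 le_rfl c
  | succ r ih =>
    refine sup_le (ih fun k hk => h k (by omega)) ?_
    rintro _ ⟨c, rfl⟩
    exact h _ le_rfl c

/-- Rotation of the last two slots, in all the copies of `ℝ⁶`. -/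
def modelRot : (PiLp 2 fun _ : Fin m => ModelFiber) →ₗᵢ[ℝ] PiLp 2 fun _ : Fin m => ModelFiber :=
  sumIsometry fun _ => fiberRot

theorem exists_modelRot_modelMap (k : ℕ) : ∃ δ : ℂ, δ ≠ 0 ∧ ∀ (a : Fin m → ℝ) (l : Fin m → ℂ) c,
    modelRot (modelMap a l k c) = modelMap a l k (δ * c) := by
  have : k % 3 = 0 ∨ (k % 6 = 1 ∨ k % 6 = 2) ∨ (k % 6 = 4 ∨ k % 6 = 5) := by omega
  rcases this with h | h | h
  · exact ⟨1, one_ne_zero, fun a l c => by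
      simp [modelMap, sumLin_apply, modelRot, sumIsometry_sumVec, fiberRot_modelFiberMap_of_zero,
        h]⟩
  · exact ⟨I, I_ne_zero, fun a l c => by
      simp [modelMap, sumLin_apply, modelRot, sumIsometry_sumVec, fiberRot_modelFiberMap_of_lt, h]⟩
  · exact ⟨-I, neg_ne_zero.2 I_ne_zero, fun a l c => by
      simp [modelMap, sumLin_apply, modelRot, sumIsometry_sumVec, fiberRot_modelFiberMap_of_gt, h]⟩

theorem LinearIsometry.starProjection_orthogonal_of_map_eq {E F : Type*} [NormedAddCommGroup E]
    [InnerProductSpace ℝ E] [FiniteDimensional ℝ E] [NormedAddCommGroup F] [InnerProductSpace ℝ F]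
    [FiniteDimensional ℝ F] (f : E →ₗᵢ[ℝ] F) {V : Submodule ℝ E} {V' : Submodule ℝ F}
    (h : V.map f.toLinearMap = V') (x : E) :
    V'ᗮ.starProjection (f x) = f (Vᗮ.starProjection x) := by
  subst h
  rw [Submodule.starProjection_orthogonal_val, Submodule.starProjection_orthogonal_val, map_sub,
    f.map_starProjection]

theorem map_modelRot_modelSpace (a : Fin m → ℝ) (l : Fin m → ℂ) (r : ℕ) :
    (modelSpace a l r).map (modelRot (m := m)).toLinearMap = modelSpace a l r := by
  have key : ∀ k, (LinearMap.range (modelMap a l k)).map (modelRot (m := m)).toLinearMap =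
      LinearMap.range (modelMap a l k) := by
    intro k
    obtain ⟨δ, hδ, h⟩ := exists_modelRot_modelMap (m := m) k
    ext x
    constructor
    · rintro ⟨_, ⟨c, rfl⟩, rfl⟩
      exact ⟨δ * c, (h a l c).symm⟩
    · rintro ⟨c, rfl⟩
      refine ⟨_, ⟨δ⁻¹ * c, rfl⟩, (h a l _).trans ?_⟩
      rw [mul_inv_cancel_left₀ hδ]
  induction r with
  | zero => exact key 0
  | succ r ih => rw [modelSpace, Submodule.map_sup, ih, key]

/-- The model of the fundamental form of order `s + 1` is circular unless `3` divides `s + 1`: then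
`modelRot` multiplies the argument of the term of order `s + 1` by `i` or `-i`. -/
theorem inner_modelForm_I_mul (a : Fin m → ℝ) (l : Fin m → ℂ) {s : ℕ} (hs : s % 3 ≠ 2) (c d : ℂ) :
    ⟪modelForm a l s (I * c), modelForm a l s (I * d)⟫_ℝ =
      ⟪modelForm a l s c, modelForm a l s d⟫_ℝ := by
  have hrot : ∀ x, modelRot ((modelSpace a l s)ᗮ.starProjection x) =
      (modelSpace a l s)ᗮ.starProjection (modelRot x) := fun x =>
    ((modelRot (m := m)).starProjection_orthogonal_of_map_eq (map_modelRot_modelSpace a l s) x).symm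
  have h : ((s + 1) % 6 = 1 ∨ (s + 1) % 6 = 2) ∨ ((s + 1) % 6 = 4 ∨ (s + 1) % 6 = 5) := by omega
  rcases h with h | h
  · have key : ∀ c, modelForm a l s (I * c) = modelRot (modelForm a l s c) := fun c => by
      simp only [modelForm, LinearMap.comp_apply, ContinuousLinearMap.coe_coe, hrot]
      simp [modelMap, sumLin_apply, modelRot, sumIsometry_sumVec, fiberRot_modelFiberMap_of_lt, h]
    rw [key, key, LinearIsometry.inner_map_map]
  · have key : ∀ c, modelForm a l s (I * c) = -modelRot (modelForm a l s c) := fun c => by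
      simp only [modelForm, LinearMap.comp_apply, ContinuousLinearMap.coe_coe, hrot, ← map_neg]
      simp [modelMap, sumLin_apply, modelRot, sumIsometry_sumVec, fiberRot_modelFiberMap_of_gt, h]
    rw [key, key, inner_neg_neg, LinearIsometry.inner_map_map]

end Model

/-! ### Independence of the model sequence -/

section Independence

open Polynomial

theorem Polynomial.eq_zero_of_mem_degreeLT {m : ℕ} {μ : Fin m → ℂ} (hμ : Function.Injective μ)
    {P : ℂ[X]} (hP : P ∈ degreeLT ℂ m) (h : ∀ j, P.eval (μ j) = 0) : P = 0 := by
  by_contra h0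
  have hd : P.natDegree < m := (natDegree_lt_iff_degree_lt h0).2 (mem_degreeLT.1 hP)
  exact h0 (eq_zero_of_natDegree_lt_card_of_eval_eq_zero P hμ h (by simpa using hd))

theorem Polynomial.X_mul_mem_degreeLT {d : ℕ} {P : ℂ[X]} (hP : P ∈ degreeLT ℂ d) :
    X * P ∈ degreeLT ℂ (d + 1) := by
  rw [mem_degreeLT] at hP ⊢
  rcases eq_or_ne P 0 with rfl | h0
  · simp
  · have hP := (natDegree_lt_iff_degree_lt h0).2 hP
    rw [← natDegree_lt_iff_degree_lt (mul_ne_zero X_ne_zero h0), natDegree_X_mul h0]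
    omega

theorem Polynomial.C_mul_X_pow_mem_degreeLT {d n : ℕ} (h : n < d) (c : ℂ) :
    C c * X ^ n ∈ degreeLT ℂ d :=
  mem_degreeLT.2 ((degree_C_mul_X_pow_le n c).trans_lt (by exact_mod_cast h))

variable {m : ℕ}

/-- The functions `j ↦ l_j ^ A * P (l_j ^ 2)` with a polynomial `P` of degree less than `d`. -/
def laurentSpace (l : Fin m → ℂ) (A : ℤ) (d : ℕ) : Submodule ℂ (Fin m → ℂ) where
  carrier := {F | ∃ P ∈ degreeLT ℂ d, ∀ j, F j = l j ^ A * P.eval (l j ^ 2)}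
  zero_mem' := ⟨0, zero_mem _, by simp⟩
  add_mem' := by
    rintro F G ⟨P, hP, hF⟩ ⟨Q, hQ, hG⟩
    exact ⟨P + Q, add_mem hP hQ, fun j => by simp [hF, hG, mul_add]⟩
  smul_mem' := by
    rintro c F ⟨P, hP, hF⟩
    exact ⟨c • P, Submodule.smul_mem _ c hP, fun j => by simp [hF]; ring⟩

theorem monomial_mem_laurentSpace {l : Fin m → ℂ} (hl : ∀ j, l j ≠ 0) {A : ℤ} {d t : ℕ}
    (ht : t < d) {n : ℤ} (hn : n = A + 2 * t) (c : ℂ) :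
    (fun j => l j ^ n * c) ∈ laurentSpace l A d :=
  ⟨C c * X ^ t, C_mul_X_pow_mem_degreeLT ht c, fun j => by
    simp only [eval_mul, eval_C, eval_pow, eval_X]
    rw [hn, zpow_add₀ (hl j), ← pow_mul]
    norm_cast
    ring⟩

/-- The slot `i` of all the copies of `ℝ⁶`, rescaled by the coefficients `a` and composed with a
real linear map. -/
def slotFn (a : Fin m → ℝ) (i : Fin 3) (g : ℂ →ₗ[ℝ] ℂ) :
    (PiLp 2 fun _ : Fin m => ModelFiber) →ₗ[ℝ] Fin m → ℂ where
  toFun x j := (a j)⁻¹ • g (x j i)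
  map_add' x y := by
    ext j
    change (a j)⁻¹ • g (x j i + y j i) = (a j)⁻¹ • g (x j i) + (a j)⁻¹ • g (y j i)
    rw [map_add, smul_add]
  map_smul' s x := by
    ext j
    change (a j)⁻¹ • g (s • x j i) = s • (a j)⁻¹ • g (x j i)
    rw [map_smul, smul_comm]

theorem slotFn_modelMap {a : Fin m → ℝ} (ha : ∀ j, a j ≠ 0) (i : Fin 3) (g : ℂ →ₗ[ℝ] ℂ)
    (l : Fin m → ℂ) (k : ℕ) (c : ℂ) :
    slotFn a i g (modelMap a l k c) = fun j => g (modelFiberMap (l j) k c i) := by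
  ext j
  change (a j)⁻¹ • g (a j • modelFiberMap (l j) k c i) = _
  rw [map_smul, inv_smul_smul₀ (ha j)]

theorem slotFn_mem_of_mem_modelSpace {a : Fin m → ℝ} (ha : ∀ j, a j ≠ 0) {i : Fin 3}
    {g : ℂ →ₗ[ℝ] ℂ} {l : Fin m → ℂ} {r : ℕ} {A : ℤ} {d : ℕ}
    (h : ∀ k ≤ r, ∀ c, (fun j => g (modelFiberMap (l j) k c i)) ∈ laurentSpace l A d) {k : ℕ}
    {c : ℂ} (hx : modelMap a l k c ∈ modelSpace a l r) :
    ∃ P ∈ degreeLT ℂ d, ∀ j, g (modelFiberMap (l j) k c i) = l j ^ A * P.eval (l j ^ 2) := by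
  have h1 : modelSpace a l r ≤
      ((laurentSpace l A d).restrictScalars ℝ).comap (slotFn a i g) :=
    modelSpace_le fun k hk c => by
    rw [Submodule.mem_comap, slotFn_modelMap ha]
    exact h k hk c
  have h2 := h1 hx
  rw [Submodule.mem_comap, slotFn_modelMap ha] at h2
  exact h2

theorem conj_pow_mul {l : ℂ} (hl : normSq l = 1) (n : ℕ) (c : ℂ) :
    starRingEnd ℂ (l ^ n * c) = l ^ (-(n : ℤ)) * starRingEnd ℂ c := by
  have : starRingEnd ℂ l = l⁻¹ := by
    rw [inv_def, hl]
    simp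
  rw [map_mul, map_pow, this, zpow_neg, zpow_natCast, inv_pow]

variable {a : Fin m → ℝ} {l : Fin m → ℂ}

theorem ne_zero_of_normSq_eq_one {l : ℂ} (h : normSq l = 1) : l ≠ 0 := by
  rintro rfl
  simp at h

/-- The terms with values in the tangent and first normal planes, in the first half of a period.
They carry the power `l ^ (2 q)`, while the earlier terms in the same slot carry the powers
`l ^ n` with `n` even and `-2 q ≤ n < 2 q`. -/
theorem eq_zero_of_modelMap_mem_up (ha : ∀ j, a j ≠ 0) (hl : ∀ j, normSq (l j) = 1)
    (hinj : Function.Injective fun j => l j ^ 2) {r : ℕ}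
    (hr : (r + 1) % 6 = 1 ∨ (r + 1) % 6 = 2) (hm : r + 1 ≤ 3 * m - 1) {c : ℂ}
    (h : modelMap a l (r + 1) c ∈ modelSpace a l r) : c = 0 := by
  have hl0 : ∀ j, l j ≠ 0 := fun j => ne_zero_of_normSq_eq_one (hl j)
  obtain ⟨i, hi0, hi, hi'⟩ : ∃ i : Fin 3, i ≠ 0 ∧ (r + 1) % 6 = i ∧ ∀ (l : ℂ) k c,
      modelFiberMap l k c i = if k % 6 = i then l ^ (k / 3) * c else
        if k % 6 = 6 - (i : ℕ) then starRingEnd ℂ (l ^ (k / 3 + 1) * c) else 0 := by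
    rcases hr with hr | hr
    · exact ⟨1, by decide, hr, fun l k c => rfl⟩
    · exact ⟨2, by decide, hr, fun l k c => rfl⟩
  have hi3 := i.2
  have hi1 : 1 ≤ (i : ℕ) := Nat.one_le_iff_ne_zero.2 fun h => hi0 (Fin.ext h)
  set q := (r + 1) / 6 with hq
  have hd : (r + 1) / 3 = 2 * q := by omega
  have hlow : ∀ k ≤ r, ∀ c, (fun j => (LinearMap.id : ℂ →ₗ[ℝ] ℂ) (modelFiberMap (l j) k c i)) ∈
      laurentSpace l (-(2 * q : ℕ)) (2 * q) := fun k hk c => by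
    simp only [hi', LinearMap.id_apply]
    split_ifs with h1 h2
    · exact monomial_mem_laurentSpace hl0 (t := q + k / 6) (by omega) (n := (k / 3 : ℕ))
        (by omega) c
    · simp only [conj_pow_mul (hl _)]
      exact monomial_mem_laurentSpace hl0 (t := q - 1 - k / 6) (by omega) (by omega) _
    · exact zero_mem _
  obtain ⟨P, hP, hPe⟩ := slotFn_mem_of_mem_modelSpace ha hlow h
  have hQ : C c * X ^ (2 * q) - P = 0 := by
    refine Polynomial.eq_zero_of_mem_degreeLT hinj (sub_mem
      (C_mul_X_pow_mem_degreeLT (by omega) c) (degreeLT_mono (by omega) hP)) fun j => ?_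
    have := hPe j
    rw [hi', if_pos hi, hd, zpow_neg, zpow_natCast, LinearMap.id_apply] at this
    simp only [eval_sub, eval_mul, eval_C, eval_pow, eval_X]
    have h0 := pow_ne_zero (2 * q) (hl0 j)
    field_simp at this
    rw [← this]
    ring
  have := congrArg (fun Q : ℂ[X] => Q.coeff (2 * q)) hQ
  simpa [coeff_eq_zero_of_degree_lt (mem_degreeLT.1 hP)] using this

/-- The terms with values in the tangent and first normal planes, in the second half of a period.
Being conjugated, they carry the power `l ^ (-(2 q + 2))`, while the earlier terms in the same slot
carry the powers `l ^ n` with `n` even and `-2 q ≤ n ≤ 2 q`. -/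
theorem eq_zero_of_modelMap_mem_down (ha : ∀ j, a j ≠ 0) (hl : ∀ j, normSq (l j) = 1)
    (hinj : Function.Injective fun j => l j ^ 2) {r : ℕ}
    (hr : (r + 1) % 6 = 4 ∨ (r + 1) % 6 = 5) (hm : r + 1 ≤ 3 * m - 1) {c : ℂ}
    (h : modelMap a l (r + 1) c ∈ modelSpace a l r) : c = 0 := by
  have hl0 : ∀ j, l j ≠ 0 := fun j => ne_zero_of_normSq_eq_one (hl j)
  obtain ⟨i, hi0, hi, hi'⟩ : ∃ i : Fin 3, i ≠ 0 ∧ (r + 1) % 6 = 6 - (i : ℕ) ∧ ∀ (l : ℂ) k c,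
      modelFiberMap l k c i = if k % 6 = i then l ^ (k / 3) * c else
        if k % 6 = 6 - (i : ℕ) then starRingEnd ℂ (l ^ (k / 3 + 1) * c) else 0 := by
    rcases hr with hr | hr
    · exact ⟨2, by decide, hr, fun l k c => rfl⟩
    · exact ⟨1, by decide, hr, fun l k c => rfl⟩
  have hi3 := i.2
  have hi1 : 1 ≤ (i : ℕ) := Nat.one_le_iff_ne_zero.2 fun h => hi0 (Fin.ext h)
  set q := (r + 1) / 6 with hq
  have hd : (r + 1) / 3 + 1 = 2 * q + 2 := by omega
  have hlow : ∀ k ≤ r, ∀ c, (fun j => (LinearMap.id : ℂ →ₗ[ℝ] ℂ) (modelFiberMap (l j) k c i)) ∈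
      laurentSpace l (-(2 * q : ℕ)) (2 * q + 1) := fun k hk c => by
    simp only [hi', LinearMap.id_apply]
    split_ifs with h1 h2
    · exact monomial_mem_laurentSpace hl0 (t := q + k / 6) (by omega) (n := (k / 3 : ℕ))
        (by omega) c
    · simp only [conj_pow_mul (hl _)]
      exact monomial_mem_laurentSpace hl0 (t := q - 1 - k / 6) (by omega) (by omega) _
    · exact zero_mem _
  obtain ⟨P, hP, hPe⟩ := slotFn_mem_of_mem_modelSpace ha hlow h
  have hQ : C (starRingEnd ℂ c) * X ^ 0 - X * P = 0 := by
    refine Polynomial.eq_zero_of_mem_degreeLT hinj (sub_mem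
      (C_mul_X_pow_mem_degreeLT (by omega) _)
      (degreeLT_mono (by omega) (X_mul_mem_degreeLT hP))) fun j => ?_
    have := hPe j
    rw [hi', if_neg (by omega), if_pos hi, hd, conj_pow_mul (hl j), zpow_neg, zpow_natCast,
      zpow_neg, zpow_natCast, LinearMap.id_apply] at this
    simp only [eval_sub, eval_mul, eval_C, eval_pow, eval_X]
    have h0 := hl0 j
    field_simp at this
    have h1 := pow_ne_zero (2 * q) h0
    refine mul_right_cancel₀ h1 ?_
    linear_combination this
  have := congrArg (fun Q : ℂ[X] => Q.coeff 0) hQ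
  simpa using this

/-- A dependence of a term with values in the span of `u` and `η`, which is a real part and thus
carries the two powers `l ^ n` and `l ^ (-n)`. -/
theorem exists_polynomial_of_modelMap_mem (ha : ∀ j, a j ≠ 0) (hl : ∀ j, normSq (l j) = 1) {n : ℕ}
    {r : ℕ} (hr : r + 1 = 3 * n) {c : ℂ} (h : modelMap a l (r + 1) c ∈ modelSpace a l r) :
    ∃ P ∈ degreeLT ℂ (n - 1), ∀ j, c * (l j ^ 2) ^ n + starRingEnd ℂ c =
      l j ^ 2 * P.eval (l j ^ 2) := by
  have hl0 : ∀ j, l j ≠ 0 := fun j => ne_zero_of_normSq_eq_one (hl j)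
  have two_re : ∀ w : ℂ, 2 * (w.re : ℂ) = w + starRingEnd ℂ w := fun w => by
    rw [add_conj]; push_cast; rfl
  obtain ⟨g, hg⟩ : ∃ g : ℂ →ₗ[ℝ] ℂ, ∀ j k c, g (modelFiberMap (l j) k c 0) =
      if k % 6 = 3 * n % 6 then l j ^ ((k / 3 : ℕ) : ℤ) * c +
        l j ^ (-(k / 3 : ℕ) : ℤ) * starRingEnd ℂ c else 0 := by
    have hcase : ∀ l : ℂ, normSq l = 1 → ∀ k c, (2 : ℝ) • (((l ^ (k / 3) * c).re : ℝ) : ℂ) =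
        l ^ ((k / 3 : ℕ) : ℤ) * c + l ^ (-(k / 3 : ℕ) : ℤ) * starRingEnd ℂ c := fun l hl k c => by
      rw [← conj_pow_mul hl, zpow_natCast, ← two_re, real_smul]
      rfl
    -- twice the real part, or twice the imaginary part, of the first slot
    have : 3 * n % 6 = 0 ∨ 3 * n % 6 = 3 := by omega
    rcases this with h3 | h3
    · refine ⟨(2 : ℝ) • (ofRealCLM.toLinearMap ∘ₗ reLm), fun j k c => ?_⟩
      rw [← hcase _ (hl j), h3]
      simp only [modelFiberMap, LinearMap.coe_mk, AddHom.coe_mk, Matrix.cons_val_zero]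
      split_ifs with h1 h2 <;> simp
    · refine ⟨(2 : ℝ) • (ofRealCLM.toLinearMap ∘ₗ imLm), fun j k c => ?_⟩
      rw [← hcase _ (hl j), h3]
      simp only [modelFiberMap, LinearMap.coe_mk, AddHom.coe_mk, Matrix.cons_val_zero]
      split_ifs with h1 h2
      · omega
      all_goals simp
  have hlow : ∀ k ≤ r, ∀ c, (fun j => g (modelFiberMap (l j) k c 0)) ∈
      laurentSpace l (2 - n) (n - 1) := fun k hk c => by
    simp only [hg]
    split_ifs with h1
    · obtain ⟨q, hq⟩ : ∃ q, n = k / 3 + 2 + 2 * q := ⟨(n - k / 3 - 2) / 2, by omega⟩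
      exact add_mem (monomial_mem_laurentSpace hl0 (t := k / 3 + q) (by omega) (by omega) _)
        (monomial_mem_laurentSpace hl0 (t := q) (by omega) (by omega) _)
    · exact zero_mem _
  obtain ⟨P, hP, hPe⟩ := slotFn_mem_of_mem_modelSpace ha hlow h
  refine ⟨P, hP, fun j => ?_⟩
  have := hPe j
  rw [hg, if_pos (by omega), show (r + 1) / 3 = n by omega] at this
  rw [zpow_sub₀ (hl0 j), zpow_neg] at this
  norm_cast at this
  have h0 := hl0 j
  field_simp at this
  rw [← this]
  ring

/-- The terms of order at most `3 m - 1` are injective, with values independent of the earlier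
terms: a dependence is a nonzero polynomial of degree less than `m` that vanishes at the `m` numbers
`l j ^ 2`. -/
theorem eq_zero_of_modelMap_mem (ha : ∀ j, a j ≠ 0) (hl : ∀ j, normSq (l j) = 1)
    (hinj : Function.Injective fun j => l j ^ 2) {r : ℕ} (hm : r + 1 ≤ 3 * m - 1) {c : ℂ}
    (h : modelMap a l (r + 1) c ∈ modelSpace a l r) : c = 0 := by
  have : (r + 1) % 3 = 0 ∨ ((r + 1) % 6 = 1 ∨ (r + 1) % 6 = 2) ∨
    ((r + 1) % 6 = 4 ∨ (r + 1) % 6 = 5) := by omega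
  rcases this with h1 | h1 | h1
  · obtain ⟨n, hn⟩ : ∃ n, r + 1 = 3 * n := ⟨(r + 1) / 3, by omega⟩
    obtain ⟨P, hP, hPe⟩ := exists_polynomial_of_modelMap_mem ha hl hn h
    have hQ : C c * X ^ n + C (starRingEnd ℂ c) * X ^ 0 - X * P = 0 := by
      refine Polynomial.eq_zero_of_mem_degreeLT hinj (sub_mem (add_mem
        (C_mul_X_pow_mem_degreeLT (by omega) _) (C_mul_X_pow_mem_degreeLT (by omega) _))
        (degreeLT_mono (by omega) (X_mul_mem_degreeLT hP))) fun j => ?_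
      simp [hPe j]
    have := congrArg (fun Q : ℂ[X] => Q.coeff 0) hQ
    simpa [coeff_X_pow, show n ≠ 0 by omega, show 0 ≠ n by omega] using this
  · exact eq_zero_of_modelMap_mem_up ha hl hinj h1 hm h
  · exact eq_zero_of_modelMap_mem_down ha hl hinj h1 hm h

/-- The term of order `3 m` is not in the span of its predecessors. For one argument `c` the
polynomial relation can hold, as it has degree `m`; the leading terms cancel between the relations
for `1` and for `i`. -/
theorem exists_modelMap_notMem (ha : ∀ j, a j ≠ 0) (hl : ∀ j, normSq (l j) = 1)
    (hinj : Function.Injective fun j => l j ^ 2) {r : ℕ} (hr : r + 1 = 3 * m) :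
    ∃ c, modelMap a l (r + 1) c ∉ modelSpace a l r := by
  by_contra! h
  obtain ⟨P, hP, hPe⟩ := exists_polynomial_of_modelMap_mem ha hl hr (h 1)
  obtain ⟨Q, hQ, hQe⟩ := exists_polynomial_of_modelMap_mem ha hl hr (h I)
  have h0 : C (2 * I) * X ^ 0 - X * (C I * P - Q) = 0 := by
    refine Polynomial.eq_zero_of_mem_degreeLT hinj (sub_mem
        (C_mul_X_pow_mem_degreeLT (by omega) _) (degreeLT_mono (by omega)
          (X_mul_mem_degreeLT (sub_mem ?_ hQ)))) fun j => ?_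
    · rw [← smul_eq_C_mul]
      exact Submodule.smul_mem _ _ hP
    · have h1 := hPe j
      have h2 := hQe j
      simp only [map_one, conj_I] at h1 h2
      simp only [eval_sub, eval_mul, eval_C, eval_pow, eval_X]
      linear_combination I * h1 - h2
  have := congrArg (fun Q : ℂ[X] => Q.coeff 0) h0
  simp at this

end Independence

/-! ### The fundamental forms of the direct sum -/

section ModelRank

theorem finrank_piLp_const {E : Type*} [NormedAddCommGroup E] [InnerProductSpace ℝ E]
    [FiniteDimensional ℝ E] (m : ℕ) :
    Module.finrank ℝ (PiLp 2 fun _ : Fin m => E) = m * Module.finrank ℝ E := by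
  rw [LinearEquiv.finrank_eq (WithLp.linearEquiv 2 ℝ (Fin m → E)), Module.finrank_pi_fintype]
  simp

theorem finrank_modelFiber : Module.finrank ℝ ModelFiber = 6 := by
  rw [LinearEquiv.finrank_eq (WithLp.linearEquiv 2 ℝ (Fin 3 → ℂ)), Module.finrank_pi_fintype]
  simp [finrank_real_complex]

variable {m : ℕ} {a : Fin m → ℝ} {l : Fin m → ℂ}

theorem modelForm_eq_zero_iff {s : ℕ} {c : ℂ} :
    modelForm a l s c = 0 ↔ modelMap a l (s + 1) c ∈ modelSpace a l s := by
  rw [modelForm, LinearMap.comp_apply, ContinuousLinearMap.coe_coe,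
    Submodule.starProjection_apply_eq_zero_iff, Submodule.orthogonal_orthogonal]

theorem modelForm_injective (ha : ∀ j, a j ≠ 0) (hl : ∀ j, normSq (l j) = 1)
    (hinj : Function.Injective fun j => l j ^ 2) {s : ℕ} (hs : s + 1 ≤ 3 * m - 1) :
    Function.Injective (modelForm a l s) :=
  (injective_iff_map_eq_zero _).2 fun _ h =>
    eq_zero_of_modelMap_mem ha hl hinj hs (modelForm_eq_zero_iff.1 h)

theorem modelForm_norm_pos (ha : ∀ j, a j ≠ 0) (hl : ∀ j, normSq (l j) = 1)
    (hinj : Function.Injective fun j => l j ^ 2) {s : ℕ} (hs : s + 1 ≤ 3 * m) :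
    0 < ‖modelForm a l s 1‖ ^ 2 + ‖modelForm a l s I‖ ^ 2 := by
  by_contra! h
  have h1 : modelForm a l s 1 = 0 := by
    have : ‖modelForm a l s 1‖ ^ 2 = 0 := by
      nlinarith [sq_nonneg ‖modelForm a l s 1‖, sq_nonneg ‖modelForm a l s I‖]
    simpa only [sq_eq_zero_iff, norm_eq_zero] using this
  have h2 : modelForm a l s I = 0 := by
    have : ‖modelForm a l s I‖ ^ 2 = 0 := by
      nlinarith [sq_nonneg ‖modelForm a l s 1‖, sq_nonneg ‖modelForm a l s I‖]
    simpa only [sq_eq_zero_iff, norm_eq_zero] using this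
  have h0 : ∀ c, modelForm a l s c = 0 := fun c => by
    rw [LinearMap.apply_eq_re_im, h1, h2]
    simp
  rcases Nat.lt_or_ge (s + 1) (3 * m) with h' | h'
  · exact one_ne_zero (modelForm_injective ha hl hinj (by omega) ((h0 1).trans (h0 0).symm))
  · obtain ⟨c, hc⟩ := exists_modelMap_notMem ha hl hinj (le_antisymm hs h')
    exact hc (modelForm_eq_zero_iff.1 (h0 c))

/-- Position vector and two dimensions for each term: all the dimensions but one are exhausted by
the terms of order at most `3 m - 1`. -/
theorem le_finrank_modelSpace (ha : ∀ j, a j ≠ 0) (hl : ∀ j, normSq (l j) = 1)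
    (hinj : Function.Injective fun j => l j ^ 2) (j₀ : Fin m) {r : ℕ} (hr : r ≤ 3 * m - 1) :
    2 * r + 1 ≤ Module.finrank ℝ (modelSpace a l r) := by
  induction r with
  | zero =>
    have h0 : modelMap a l 0 1 ≠ 0 := fun h => by
      have := congrArg (fun x => x j₀ 0) h
      simp [modelMap, sumLin_apply, sumVec, modelFiberMap, ha j₀] at this
    have : Nontrivial (modelSpace a l 0) :=
      ⟨⟨⟨_, LinearMap.mem_range_self _ 1⟩, 0, fun h => h0 (congrArg Subtype.val h)⟩⟩
    exact Module.finrank_pos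
  | succ r ih =>
    have h1 := Submodule.finrank_sup_add_finrank_inf_eq (modelSpace a l r)
      (LinearMap.range (modelMap a l (r + 1)))
    have h2 : modelSpace a l r ⊓ LinearMap.range (modelMap a l (r + 1)) = ⊥ := by
      rw [eq_bot_iff]
      rintro _ ⟨hx, c, rfl⟩
      simp [eq_zero_of_modelMap_mem ha hl hinj hr hx]
    have h3 : Function.Injective (modelMap a l (r + 1)) :=
      (injective_iff_map_eq_zero _).2 fun c hc =>
        eq_zero_of_modelMap_mem ha hl hinj hr (hc ▸ zero_mem _)
    rw [h2, finrank_bot, LinearMap.finrank_range_of_inj h3, finrank_real_complex] at h1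
    rw [modelSpace]
    have := ih (by omega)
    omega

theorem modelSpace_eq_top (ha : ∀ j, a j ≠ 0) (hl : ∀ j, normSq (l j) = 1)
    (hinj : Function.Injective fun j => l j ^ 2) (j₀ : Fin m) : modelSpace a l (3 * m) = ⊤ := by
  have hm : 0 < m := j₀.pos
  obtain ⟨r, hr⟩ : ∃ r, 3 * m = r + 1 := ⟨3 * m - 1, by omega⟩
  have h1 := le_finrank_modelSpace ha hl hinj j₀ (r := r) (by omega)
  obtain ⟨c, hc⟩ := exists_modelMap_notMem ha hl hinj hr.symm
  have h2 : modelSpace a l r < modelSpace a l (r + 1) :=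
    lt_of_le_of_ne le_sup_left fun h => hc (h ▸ modelMap_range_le a l le_rfl ⟨c, rfl⟩)
  have h3 := Submodule.finrank_lt_finrank_of_lt h2
  have h4 : Module.finrank ℝ (PiLp 2 fun _ : Fin m => ModelFiber) = m * 6 := by
    rw [finrank_piLp_const, finrank_modelFiber]
  rw [hr]
  exact Submodule.eq_top_of_finrank_eq (le_antisymm (Submodule.finrank_le _) (by omega))

end ModelRank

section Frame

variable {E : Type*} [NormedAddCommGroup E] [InnerProductSpace ℝ E] [FiniteDimensional ℝ E]
  {U : Set ℂ} {u : ℂ → E} {W₁ W₂ : ℂ → ℂ →ₗ[ℝ] E} {η : ℂ → E} {ρ₁ ρ₂ : ℂ → ℝ} {ψ : ℂ → ℂ}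

/-- The linear isometry from the model onto the ambient space given by the frame at `z`. -/
def IsFramedChart.isometry (h : IsFramedChart U u W₁ W₂ η ρ₁ ρ₂) {z : ℂ} (hz : z ∈ U) :
    ModelFiber →ₗᵢ[ℝ] E where
  toFun x := (x 0).re • u z + (x 0).im • η z + W₁ z ((√(ρ₁ z))⁻¹ • x 1) + W₂ z ((√(ρ₂ z))⁻¹ • x 2)
  map_add' x y := by
    simp only [PiLp.add_apply, add_re, add_im, add_smul, smul_add, map_add]
    abel
  map_smul' s x := by
    simp only [PiLp.smul_apply, smul_re, smul_im, map_smul, smul_comm _ s, smul_add, smul_assoc,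
      RingHom.id_apply]
  norm_map' x := by
    have h1 : √(ρ₁ z) ^ 2 = ρ₁ z := Real.sq_sqrt (h.ρ₁_pos z hz).le
    have h2 : √(ρ₂ z) ^ 2 = ρ₂ z := Real.sq_sqrt (h.ρ₂_pos z hz).le
    have h1' := (Real.sqrt_pos.2 (h.ρ₁_pos z hz)).ne'
    have h2' := (Real.sqrt_pos.2 (h.ρ₂_pos z hz)).ne'
    rw [← sq_eq_sq₀ (norm_nonneg _) (norm_nonneg _), PiLp.norm_sq_eq_of_L2, Fin.sum_univ_three]
    change ‖(x 0).re • u z + (x 0).im • η z + W₁ z ((√(ρ₁ z))⁻¹ • x 1) +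
      W₂ z ((√(ρ₂ z))⁻¹ • x 2)‖ ^ 2 = _
    have e1 : ∀ c, ‖W₁ z c‖ ^ 2 = ρ₁ z * normSq c := fun c => by
      rw [← real_inner_self_eq_norm_sq, h.inner_W₁ z hz, mul_conj, ofReal_re]
    have e2 : ∀ c, ‖W₂ z c‖ ^ 2 = ρ₂ z * normSq c := fun c => by
      rw [← real_inner_self_eq_norm_sq, h.inner_W₂ z hz, mul_conj, ofReal_re]
    rw [norm_add_sq_real, norm_add_sq_real, norm_add_sq_real, e1, e2]
    simp only [inner_add_left, inner_smul_left, inner_smul_right, h.inner_u_W₁ hz, h.inner_u_W₂ hz,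
      h.inner_W₁_W₂ hz, h.inner_u_η z hz, real_inner_comm _ (η z), h.inner_W₁_η z hz,
      h.inner_W₂_η z hz, norm_smul, h.norm_u z hz, h.norm_η z hz, real_smul, normSq_mul,
      normSq_ofReal, ← normSq_eq_norm_sq]
    rw [normSq_apply (x 0)]
    simp only [Real.norm_eq_abs, mul_one, sq_abs, mul_zero, add_zero]
    field_simp
    rw [h1, h2]
    ring

/-- The factor by which the osculating sequence differs from its model. It does not depend on the
member of the associated family. -/
def modelFactor (ρ₁ ρ₂ : ℝ) (ψ : ℂ) (k : ℕ) : ℂ :=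
  match k % 6 with
  | 0 => 2 * (-ψ ^ 2) ^ (k / 6)
  | 1 => √ρ₁ * (-ψ ^ 2) ^ (k / 6)
  | 2 => √ρ₂ * (-ψ ^ 2) ^ (k / 6)
  | 3 => 2 * ψ * (-ψ ^ 2) ^ (k / 6)
  | 4 => √ρ₂ * (2 / ρ₂ : ℝ) * (-ψ ^ 2) ^ (k / 6 + 1)
  | _ => -(√ρ₁ * (2 / ρ₁ : ℝ)) * (-ψ ^ 2) ^ (k / 6 + 1)

theorem IsFramedChart.cycSeq_eq_isometry (h : IsFramedChart U u W₁ W₂ η ρ₁ ρ₂) {z : ℂ} (hz : z ∈ U)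
    (lam : ℂ) (k : ℕ) (c : ℂ) :
    cycSeq ρ₁ ρ₂ (fun z => lam * ψ z) u W₁ W₂ η k z c =
      h.isometry hz (modelFiberMap lam k (modelFactor (ρ₁ z) (ρ₂ z) (ψ z) k * c)) := by
  have h1' := (Real.sqrt_pos.2 (h.ρ₁_pos z hz)).ne'
  have h2' := (Real.sqrt_pos.2 (h.ρ₂_pos z hz)).ne'
  obtain ⟨q, r, hr, rfl⟩ : ∃ q r, r < 6 ∧ k = 6 * q + r :=
    ⟨k / 6, k % 6, Nat.mod_lt _ (by norm_num), (Nat.div_add_mod k 6).symm⟩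
  have hmod : (6 * q + r) % 6 = r := by omega
  have hdiv : (6 * q + r) / 6 = q := by omega
  have hpow : ∀ n, (-(lam * ψ z) ^ 2) ^ n = lam ^ (2 * n) * (-ψ z ^ 2) ^ n := fun n => by
    rw [pow_mul, ← mul_pow]; ring
  have happ : ∀ x₀ x₁ x₂, h.isometry hz (WithLp.toLp 2 ![x₀, x₁, x₂]) = x₀.re • u z + x₀.im • η z +
      W₁ z ((√(ρ₁ z))⁻¹ • x₁) + W₂ z ((√(ρ₂ z))⁻¹ • x₂) := fun _ _ _ => rfl
  have hs1 : ((√(ρ₁ z) : ℝ) : ℂ) ≠ 0 := by exact_mod_cast h1'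
  have hs2 : ((√(ρ₂ z) : ℝ) : ℂ) ≠ 0 := by exact_mod_cast h2'
  have two_re : ∀ w : ℂ, (2 * w).re = 2 * w.re := fun w => by simp
  rw [cycSeq_eq q r hr]
  simp only [modelFiberMap, LinearMap.coe_mk, AddHom.coe_mk, modelFactor, hmod, hdiv, happ]
  interval_cases r
  · have hd : (6 * q + 0) / 3 = 2 * q := by omega
    simp only [cycBase, cycCoeff, hd, hpow, twoReSmul_apply, ← two_re]
    norm_num only [ofReal_re, ofReal_im, zero_re, zero_im, map_zero, smul_zero, zero_smul, add_zero,
      zero_add, if_true, if_false]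
    congr 2
    ring
  · have hd : (6 * q + 1) / 3 = 2 * q := by omega
    simp only [cycBase, cycCoeff, hd, hpow]
    norm_num only [ofReal_re, ofReal_im, zero_re, zero_im, map_zero, smul_zero, zero_smul, add_zero,
      zero_add, if_true, if_false, real_smul, ofReal_inv]
    congr 1
    field_simp
  · have hd : (6 * q + 2) / 3 = 2 * q := by omega
    simp only [cycBase, cycCoeff, hd, hpow]
    norm_num only [ofReal_re, ofReal_im, zero_re, zero_im, map_zero, smul_zero, zero_smul, add_zero,
      zero_add, if_true, if_false, real_smul, ofReal_inv]
    congr 1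
    field_simp
  · have hd : (6 * q + 3) / 3 = 2 * q + 1 := by omega
    simp only [cycBase, cycCoeff, hd, hpow, twoReSmul_apply, ← two_re]
    norm_num only [ofReal_re, ofReal_im, zero_re, zero_im, map_zero, smul_zero, zero_smul, add_zero,
      zero_add, if_true, if_false, I_mul_re, I_mul_im, neg_zero]
    congr 2
    ring
  · have hd : (6 * q + 4) / 3 + 1 = 2 * (q + 1) := by omega
    simp only [cycBase, cycCoeff, hd, hpow, LinearMap.comp_apply, AlgEquiv.toLinearMap_apply,
      conjAe_coe]
    norm_num only [ofReal_re, ofReal_im, zero_re, zero_im, map_zero, smul_zero, zero_smul, add_zero,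
      zero_add, if_true, if_false, real_smul, ofReal_inv]
    congr 1
    simp only [map_mul, conj_ofReal]
    field_simp
  · have hd : (6 * q + 5) / 3 + 1 = 2 * (q + 1) := by omega
    simp only [cycBase, cycCoeff, hd, hpow, LinearMap.comp_apply, AlgEquiv.toLinearMap_apply,
      conjAe_coe]
    norm_num only [ofReal_re, ofReal_im, zero_re, zero_im, map_zero, smul_zero, zero_smul, add_zero,
      zero_add, if_true, if_false, real_smul, ofReal_inv]
    congr 1
    simp only [map_mul, map_neg, conj_ofReal]
    field_simp

end Frame

section SumForms

variable {E : Type*} [NormedAddCommGroup E] [InnerProductSpace ℝ E] [FiniteDimensional ℝ E]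
  {U : Set ℂ} {ρ₁ ρ₂ : ℂ → ℝ} {ψ : ℂ → ℂ} {m : ℕ} {a : Fin m → ℝ} {l : Fin m → ℂ}
  {u : Fin m → ℂ → E} {W₁ W₂ : Fin m → ℂ → ℂ →ₗ[ℝ] E} {η : Fin m → ℂ → E}

theorem modelFactor_ne_zero (hd : IsScalarData U ρ₁ ρ₂ ψ) {z : ℂ} (hz : z ∈ U) (k : ℕ) :
    modelFactor (ρ₁ z) (ρ₂ z) (ψ z) k ≠ 0 := by
  have h0 := hd.ψ_ne hz
  have h1 := hd.ρ₁_pos z hz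
  have h2 := hd.ρ₂_pos z hz
  have hs1 : ((√(ρ₁ z) : ℝ) : ℂ) ≠ 0 := by exact_mod_cast (Real.sqrt_pos.2 h1).ne'
  have hs2 : ((√(ρ₂ z) : ℝ) : ℂ) ≠ 0 := by exact_mod_cast (Real.sqrt_pos.2 h2).ne'
  have hr1 : ((2 / ρ₁ z : ℝ) : ℂ) ≠ 0 := by exact_mod_cast (div_pos two_pos h1).ne'
  have hr2 : ((2 / ρ₂ z : ℝ) : ℂ) ≠ 0 := by exact_mod_cast (div_pos two_pos h2).ne'
  have hψ : -ψ z ^ 2 ≠ 0 := neg_ne_zero.2 (pow_ne_zero _ h0)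
  unfold modelFactor
  split
  · exact mul_ne_zero two_ne_zero (pow_ne_zero _ hψ)
  · exact mul_ne_zero hs1 (pow_ne_zero _ hψ)
  · exact mul_ne_zero hs2 (pow_ne_zero _ hψ)
  · exact mul_ne_zero (mul_ne_zero two_ne_zero h0) (pow_ne_zero _ hψ)
  · exact mul_ne_zero (mul_ne_zero hs2 hr2) (pow_ne_zero _ hψ)
  · exact mul_ne_zero (neg_ne_zero.2 (mul_ne_zero hs1 hr1)) (pow_ne_zero _ hψ)

/-- The square of a factor of order `3 n` is a power of the Hopf differential `ψ ^ 2`. -/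
theorem modelFactor_sq (ρ₁ ρ₂ : ℝ) (ψ : ℂ) {k n : ℕ} (hk : k = 3 * n) :
    modelFactor ρ₁ ρ₂ ψ k ^ 2 = 4 * (ψ ^ 2) ^ n := by
  have : k % 6 = 0 ∨ k % 6 = 3 := by omega
  have hq : ∀ q, ((-ψ ^ 2) ^ q) ^ 2 = (ψ ^ 2) ^ (2 * q) := fun q => by
    rw [← pow_mul, mul_comm, pow_mul, neg_sq, ← pow_mul]
  unfold modelFactor
  rcases this with h | h <;> simp only [h]
  · rw [mul_pow, hq, show n = 2 * (k / 6) by omega]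
    norm_num
  · rw [mul_pow, hq, show n = 2 * (k / 6) + 1 by omega]
    ring

/-- The constant in the squared modulus of `modelFactor`; see `normSq_modelFactor`. -/
def modelConst (k : ℕ) : ℝ :=
  match k % 6 with
  | 0 => 4 / 8 ^ (2 * (k / 6))
  | 1 => 1 / 8 ^ (2 * (k / 6))
  | 2 => 1 / (2 * 8 ^ (2 * (k / 6)))
  | 3 => 4 / 8 ^ (2 * (k / 6) + 1)
  | 4 => 8 / 8 ^ (2 * (k / 6) + 2)
  | _ => 4 / 8 ^ (2 * (k / 6) + 2)

theorem modelConst_pos (k : ℕ) : 0 < modelConst k := by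
  unfold modelConst
  split <;> positivity

/-- With `ρ₂ = ρ₁² t / 2`, where `t = 1 - K` by the Gauss equation, the squared modulus of a factor
is a constant times a power of `t` times the power of `ρ₁` that is absorbed by the norms of the arguments. -/
theorem normSq_modelFactor {ρ₁ ρ₂ t : ℝ} {ψ : ℂ} (h1 : 0 < ρ₁) (h2 : 0 < ρ₂)
    (ht : ρ₂ = ρ₁ ^ 2 * t / 2) (hψ : 4 * normSq ψ = ρ₁ * ρ₂) (s : ℕ) :
    normSq (modelFactor ρ₁ ρ₂ ψ (s + 1)) =
      modelConst (s + 1) * t ^ curvatureExponent s * ρ₁ ^ (s + 1) := by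
  obtain ⟨q, r, hr, hk⟩ : ∃ q r, r < 6 ∧ s + 1 = 6 * q + r :=
    ⟨(s + 1) / 6, (s + 1) % 6, Nat.mod_lt _ (by norm_num), (Nat.div_add_mod _ 6).symm⟩
  have hmod : (6 * q + r) % 6 = r := by omega
  have hdiv : (6 * q + r) / 6 = q := by omega
  have ht0 : t ≠ 0 := by
    rintro rfl
    simp [ht] at h2
  have hψ' : normSq ψ = ρ₁ ^ 3 * t / 8 := by
    rw [ht] at hψ
    linarith
  have hpow : ∀ n, normSq ((-ψ ^ 2) ^ n) = (ρ₁ ^ 3 * t / 8) ^ (2 * n) := fun n => by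
    rw [map_pow, normSq_neg, map_pow, hψ', ← pow_mul]
  have hs1 : √ρ₁ * √ρ₁ = ρ₁ := Real.mul_self_sqrt h1.le
  have hs2 : √ρ₂ * √ρ₂ = ρ₂ := Real.mul_self_sqrt h2.le
  have n2 : normSq 2 = 4 := by norm_num [normSq_apply]
  unfold curvatureExponent
  simp only [modelFactor, modelConst, hk, hmod, hdiv]
  interval_cases r
  · rw [if_neg (by omega), if_neg (by omega), show (6 * q + 0) / 3 = 2 * q by omega]
    simp only [normSq_mul, hpow, n2]
    rw [div_pow, mul_pow, ← pow_mul, show 6 * q + 0 = 3 * (2 * q) by ring]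
    ring
  · rw [if_pos (by omega), show s / 3 = 2 * q by omega]
    simp only [normSq_mul, hpow, normSq_ofReal, hs1]
    rw [div_pow, mul_pow, ← pow_mul, show 6 * q + 1 = 3 * (2 * q) + 1 by ring]
    ring
  · rw [if_neg (by omega), if_pos (by omega), show (s + 2) / 3 = 2 * q + 1 by omega]
    simp only [normSq_mul, hpow, normSq_ofReal, hs2]
    rw [div_pow, mul_pow, ← pow_mul, show 6 * q + 2 = 3 * (2 * q) + 2 by ring, ht]
    field_simp
    ring
  · rw [if_neg (by omega), if_neg (by omega), show (6 * q + 3) / 3 = 2 * q + 1 by omega]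
    simp only [normSq_mul, hpow, n2, hψ']
    rw [div_pow, mul_pow, ← pow_mul, show 6 * q + 3 = 3 * (2 * q) + 3 by ring]
    ring
  · rw [if_pos (by omega), show s / 3 = 2 * q + 1 by omega]
    simp only [normSq_mul, hpow, normSq_ofReal, hs2]
    rw [div_pow, mul_pow, ← pow_mul, show 6 * q + 4 = 3 * (2 * q) + 4 by ring, ht,
      show 2 * (q + 1) = 2 * q + 2 by ring]
    field_simp
    ring
  · rw [if_neg (by omega), if_pos (by omega), show (s + 2) / 3 = 2 * q + 2 by omega]
    simp only [normSq_mul, normSq_neg, hpow, normSq_ofReal, hs1]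
    rw [div_pow, mul_pow, ← pow_mul, show 6 * q + 5 = 3 * (2 * q) + 5 by ring,
      show 2 * (q + 1) = 2 * q + 2 by ring]
    field_simp
    ring

/-- The osculating sequence of the direct sum. -/
def sumSeq (a : Fin m → ℝ) (l : Fin m → ℂ) (ρ₁ ρ₂ : ℂ → ℝ) (ψ : ℂ → ℂ) (u : Fin m → ℂ → E)
    (W₁ W₂ : Fin m → ℂ → ℂ →ₗ[ℝ] E) (η : Fin m → ℂ → E) (k : ℕ) (z : ℂ) :
    ℂ →ₗ[ℝ] PiLp 2 fun _ : Fin m => E :=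
  sumLin a fun j => cycSeq ρ₁ ρ₂ (fun z => l j * ψ z) (u j) (W₁ j) (W₂ j) (η j) k z

theorem isOsculating_sumSeq (ha : ∑ j, a j ^ 2 = 1) (hl : ∀ j, normSq (l j) = 1) (j₀ : Fin m)
    (h : ∀ j, IsFramedChart U (u j) (W₁ j) (W₂ j) (η j) ρ₁ ρ₂) (hd : IsScalarData U ρ₁ ρ₂ ψ)
    (hκ : ∀ j, ∀ z ∈ U, thirdCoeff (W₂ j) (η j) z = l j * ψ z) :
    IsOsculating U (fun z => sumVec a fun j => u j z) (sumSeq a l ρ₁ ρ₂ ψ u W₁ W₂ η)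
      (cycP ρ₁ ρ₂ ψ) (cycQ ρ₁ ρ₂) ρ₁ :=
  IsOsculating.sum ha j₀ fun j => isOsculating_cycSeq (h j) hd (hl j) (hκ j)

/-- The linear isometry from the model of the direct sum. -/
def sumFrameIsometry (h : ∀ j, IsFramedChart U (u j) (W₁ j) (W₂ j) (η j) ρ₁ ρ₂) {z : ℂ}
    (hz : z ∈ U) : (PiLp 2 fun _ : Fin m => ModelFiber) →ₗᵢ[ℝ] PiLp 2 fun _ : Fin m => E :=
  sumIsometry fun j => (h j).isometry hz

variable (h : ∀ j, IsFramedChart U (u j) (W₁ j) (W₂ j) (η j) ρ₁ ρ₂)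

include h

theorem sumSeq_apply {z : ℂ} (hz : z ∈ U) (k : ℕ) (c : ℂ) :
    sumSeq a l ρ₁ ρ₂ ψ u W₁ W₂ η k z c = sumFrameIsometry h hz
      (modelMap a l k (modelFactor (ρ₁ z) (ρ₂ z) (ψ z) k * c)) := by
  rw [modelMap, sumLin_apply, sumFrameIsometry, sumIsometry_sumVec, sumSeq, sumLin_apply]
  simp only [(h _).cycSeq_eq_isometry hz]

theorem range_sumSeq (hd : IsScalarData U ρ₁ ρ₂ ψ) {z : ℂ} (hz : z ∈ U) (k : ℕ) :
    LinearMap.range (sumSeq a l ρ₁ ρ₂ ψ u W₁ W₂ η k z) =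
      (LinearMap.range (modelMap a l k)).map (sumFrameIsometry h hz).toLinearMap := by
  have h0 := modelFactor_ne_zero hd hz k
  ext x
  constructor
  · rintro ⟨c, rfl⟩
    exact ⟨_, ⟨_, rfl⟩, (sumSeq_apply h hz k c).symm⟩
  · rintro ⟨_, ⟨c, rfl⟩, rfl⟩
    refine ⟨(modelFactor (ρ₁ z) (ρ₂ z) (ψ z) k)⁻¹ * c, ?_⟩
    rw [sumSeq_apply h hz, mul_inv_cancel_left₀ h0]
    rfl

theorem oscSpace_sumSeq (hd : IsScalarData U ρ₁ ρ₂ ψ) {z : ℂ} (hz : z ∈ U) (r : ℕ) :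
    oscSpace (fun z => sumVec a fun j => u j z) (sumSeq a l ρ₁ ρ₂ ψ u W₁ W₂ η) r z =
      (modelSpace a l r).map (sumFrameIsometry h hz).toLinearMap := by
  induction r with
  | zero =>
    have h1 : ∀ c, sumSeq a l ρ₁ ρ₂ ψ u W₁ W₂ η 0 z c = (2 * c.re) • sumVec a fun j => u j z :=
      fun c => by
        ext j
        simpa [sumSeq, sumLin_apply, sumVec, cycSeq, cycBase, cycCoeff, twoReSmul_apply] using
          smul_comm (a j) (2 * c.re) (u j z)
    rw [modelSpace, ← range_sumSeq h hd hz 0, oscSpace]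
    refine le_antisymm ?_ ?_
    · rw [Submodule.span_singleton_le_iff_mem]
      refine ⟨1 / 2, ?_⟩
      rw [h1]
      norm_num
    · rintro _ ⟨c, rfl⟩
      rw [h1]
      exact Submodule.smul_mem _ _ (Submodule.mem_span_singleton_self _)
  | succ r ih => rw [oscSpace, ih, range_sumSeq h hd hz, modelSpace, Submodule.map_sup]

/-- The fundamental forms of the direct sum are those of the constant model, up to a linear isometry
and a complex factor. -/
theorem fundForm_sumVec (ha : ∑ j, a j ^ 2 = 1) (hl : ∀ j, normSq (l j) = 1) (j₀ : Fin m)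
    (hd : IsScalarData U ρ₁ ρ₂ ψ) (hκ : ∀ j, ∀ z ∈ U, thirdCoeff (W₂ j) (η j) z = l j * ψ z)
    {z : ℂ} (hz : z ∈ U) (s : ℕ) (X : Fin (s + 1) → ℂ) :
    fundForm (fun z => sumVec a fun j => u j z) s X z = sumFrameIsometry h hz
      (modelForm a l s (modelFactor (ρ₁ z) (ρ₂ z) (ψ z) (s + 1) * ∏ i, X i)) := by
  rw [(isOsculating_sumSeq ha hl j₀ h hd hκ).fundForm_eq hz, sumSeq_apply h hz,
    (sumFrameIsometry h hz).starProjection_orthogonal_of_map_eq (oscSpace_sumSeq h hd hz s).symm]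
  rfl

/-- A subspace that contains the direct sum near one point is the whole space. -/
theorem eq_top_of_sumVec_mem (ha : ∑ j, a j ^ 2 = 1) (ha0 : ∀ j, a j ≠ 0)
    (hl : ∀ j, normSq (l j) = 1) (hinj : Function.Injective fun j => l j ^ 2) (j₀ : Fin m)
    (hd : IsScalarData U ρ₁ ρ₂ ψ) (hκ : ∀ j, ∀ z ∈ U, thirdCoeff (W₂ j) (η j) z = l j * ψ z)
    {z : ℂ} (hz : z ∈ U) {V : Submodule ℝ (PiLp 2 fun _ : Fin m => E)}
    (hV : ∀ w ∈ U, (sumVec a fun j => u j w) ∈ V) : V = ⊤ := by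
  have ho := isOsculating_sumSeq ha hl j₀ h hd hκ
  -- a function with values in `V` has its derivatives in `V`
  have key : ∀ {f : ℂ → PiLp 2 fun _ : Fin m => E} {f' : ℂ → _} {w : ℂ}, w ∈ U →
      (∀ w ∈ U, f w ∈ V) → HasDirDeriv f f' w → ∀ X, f' X ∈ V := by
    intro f f' w hw hf hff X
    have h1 : HasDirDeriv (fun w => Vᗮ.starProjection (f w))
        (fun X => Vᗮ.starProjection (f' X)) w :=
      hff.clm _
    have h2 : HasDirDeriv (fun w => Vᗮ.starProjection (f w)) (fun _ => 0) w :=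
      (HasDirDeriv.const 0).congr_of_eventuallyEq (by
        filter_upwards [ho.isOpen.mem_nhds hw] with w hw
        rw [Submodule.starProjection_apply_eq_zero_iff, Submodule.orthogonal_orthogonal]
        exact hf w hw)
    have h3 := h1.unique h2 X
    rwa [Submodule.starProjection_apply_eq_zero_iff, Submodule.orthogonal_orthogonal] at h3
  have hW : ∀ k, (∀ w ∈ U, ∀ c, sumSeq a l ρ₁ ρ₂ ψ u W₁ W₂ η k w c ∈ V) ∧
      ∀ w ∈ U, ∀ c, sumSeq a l ρ₁ ρ₂ ψ u W₁ W₂ η (k + 1) w c ∈ V := by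
    intro k
    induction k with
    | zero =>
      refine ⟨fun w hw c => ?_, fun w hw c => key hw hV (ho.deriv_u w hw) c⟩
      rw [ho.W_zero w hw]
      exact Submodule.smul_mem _ _ (hV w hw)
    | succ k ih =>
      refine ⟨ih.2, fun w hw c => ?_⟩
      have h1 := key hw (fun w hw => ih.2 w hw c) (ho.deriv_W (k + 1) (by omega) w hw c) 1
      rw [add_assoc, mul_one] at h1
      exact (Submodule.add_mem_iff_left _ (add_mem (ih.2 w hw _) (ih.1 w hw _))).1 h1
  have hle : ∀ r, oscSpace (fun z => sumVec a fun j => u j z) (sumSeq a l ρ₁ ρ₂ ψ u W₁ W₂ η) r z ≤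
      V := by
    intro r
    induction r with
    | zero => exact (Submodule.span_singleton_le_iff_mem _ _).2 (hV z hz)
    | succ r ih =>
      refine sup_le ih ?_
      rintro _ ⟨c, rfl⟩
      exact (hW (r + 1)).1 z hz c
  have h1 := hle (3 * m)
  rw [oscSpace_sumSeq h hd hz, modelSpace_eq_top ha0 hl hinj j₀] at h1
  have h2 : Module.finrank ℝ (PiLp 2 fun _ : Fin m => ModelFiber) =
      Module.finrank ℝ (PiLp 2 fun _ : Fin m => E) := by
    rw [finrank_piLp_const (E := ModelFiber), finrank_piLp_const (E := E), finrank_modelFiber,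
      (h j₀).finrank_eq]
  rw [eq_top_iff, ← LinearMap.range_eq_top.2
    ((LinearMap.injective_iff_surjective_of_finrank_eq_finrank h2).1
      (sumFrameIsometry h hz).injective), ← Submodule.map_top]
  exact h1

end SumForms

/-! ### Invariants of the model forms -/

section Transport

variable {E F : Type*} [NormedAddCommGroup E] [InnerProductSpace ℝ E] [NormedAddCommGroup F]
  [InnerProductSpace ℝ F]

/-- The value at `∂, ∂` of the complex bilinear extension of `⟪L ·, L ·⟫`, for `L` evaluated at a
power of the tangent vector. -/
def hopfForm (L : ℂ →ₗ[ℝ] E) : ℂ :=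
  ((⟪L 1, L 1⟫_ℝ : ℂ) - (⟪L I, L I⟫_ℝ : ℂ) - 2 * I * (⟪L 1, L I⟫_ℝ : ℂ)) / 4

/-- The map `c ↦ Ψ (L (τ c))`. -/
def transport (Ψ : E →ₗᵢ[ℝ] F) (L : ℂ →ₗ[ℝ] E) (τ : ℂ) : ℂ →ₗ[ℝ] F :=
  Ψ.toLinearMap ∘ₗ L ∘ₗ LinearMap.mulLeft ℝ τ

variable (Ψ : E →ₗᵢ[ℝ] F) (L : ℂ →ₗ[ℝ] E) (τ : ℂ)

theorem transport_apply (c : ℂ) : transport Ψ L τ c = Ψ (L (τ * c)) := rfl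

theorem hopfForm_transport : hopfForm (transport Ψ L τ) = τ ^ 2 * hopfForm L := by
  simp only [hopfForm, transport_apply, LinearIsometry.inner_map_map]
  rw [L.apply_eq_re_im (τ * 1), L.apply_eq_re_im (τ * I)]
  simp only [inner_add_left, inner_add_right, inner_smul_left, inner_smul_right,
    real_inner_comm (L 1) (L I), mul_one, mul_I_re, mul_I_im, conj_trivial]
  conv_rhs => rw [← re_add_im τ]
  generalize τ.re = x
  generalize τ.im = y
  generalize ⟪L 1, L 1⟫_ℝ = p
  generalize ⟪L I, L I⟫_ℝ = q
  generalize ⟪L 1, L I⟫_ℝ = r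
  push_cast
  linear_combination ((-(p - q) * y ^ 2 + 4 * x * y * r + 2 * I * y ^ 2 * r) / 4 : ℂ) * I_sq

theorem normSq_transport : ‖transport Ψ L τ 1‖ ^ 2 + ‖transport Ψ L τ I‖ ^ 2 =
    (‖L 1‖ ^ 2 + ‖L I‖ ^ 2) * normSq τ := by
  simp only [transport_apply, LinearIsometry.norm_map]
  rw [← L.norm_sq_add_norm_sq_I_mul, mul_one, mul_comm τ I]

theorem normDet_transport : (transport Ψ L τ).normDet = L.normDet * normSq τ := by
  have h1 : (LinearMap.mulLeft ℝ τ).normDet = normSq τ := by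
    rw [LinearMap.normDet_eq_abs_det]
    have : LinearMap.det (LinearMap.mulLeft ℝ τ) = normSq τ := by
      rw [← LinearMap.det_toMatrix basisOneI]
      simp [Algebra.leftMulMatrix_complex, Matrix.det_fin_two, normSq_apply]
    rw [this, abs_of_nonneg (normSq_nonneg _)]
  have h2 : ∀ K : ℂ →ₗ[ℝ] E, (Ψ.toLinearMap ∘ₗ K).normDet = K.normDet := fun K => by
    rw [LinearMap.normDet_comp]
    have : (Ψ.toLinearMap.domRestrict K.range).normDet = 1 :=
      (Ψ.comp K.range.subtypeₗᵢ).normDet_eq_one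
    rw [this, one_mul]
  rw [transport, h2, LinearMap.normDet_comp_of_finrank_eq _ _ rfl, h1]

end Transport

section ModelInvariants

variable {m : ℕ} (a : Fin m → ℝ) (l : Fin m → ℂ)

theorem hopfForm_modelForm {s : ℕ} (hs : s % 3 ≠ 2) : hopfForm (modelForm a l s) = 0 := by
  have h1 := inner_modelForm_I_mul a l hs 1 1
  have h2 := inner_modelForm_I_mul a l hs 1 I
  rw [mul_one, I_mul_I, map_neg, inner_neg_right, real_inner_comm] at h2
  rw [mul_one] at h1
  have h3 : ⟪modelForm a l s 1, modelForm a l s I⟫_ℝ = 0 := by linarith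
  rw [hopfForm, h1, h3]
  simp

end ModelInvariants

/-! ### The cross product of imaginary Cayley numbers -/

section Cross

/-- The imaginary part of the product of two imaginary Cayley numbers. -/
def cayleyCross (a b : EuclideanSpace ℝ (Fin 7)) : EuclideanSpace ℝ (Fin 7) :=
  let x := cayleyMul (cayleyIm a) (cayleyIm b)
  WithLp.toLp 2 ![x.1.imI, x.1.imJ, x.1.imK, x.2.re, x.2.imI, x.2.imJ, x.2.imK]

theorem eq_cayleyCross {a b c : EuclideanSpace ℝ (Fin 7)}
    (h : cayleyIm c = cayleyMul (cayleyIm a) (cayleyIm b)) : c = cayleyCross a b := by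
  ext i
  simp only [cayleyCross, ← h]
  fin_cases i <;> rfl

theorem cayleyCross_eq (a b : EuclideanSpace ℝ (Fin 7)) : cayleyCross a b = WithLp.toLp 2
    ![a 1 * b 2 - a 2 * b 1 - b 3 * a 4 + b 4 * a 3 + b 5 * a 6 - b 6 * a 5,
      a 2 * b 0 - a 0 * b 2 - b 3 * a 5 - b 4 * a 6 + b 5 * a 3 + b 6 * a 4,
      a 0 * b 1 - a 1 * b 0 - b 3 * a 6 + b 4 * a 5 - b 5 * a 4 + b 6 * a 3,
      -b 4 * a 0 - b 5 * a 1 - b 6 * a 2 + a 4 * b 0 + a 5 * b 1 + a 6 * b 2,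
      b 3 * a 0 + b 5 * a 2 - b 6 * a 1 - a 3 * b 0 - a 5 * b 2 + a 6 * b 1,
      b 3 * a 1 - b 4 * a 2 + b 6 * a 0 - a 3 * b 1 + a 4 * b 2 - a 6 * b 0,
      b 3 * a 2 + b 4 * a 1 - b 5 * a 0 - a 3 * b 2 - a 4 * b 1 + a 5 * b 0] := by
  ext i
  fin_cases i <;> simp [cayleyCross, cayleyMul, Quaternion.re_mul, Quaternion.imI_mul,
    Quaternion.imJ_mul, Quaternion.imK_mul] <;> simp [cayleyIm] <;> ring

theorem inner_fin_seven (a b : EuclideanSpace ℝ (Fin 7)) : ⟪a, b⟫_ℝ =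
    a 0 * b 0 + a 1 * b 1 + a 2 * b 2 + a 3 * b 3 + a 4 * b 4 + a 5 * b 5 + a 6 * b 6 := by
  simp only [PiLp.inner_apply, Fin.sum_univ_seven, RCLike.inner_apply]
  simp [mul_comm]

/-- The cross product as a continuous bilinear map. -/
def cayleyCrossL : EuclideanSpace ℝ (Fin 7) →L[ℝ] EuclideanSpace ℝ (Fin 7) →L[ℝ]
    EuclideanSpace ℝ (Fin 7) :=
  LinearMap.toContinuousLinearMap (LinearMap.toContinuousLinearMap.toLinearMap ∘ₗ
    LinearMap.mk₂ ℝ cayleyCross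
      (fun a a' b => by
        ext i; simp only [cayleyCross_eq]; fin_cases i <;> simp <;> ring)
      (fun s a b => by
        ext i; simp only [cayleyCross_eq]; fin_cases i <;> simp <;> ring)
      (fun a b b' => by
        ext i; simp only [cayleyCross_eq]; fin_cases i <;> simp <;> ring)
      (fun s a b => by
        ext i; simp only [cayleyCross_eq]; fin_cases i <;> simp <;> ring))

theorem cayleyCrossL_apply (a b : EuclideanSpace ℝ (Fin 7)) :
    cayleyCrossL a b = cayleyCross a b := rfl

theorem cayleyCrossL_swap (a b : EuclideanSpace ℝ (Fin 7)) :
    cayleyCrossL a b = -cayleyCrossL b a := by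
  ext i
  simp only [cayleyCrossL_apply, cayleyCross_eq]
  fin_cases i <;> simp <;> ring

theorem inner_cayleyCrossL (a b c : EuclideanSpace ℝ (Fin 7)) :
    ⟪cayleyCrossL a b, c⟫_ℝ = -⟪b, cayleyCrossL a c⟫_ℝ := by
  rw [inner_fin_seven, inner_fin_seven]
  simp only [cayleyCrossL_apply, cayleyCross_eq]
  simp
  ring

theorem inner_cayleyCrossL_self (a b : EuclideanSpace ℝ (Fin 7)) : ⟪a, cayleyCrossL a b⟫_ℝ = 0 := by
  rw [inner_fin_seven]
  simp only [cayleyCrossL_apply, cayleyCross_eq]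
  simp
  ring

theorem cayleyCrossL_cayleyCrossL (a b : EuclideanSpace ℝ (Fin 7)) :
    cayleyCrossL a (cayleyCrossL a b) = ⟪a, b⟫_ℝ • a - ⟪a, a⟫_ℝ • b := by
  ext i
  rw [inner_fin_seven, inner_fin_seven]
  simp only [cayleyCrossL_apply, cayleyCross_eq]
  fin_cases i <;> simp <;> ring

theorem cayleyCrossL_self (a : EuclideanSpace ℝ (Fin 7)) : cayleyCrossL a a = 0 := by
  have := cayleyCrossL_swap a a
  rw [eq_neg_iff_add_eq_zero, ← two_smul ℝ] at this
  simpa using this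

theorem norm_sq_cayleyCrossL (a b : EuclideanSpace ℝ (Fin 7)) :
    ‖cayleyCrossL a b‖ ^ 2 = ‖a‖ ^ 2 * ‖b‖ ^ 2 - ⟪a, b⟫_ℝ ^ 2 := by
  rw [← real_inner_self_eq_norm_sq, inner_cayleyCrossL, cayleyCrossL_cayleyCrossL, inner_sub_right,
    inner_smul_right, inner_smul_right, real_inner_self_eq_norm_sq, real_inner_self_eq_norm_sq,
    real_inner_comm]
  ring

end Cross

/-! ### Pseudoholomorphic curves in a chart -/

section PseudoholomorphicChart

theorem HasDirDeriv.bilin {F G H : Type*} [NormedAddCommGroup F] [NormedSpace ℝ F]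
    [NormedAddCommGroup G] [NormedSpace ℝ G] [NormedAddCommGroup H] [NormedSpace ℝ H]
    (B : F →L[ℝ] G →L[ℝ] H) {f f' : ℂ → F} {g g' : ℂ → G} {z : ℂ} (hf : HasDirDeriv f f' z)
    (hg : HasDirDeriv g g' z) :
    HasDirDeriv (fun w => B (f w) (g w)) (fun X => B (f' X) (g z) + B (f z) (g' X)) z :=
  (HasDirDeriv.of_hasFDerivAt ((B.hasFDerivAt.comp z hf.1.hasFDerivAt).clm_apply
    hg.1.hasFDerivAt)).congr_deriv fun X => by
      simp [hf.2 X, hg.2 X, add_comm]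

variable {E : Type*} [NormedAddCommGroup E] [InnerProductSpace ℝ E]

/-- A real linear map that sends `1, i` to orthogonal vectors of the same length is conformal. -/
theorem LinearMap.inner_of_conformal {L : ℂ →ₗ[ℝ] E} (h1 : ‖L I‖ = ‖L 1‖)
    (h2 : ⟪L 1, L I⟫_ℝ = 0) (c d : ℂ) :
    ⟪L c, L d⟫_ℝ = ‖L 1‖ ^ 2 * (c * starRingEnd ℂ d).re := by
  rw [L.apply_eq_re_im c, L.apply_eq_re_im d]
  simp only [inner_add_left, inner_add_right, inner_smul_left, inner_smul_right,
    real_inner_comm (L 1) (L I), h2, real_inner_self_eq_norm_sq, h1]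
  simp
  ring

variable [FiniteDimensional ℝ E]

/-- The normal component of the second derivative, at `1` and at a second vector `c`. For a
pseudoholomorphic curve this is the second fundamental form as a function of the product of its
arguments; see `IsPseudoholomorphicChart.secondMap_mul`. -/
def secondMap (u : ℂ → E) (z : ℂ) : ℂ →ₗ[ℝ] E :=
  reLm.smulRight ((normalSpace u z).starProjection (fderiv ℝ (fun w => fderiv ℝ u w 1) z 1)) +
    imLm.smulRight ((normalSpace u z).starProjection (fderiv ℝ (fun w => fderiv ℝ u w I) z 1))

/-- A pseudoholomorphic curve read in a coordinate; `ι` is the inclusion of `E` in the imaginary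
Cayley numbers. -/
structure IsPseudoholomorphicChart (U : Set ℂ) (u : ℂ → E)
    (ι : E →ₗᵢ[ℝ] EuclideanSpace ℝ (Fin 7)) : Prop where
  isOpen : IsOpen U
  smooth_u : ContDiffOn ℝ ∞ u U
  norm_u : ∀ z ∈ U, ‖u z‖ = 1
  injective : ∀ z ∈ U, Function.Injective (fderiv ℝ u z)
  complexLinear : ∀ z ∈ U, ∀ X,
    ι (fderiv ℝ u z (I * X)) = cayleyCrossL (ι (u z)) (ι (fderiv ℝ u z X))

namespace IsPseudoholomorphicChart

variable {U : Set ℂ} {u : ℂ → E} {ι : E →ₗᵢ[ℝ] EuclideanSpace ℝ (Fin 7)}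

omit [FiniteDimensional ℝ E] in
theorem hasDirDeriv (h : IsPseudoholomorphicChart U u ι) {z : ℂ} (hz : z ∈ U) :
    HasDirDeriv u (fun X => fderiv ℝ u z X) z :=
  h.smooth_u.hasDirDeriv h.isOpen hz

omit [FiniteDimensional ℝ E] in
theorem inner_u_fderiv (h : IsPseudoholomorphicChart U u ι) {z : ℂ} (hz : z ∈ U) (X : ℂ) :
    ⟪u z, fderiv ℝ u z X⟫_ℝ = 0 :=
  (h.hasDirDeriv hz).inner_eq_zero_of_norm
    (by filter_upwards [h.isOpen.mem_nhds hz] with w hw using h.norm_u w hw) X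

omit [FiniteDimensional ℝ E] in
theorem inner_fderiv (h : IsPseudoholomorphicChart U u ι) {z : ℂ} (hz : z ∈ U) (c d : ℂ) :
    ⟪fderiv ℝ u z c, fderiv ℝ u z d⟫_ℝ =
      ‖fderiv ℝ u z 1‖ ^ 2 * (c * starRingEnd ℂ d).re := by
  have hI := h.complexLinear z hz 1
  rw [mul_one] at hI
  refine LinearMap.inner_of_conformal (L := (fderiv ℝ u z : ℂ →ₗ[ℝ] E)) ?_ ?_ c d
  · rw [← sq_eq_sq₀ (norm_nonneg _) (norm_nonneg _)]
    change ‖fderiv ℝ u z I‖ ^ 2 = ‖fderiv ℝ u z 1‖ ^ 2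
    rw [← ι.norm_map (fderiv ℝ u z I), hI, norm_sq_cayleyCrossL, ι.inner_map_map,
      h.inner_u_fderiv hz, ι.norm_map, ι.norm_map, h.norm_u z hz]
    ring
  · change ⟪fderiv ℝ u z 1, fderiv ℝ u z I⟫_ℝ = 0
    rw [← ι.inner_map_map, hI, cayleyCrossL_swap, inner_neg_right, inner_cayleyCrossL_self,
      neg_zero]

omit [FiniteDimensional ℝ E] in
theorem norm_fderiv_pos (h : IsPseudoholomorphicChart U u ι) {z : ℂ} (hz : z ∈ U) :
    0 < ‖fderiv ℝ u z 1‖ ^ 2 := by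
  have : fderiv ℝ u z 1 ≠ 0 := fun h0 =>
    one_ne_zero (h.injective z hz (h0.trans (map_zero _).symm))
  positivity

theorem normalSpace_proj (h : IsPseudoholomorphicChart U u ι) {z : ℂ} (hz : z ∈ U) (y : E) :
    ∃ (s : ℝ) (c : ℂ), (normalSpace u z).starProjection y = y - s • u z - fderiv ℝ u z c :=
  ⟨_, _, normalSpace_starProjection (L := (fderiv ℝ u z : ℂ →ₗ[ℝ] E)) (fun _ => rfl) (h.norm_u z hz)
    (h.inner_u_fderiv hz) (h.norm_fderiv_pos hz) (h.inner_fderiv hz) y⟩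

omit [FiniteDimensional ℝ E] in
theorem inner_normal (u : ℂ → E) (z : ℂ) {n : E} (hn : n ∈ normalSpace u z) :
    ⟪n, u z⟫_ℝ = 0 ∧ ∀ X, ⟪n, fderiv ℝ u z X⟫_ℝ = 0 := by
  rw [normalSpace, Submodule.mem_orthogonal'] at hn
  exact ⟨hn _ (Submodule.mem_sup_left (Submodule.mem_span_singleton_self _)),
    fun X => hn _ (Submodule.mem_sup_right ⟨X, rfl⟩)⟩

omit [FiniteDimensional ℝ E] in
theorem cross_fderiv (h : IsPseudoholomorphicChart U u ι) {z : ℂ} (hz : z ∈ U) (X Y : ℂ) :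
    ∃ s : ℝ, cayleyCrossL (ι (fderiv ℝ u z X)) (ι (fderiv ℝ u z Y)) = s • ι (u z) := by
  set L : ℂ →ₗ[ℝ] E := (fderiv ℝ u z : ℂ →ₗ[ℝ] E)
  have hI : ι (L I) = cayleyCrossL (ι (u z)) (ι (L 1)) := by
    have := h.complexLinear z hz 1
    rwa [mul_one] at this
  have h1 : cayleyCrossL (ι (L 1)) (ι (L I)) = ‖L 1‖ ^ 2 • ι (u z) := by
    rw [hI, cayleyCrossL_swap (ι (u z)), map_neg, cayleyCrossL_cayleyCrossL, ι.inner_map_map,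
      ι.inner_map_map, real_inner_self_eq_norm_sq, real_inner_comm,
      show ⟪u z, L 1⟫_ℝ = 0 from h.inner_u_fderiv hz 1]
    simp
  refine ⟨(X.re * Y.im - X.im * Y.re) * ‖L 1‖ ^ 2, ?_⟩
  change cayleyCrossL (ι (L X)) (ι (L Y)) = _
  rw [L.apply_eq_re_im X, L.apply_eq_re_im Y]
  simp only [map_add, map_smul, add_apply, smul_apply, cayleyCrossL_self,
    cayleyCrossL_swap (ι (L I)) (ι (L 1)), h1]
  module

/-- The normal component of the second derivative is complex linear. -/
theorem normal_complexLinear (h : IsPseudoholomorphicChart U u ι) {z : ℂ} (hz : z ∈ U) (Y X : ℂ) :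
    ι ((normalSpace u z).starProjection (fderiv ℝ (fun w => fderiv ℝ u w (I * Y)) z X)) =
      cayleyCrossL (ι (u z))
        (ι ((normalSpace u z).starProjection (fderiv ℝ (fun w => fderiv ℝ u w Y) z X))) := by
  have hD : ∀ Y, HasDirDeriv (fun w => fderiv ℝ u w Y)
      (fun X => fderiv ℝ (fun w => fderiv ℝ u w Y) z X) z := fun Y =>
    (h.smooth_u.fderiv_apply_smooth h.isOpen Y).hasDirDeriv h.isOpen hz
  obtain ⟨s, hs⟩ := h.cross_fderiv hz X Y
  have e0 : ι (fderiv ℝ (fun w => fderiv ℝ u w (I * Y)) z X) = s • ι (u z) +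
      cayleyCrossL (ι (u z)) (ι (fderiv ℝ (fun w => fderiv ℝ u w Y) z X)) := by
    have h1 := (hD (I * Y)).clm ι.toContinuousLinearMap
    have h2 := HasDirDeriv.bilin cayleyCrossL ((h.hasDirDeriv hz).clm ι.toContinuousLinearMap)
      ((hD Y).clm ι.toContinuousLinearMap)
    have h3 := h1.congr_of_eventuallyEq (g := fun w => cayleyCrossL (ι (u w)) (ι (fderiv ℝ u w Y)))
      (by filter_upwards [h.isOpen.mem_nhds hz] with w hw using (h.complexLinear w hw Y).symm)
    rw [← hs]
    exact h3.unique h2 X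
  have hn1 := inner_normal u z (Submodule.starProjection_apply_mem (normalSpace u z)
    (fderiv ℝ (fun w => fderiv ℝ u w (I * Y)) z X))
  have hn2 := inner_normal u z (Submodule.starProjection_apply_mem (normalSpace u z)
    (fderiv ℝ (fun w => fderiv ℝ u w Y) z X))
  obtain ⟨s₁, c₁, h1⟩ := h.normalSpace_proj hz (fderiv ℝ (fun w => fderiv ℝ u w (I * Y)) z X)
  obtain ⟨s₂, c₂, h2⟩ := h.normalSpace_proj hz (fderiv ℝ (fun w => fderiv ℝ u w Y) z X)
  set n₁ := (normalSpace u z).starProjection (fderiv ℝ (fun w => fderiv ℝ u w (I * Y)) z X)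
  set n₂ := (normalSpace u z).starProjection (fderiv ℝ (fun w => fderiv ℝ u w Y) z X)
  -- the difference is both tangential and normal
  have e1 : ι n₁ - cayleyCrossL (ι (u z)) (ι n₂) =
      (s - s₁) • ι (u z) + ι (fderiv ℝ u z (I * c₂ - c₁)) := by
    rw [h1, h2]
    simp only [map_sub, map_smul, e0, cayleyCrossL_self, h.complexLinear z hz c₂]
    module
  rw [← sub_eq_zero, ← inner_self_eq_zero (𝕜 := ℝ)]
  nth_rewrite 2 [e1]
  rw [inner_add_right, inner_smul_right, inner_sub_left, inner_sub_left, ι.inner_map_map,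
    ι.inner_map_map, hn1.1, hn1.2, inner_cayleyCrossL, inner_cayleyCrossL, cayleyCrossL_self,
    ← h.complexLinear z hz, ι.inner_map_map, hn2.2]
  simp

theorem secondMap_mul (h : IsPseudoholomorphicChart U u ι) {z : ℂ} (hz : z ∈ U) (c X : ℂ) :
    (normalSpace u z).starProjection (fderiv ℝ (fun w => fderiv ℝ u w c) z X) =
      secondMap u z (c * X) := by
  set P := (normalSpace u z).starProjection
  have hsymm : ∀ a b, fderiv ℝ (fun w => fderiv ℝ u w a) z b =
      fderiv ℝ (fun w => fderiv ℝ u w b) z a := fderiv_fderiv_symm h.isOpen h.smooth_u hz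
  have hlin : ∀ c X, fderiv ℝ (fun w => fderiv ℝ u w c) z X =
      X.re • fderiv ℝ (fun w => fderiv ℝ u w c) z 1 +
        X.im • fderiv ℝ (fun w => fderiv ℝ u w c) z I := fun c X =>
    (fderiv ℝ (fun w => fderiv ℝ u w c) z : ℂ →ₗ[ℝ] E).apply_eq_re_im X
  have hI : P (fderiv ℝ (fun w => fderiv ℝ u w I) z I) =
      -P (fderiv ℝ (fun w => fderiv ℝ u w 1) z 1) := by
    have h1 := h.normal_complexLinear hz 1 I
    have h2 := h.normal_complexLinear hz 1 1
    rw [mul_one] at h1 h2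
    rw [hsymm 1 I, h2, cayleyCrossL_cayleyCrossL, ι.inner_map_map, ι.inner_map_map, real_inner_comm,
      (inner_normal u z (Submodule.starProjection_apply_mem (normalSpace u z) _)).1,
      real_inner_self_eq_norm_sq, h.norm_u z hz] at h1
    refine ι.injective (h1.trans ?_)
    simp [P]
  rw [hlin c X, hsymm c 1, hsymm c I, hlin 1 c, hlin I c, hsymm 1 I]
  simp only [map_add, map_smul, hI, secondMap, LinearMap.add_apply, LinearMap.smulRight_apply,
    reLm_coe, imLm_coe, mul_re, mul_im]
  module

theorem secondMap_mem (h : IsPseudoholomorphicChart U u ι) {z : ℂ} (hz : z ∈ U) (c : ℂ) :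
    secondMap u z c ∈ normalSpace u z := by
  have := h.secondMap_mul hz c 1
  rw [mul_one] at this
  rw [← this]
  exact Submodule.starProjection_apply_mem _ _

theorem secondMap_I_mul (h : IsPseudoholomorphicChart U u ι) {z : ℂ} (hz : z ∈ U) (c : ℂ) :
    ι (secondMap u z (I * c)) = cayleyCrossL (ι (u z)) (ι (secondMap u z c)) := by
  have h1 := h.normal_complexLinear hz c 1
  rwa [h.secondMap_mul hz, h.secondMap_mul hz, mul_one, mul_one] at h1

theorem isIsotropicChart (h : IsPseudoholomorphicChart U u ι) :
    IsIsotropicChart U u (fun z => (fderiv ℝ u z : ℂ →ₗ[ℝ] E)) (secondMap u)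
      (fun z => ‖fderiv ℝ u z 1‖ ^ 2) (fun z => ‖secondMap u z 1‖ ^ 2) where
  isOpen := h.isOpen
  smooth_u := h.smooth_u
  norm_u := h.norm_u
  deriv_u _ hz := h.hasDirDeriv hz
  ρ₁_pos _ hz := h.norm_fderiv_pos hz
  inner_W₁ _ hz := h.inner_fderiv hz
  normal_W₁ _ hz := h.secondMap_mul hz
  inner_W₂ z hz := by
    have hI := h.secondMap_I_mul hz 1
    rw [mul_one] at hI
    have hn := (inner_normal u z (h.secondMap_mem hz 1)).1
    refine LinearMap.inner_of_conformal ?_ ?_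
    · rw [← sq_eq_sq₀ (norm_nonneg _) (norm_nonneg _), ← ι.norm_map (secondMap u z I), hI,
        norm_sq_cayleyCrossL, ι.inner_map_map, real_inner_comm, hn, ι.norm_map, ι.norm_map,
        h.norm_u z hz]
      ring
    · rw [← ι.inner_map_map, hI, cayleyCrossL_swap, inner_neg_right, inner_cayleyCrossL_self,
        neg_zero]

/-- A unit vector orthogonal to the hyperplane `ι E`. -/
theorem exists_unit_normal (hE : Module.finrank ℝ E = 6)
    (ι : E →ₗᵢ[ℝ] EuclideanSpace ℝ (Fin 7)) : ∃ ξ, ‖ξ‖ = 1 ∧ (∀ x, ⟪ι x, ξ⟫_ℝ = 0) ∧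
      ∀ v, ⟪v, ξ⟫_ℝ = 0 → ∃ x, ι x = v := by
  set R := LinearMap.range ι.toLinearMap
  have h1 : Module.finrank ℝ R = 6 := by
    rw [LinearMap.finrank_range_of_inj ι.injective, hE]
  have h2 : Module.finrank ℝ Rᗮ = 1 := by
    have := R.finrank_add_finrank_orthogonal
    rw [h1, finrank_euclideanSpace_fin] at this
    omega
  obtain ⟨ξ, hξ, hspan⟩ : ∃ ξ : Rᗮ, ‖ξ‖ = 1 ∧ ∀ w : Rᗮ, ∃ c : ℝ, c • ξ = w := by
    obtain ⟨v, hv, hs⟩ := finrank_eq_one_iff'.1 h2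
    have hv' := norm_ne_zero_iff.2 hv
    refine ⟨‖v‖⁻¹ • v, by rw [norm_smul, norm_inv, norm_norm, inv_mul_cancel₀ hv'], fun w => ?_⟩
    obtain ⟨c, rfl⟩ := hs w
    exact ⟨c * ‖v‖, by rw [smul_smul, mul_assoc, mul_inv_cancel₀ hv', mul_one]⟩
  refine ⟨ξ, hξ, fun x => (R.mem_orthogonal _).1 ξ.2 _ ⟨x, rfl⟩, fun v hv => ?_⟩
  have : v ∈ Rᗮᗮ := (Submodule.mem_orthogonal _ _).2 fun w hw => by
    obtain ⟨c, hc⟩ := hspan ⟨w, hw⟩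
    rw [show w = c • (ξ : EuclideanSpace ℝ (Fin 7)) from (congrArg Subtype.val hc).symm,
      inner_smul_left, real_inner_comm, hv, mul_zero]
  rw [Submodule.orthogonal_orthogonal] at this
  exact this

/-- The third normal direction is the cross product of the position vector with the normal vector
`ξ` of the hyperplane that contains the curve: it is orthogonal to the differential and the
second fundamental form because these are complex linear with values orthogonal to `ξ`. -/
theorem exists_framedChart (h : IsPseudoholomorphicChart U u ι) (hE : Module.finrank ℝ E = 6)
    (hpos : ∀ z ∈ U, 0 < ‖secondMap u z 1‖ ^ 2) : ∃ η : ℂ → E,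
      IsFramedChart U u (fun z => (fderiv ℝ u z : ℂ →ₗ[ℝ] E)) (secondMap u) η
        (fun z => ‖fderiv ℝ u z 1‖ ^ 2) (fun z => ‖secondMap u z 1‖ ^ 2) ∧
      IsScalarData U (fun z => ‖fderiv ℝ u z 1‖ ^ 2) (fun z => ‖secondMap u z 1‖ ^ 2)
        (thirdCoeff (secondMap u) η) := by
  obtain ⟨ξ, hξ, hort, hsurj⟩ := exists_unit_normal hE ι
  have hex : ∀ z, ∃ x, ι x = cayleyCrossL (ι (u z)) ξ := fun z => hsurj _ (by
    rw [real_inner_comm, cayleyCrossL_swap, inner_neg_right, inner_cayleyCrossL_self, neg_zero])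
  choose η hη using hex
  have hsmooth : ContDiffOn ℝ ∞ η U := by
    have h1 : ContDiffOn ℝ ∞ (fun z => ContinuousLinearMap.adjoint ι.toContinuousLinearMap
        (cayleyCrossL (ι (u z)) ξ)) U :=
      (ContinuousLinearMap.adjoint ι.toContinuousLinearMap).contDiff.comp_contDiffOn
        (((cayleyCrossL.flip ξ).comp ι.toContinuousLinearMap).contDiff.comp_contDiffOn h.smooth_u)
    refine h1.congr fun z _ => ext_inner_right ℝ fun v => ?_
    rw [← hη, ContinuousLinearMap.adjoint_inner_left]
    exact (ι.inner_map_map _ _).symm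
  have hf : IsFramedChart U u (fun z => (fderiv ℝ u z : ℂ →ₗ[ℝ] E)) (secondMap u) η
      (fun z => ‖fderiv ℝ u z 1‖ ^ 2) (fun z => ‖secondMap u z 1‖ ^ 2) :=
    { h.isIsotropicChart with
      finrank_eq := hE
      ρ₂_pos := hpos
      smooth_η := hsmooth
      norm_η := fun z hz => by
        rw [← sq_eq_sq₀ (norm_nonneg _) zero_le_one, ← ι.norm_map, hη, norm_sq_cayleyCrossL, hort,
          ι.norm_map, h.norm_u z hz, hξ]
        norm_num
      inner_u_η := fun z _ => by
        rw [← ι.inner_map_map, hη, inner_cayleyCrossL_self]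
      inner_W₁_η := fun z hz c => by
        rw [← ι.inner_map_map, hη, ← neg_eq_zero, ← inner_cayleyCrossL]
        exact (congrArg (⟪·, ξ⟫_ℝ) (h.complexLinear z hz c).symm).trans (hort _)
      inner_W₂_η := fun z hz c => by
        rw [← ι.inner_map_map, hη, ← neg_eq_zero, ← inner_cayleyCrossL, ← h.secondMap_I_mul hz,
          hort] }
  refine ⟨η, hf, hf.isOpen, hf.smooth_ρ₁, hf.smooth_ρ₂, hf.ρ₁_pos, hf.ρ₂_pos, fun z hz =>
    (hf.hasDerivAt_thirdCoeff hz).differentiableAt.differentiableWithinAt, fun z hz => ?_⟩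
  -- the derivative of `η = u × ξ` has the length of `du`, and by the structure equations it is a
  -- multiple of `W₂` with coefficient `ψ`
  have h1 := (hf.deriv_η hz).clm ι.toContinuousLinearMap
  have h2 : HasDirDeriv (fun w => ι (η w)) (fun X => cayleyCrossL (ι (fderiv ℝ u z X)) ξ) z :=
    ((h.hasDirDeriv hz).clm ((cayleyCrossL.flip ξ).comp
      ι.toContinuousLinearMap)).congr_of_eventuallyEq (Filter.Eventually.of_forall fun w => hη w)
  have h3 := congrArg (fun v => ‖v‖ ^ 2) (h1.unique h2 1)
  have hp := hpos z hz
  have h4 : ‖secondMap u z ((2 / ‖secondMap u z 1‖ ^ 2 : ℝ) *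
      starRingEnd ℂ (thirdCoeff (secondMap u) η z * 1))‖ ^ 2 =
      4 * normSq (thirdCoeff (secondMap u) η z) / ‖secondMap u z 1‖ ^ 2 := by
    rw [← real_inner_self_eq_norm_sq, hf.inner_W₂ z hz, mul_conj, ofReal_re, normSq_mul,
      normSq_ofReal, normSq_conj, mul_one]
    field_simp
    ring
  simp only [LinearIsometry.coe_toContinuousLinearMap, map_neg, norm_neg, ι.norm_map, h4,
    norm_sq_cayleyCrossL, hort, hξ] at h3
  rw [div_eq_iff hp.ne'] at h3
  rw [h3]
  ring

end IsPseudoholomorphicChart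

end PseudoholomorphicChart

/-! ### Change of coordinates -/

section FundFormOne

variable {E : Type*} [NormedAddCommGroup E] [InnerProductSpace ℝ E] [FiniteDimensional ℝ E]

theorem normalSpace_proj_tangent (u : ℂ → E) (z X : ℂ) :
    (normalSpace u z).starProjection (fderiv ℝ u z X) = 0 := by
  rw [Submodule.starProjection_apply_eq_zero_iff, normalSpace, Submodule.orthogonal_orthogonal]
  exact Submodule.mem_sup_right ⟨X, rfl⟩

theorem fundForm_one (u : ℂ → E) (X : Fin 2 → ℂ) (z : ℂ) : fundForm u 1 X z =
    (normalSpace u z).starProjection (fderiv ℝ (fun w => fderiv ℝ u w (X 0)) z (X 1)) := by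
  have h1 : preForm u 1 X z =
      (normalSpace u z).starProjection (fderiv ℝ (fun w => fderiv ℝ u w (X 0)) z (X 1)) := rfl
  rw [fundForm, ← h1, Submodule.starProjection_eq_self_iff]
  have h2 : lowerSpace u 1 z ≤ Submodule.span ℝ {u z} ⊔ (fderiv ℝ u z).range := by
    refine sup_le bot_le (Submodule.span_le.2 ?_)
    rintro _ ⟨Y, rfl⟩
    refine Submodule.mem_sup_right ⟨Y 0, ?_⟩
    simp only [preForm, lowerSpace, Submodule.bot_orthogonal_eq_top]
    exact (Submodule.starProjection_eq_self_iff.2 Submodule.mem_top).symm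
  refine Submodule.orthogonal_le h2 ?_
  rw [h1]
  exact Submodule.starProjection_apply_mem _ _

end FundFormOne

section Charts

variable {M : Type*} [TopologicalSpace M] [ChartedSpace ℂ M] {F : Type*} [NormedAddCommGroup F]
  [NormedSpace ℝ F]

/-- The change of coordinates from the chart at `p` to the chart at `q`. -/
def chartChange (p q : M) : ℂ → ℂ := chartAt ℂ q ∘ (chartAt ℂ p).symm

/-- The domain of `chartChange p q`. -/
def chartOverlap (p q : M) : Set ℂ := ((chartAt ℂ p).symm ≫ₕ chartAt ℂ q).source

theorem isOpen_chartOverlap (p q : M) : IsOpen (chartOverlap p q) :=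
  ((chartAt ℂ p).symm ≫ₕ chartAt ℂ q).open_source

theorem mem_chartOverlap {p q : M} {z : ℂ} : z ∈ chartOverlap p q ↔
    z ∈ (chartAt ℂ p).target ∧ (chartAt ℂ p).symm z ∈ (chartAt ℂ q).source := by
  simp [chartOverlap]

theorem mem_chartOverlap_self {p : M} {z : ℂ} (hz : z ∈ (chartAt ℂ p).target) :
    z ∈ chartOverlap p ((chartAt ℂ p).symm z) :=
  mem_chartOverlap.2 ⟨hz, mem_chart_source ℂ _⟩

theorem chartChange_mem {p q : M} {z : ℂ} (hz : z ∈ chartOverlap p q) :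
    chartChange p q z ∈ chartOverlap q p := by
  obtain ⟨h1, h2⟩ := mem_chartOverlap.1 hz
  refine mem_chartOverlap.2 ⟨(chartAt ℂ q).map_source h2, ?_⟩
  rw [chartChange, Function.comp_apply, (chartAt ℂ q).left_inv h2]
  exact (chartAt ℂ p).map_target h1

theorem chartChange_chartChange {p q : M} {z : ℂ} (hz : z ∈ chartOverlap p q) :
    chartChange q p (chartChange p q z) = z := by
  obtain ⟨h1, h2⟩ := mem_chartOverlap.1 hz
  simp only [chartChange, Function.comp_apply, (chartAt ℂ q).left_inv h2,
    (chartAt ℂ p).right_inv h1]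

omit [NormedAddCommGroup F] [NormedSpace ℝ F] in
theorem localRep_eq_comp (f : M → F) {p q : M} {z : ℂ} (hz : z ∈ chartOverlap p q) :
    localRep f p z = localRep f q (chartChange p q z) := by
  obtain ⟨h1, h2⟩ := mem_chartOverlap.1 hz
  simp only [localRep, chartChange, Function.comp_apply, (chartAt ℂ q).left_inv h2]

omit [NormedAddCommGroup F] [NormedSpace ℝ F] in
theorem localRep_eventuallyEq (f : M → F) {p q : M} {z : ℂ} (hz : z ∈ chartOverlap p q) :
    localRep f p =ᶠ[nhds z] localRep f q ∘ chartChange p q := by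
  filter_upwards [(isOpen_chartOverlap p q).mem_nhds hz] with w hw using localRep_eq_comp f hw

theorem contMDiffAt_iff_localRep {f : M → F} {p : M} : ContMDiffAt 𝓘(ℝ, ℂ) 𝓘(ℝ, F) ∞ f p ↔
    ContinuousAt f p ∧ ContDiffAt ℝ ∞ (localRep f p) (chartAt ℂ p p) := by
  rw [contMDiffAt_iff]
  simp [localRep, Function.comp_def, contDiffWithinAt_univ, chartAt_self_eq]

variable [IsManifold 𝓘(ℂ) ω M]

theorem chartChange_contDiffOn (p q : M) : ContDiffOn ℂ ω (chartChange p q) (chartOverlap p q) := by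
  have h := contDiffOn_ext_coord_change (I := 𝓘(ℂ)) (n := ω) q p
  simpa [chartChange, chartOverlap, Function.comp_def] using h

theorem chartChange_hasDerivAt {p q : M} {z : ℂ} (hz : z ∈ chartOverlap p q) :
    HasDerivAt (chartChange p q) (deriv (chartChange p q) z) z :=
  (((chartChange_contDiffOn p q).contDiffAt
    ((isOpen_chartOverlap p q).mem_nhds hz)).differentiableAt (by simp)).hasDerivAt

theorem chartChange_contDiffAt {p q : M} {z : ℂ} (hz : z ∈ chartOverlap p q) :
    ContDiffAt ℝ ∞ (chartChange p q) z :=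
  (((chartChange_contDiffOn p q).contDiffAt
    ((isOpen_chartOverlap p q).mem_nhds hz)).restrict_scalars ℝ).of_le le_top

theorem deriv_chartChange_ne_zero {p q : M} {z : ℂ} (hz : z ∈ chartOverlap p q) :
    deriv (chartChange p q) z ≠ 0 := by
  have h1 := (chartChange_hasDerivAt (chartChange_mem hz)).comp z (chartChange_hasDerivAt hz)
  have h2 : HasDerivAt (chartChange q p ∘ chartChange p q) 1 z :=
    (hasDerivAt_id z).congr_of_eventuallyEq (by
      filter_upwards [(isOpen_chartOverlap p q).mem_nhds hz] with w hw
        using chartChange_chartChange hw)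
  intro h0
  have := h1.unique h2
  rw [h0, mul_zero] at this
  exact zero_ne_one this

theorem contDiffOn_localRep {f : M → F} (hf : ContMDiff 𝓘(ℝ, ℂ) 𝓘(ℝ, F) ∞ f) (p : M) :
    ContDiffOn ℝ ∞ (localRep f p) (chartAt ℂ p).target := by
  intro z hz
  have h1 := mem_chartOverlap_self hz
  have h2 := (contMDiffAt_iff_localRep.1 (hf ((chartAt ℂ p).symm z))).2
  exact ((ContDiffAt.comp z (g := localRep f ((chartAt ℂ p).symm z)) h2
    (chartChange_contDiffAt h1)).congr_of_eventuallyEq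
      (localRep_eventuallyEq f h1)).contDiffWithinAt

theorem contMDiffAt_of_localRep {f : M → F} {p q : M} (hq : q ∈ (chartAt ℂ p).source)
    (h : ContDiffAt ℝ ∞ (localRep f p) (chartAt ℂ p q)) :
    ContMDiffAt 𝓘(ℝ, ℂ) 𝓘(ℝ, F) ∞ f q := by
  have hz : chartAt ℂ q q ∈ chartOverlap q p := mem_chartOverlap.2
    ⟨mem_chart_target ℂ q, by rwa [(chartAt ℂ q).left_inv (mem_chart_source ℂ q)]⟩
  have hc : chartChange q p (chartAt ℂ q q) = chartAt ℂ p q := by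
    simp [chartChange, (chartAt ℂ q).left_inv (mem_chart_source ℂ q)]
  refine contMDiffAt_iff_localRep.2 ⟨?_, ?_⟩
  · have h1 : ContinuousAt (localRep f p ∘ chartAt ℂ p) q :=
      h.continuousAt.comp ((chartAt ℂ p).continuousAt hq)
    refine h1.congr ?_
    filter_upwards [(chartAt ℂ p).open_source.mem_nhds hq] with w hw
    simp [localRep, (chartAt ℂ p).left_inv hw]
  · rw [← hc] at h
    exact (ContDiffAt.comp _ h (chartChange_contDiffAt hz)).congr_of_eventuallyEq
      (localRep_eventuallyEq f hz)

theorem fderiv_localRep {f : M → F} {p q : M} {z : ℂ} (hz : z ∈ chartOverlap p q)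
    (hd : DifferentiableAt ℝ (localRep f q) (chartChange p q z)) (X : ℂ) :
    fderiv ℝ (localRep f p) z X =
      fderiv ℝ (localRep f q) (chartChange p q z) (deriv (chartChange p q) z * X) := by
  have h1 := hd.hasFDerivAt.comp z
    ((chartChange_hasDerivAt hz).hasFDerivAt.restrictScalars ℝ)
  rw [(h1.congr_of_eventuallyEq (localRep_eventuallyEq f hz)).fderiv]
  simp [mul_comm]

variable {E : Type*} [NormedAddCommGroup E] [InnerProductSpace ℝ E]

theorem differential_eq_fderiv_localRep {f : M → E} (hf : ContMDiff 𝓘(ℝ, ℂ) 𝓘(ℝ, E) ∞ f) (p : M)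
    {z : ℂ}
    (hz : z ∈ (chartAt ℂ p).target) (X : ℂ) : fderiv ℝ (localRep f p) z X =
      differential f ((chartAt ℂ p).symm z)
        (deriv (chartChange p ((chartAt ℂ p).symm z)) z * X) :=
  fderiv_localRep (mem_chartOverlap_self hz) (((contDiffOn_localRep hf _).contDiffAt
    ((chartAt ℂ _).open_target.mem_nhds
      (chartChange_mem (mem_chartOverlap_self hz)).1)).differentiableAt (by simp)) X

theorem normalSpaceAt_eq {f : M → E} (hf : ContMDiff 𝓘(ℝ, ℂ) 𝓘(ℝ, E) ∞ f) (p : M) {z : ℂ}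
    (hz : z ∈ (chartAt ℂ p).target) :
    normalSpaceAt f ((chartAt ℂ p).symm z) = normalSpace (localRep f p) z := by
  have h0 := deriv_chartChange_ne_zero (mem_chartOverlap_self hz)
  have h1 : localRep f ((chartAt ℂ p).symm z) (chartAt ℂ ((chartAt ℂ p).symm z)
      ((chartAt ℂ p).symm z)) = localRep f p z :=
    (localRep_eq_comp f (mem_chartOverlap_self hz)).symm
  have h2 : (fderiv ℝ (localRep f p) z).range =
      (differential f ((chartAt ℂ p).symm z)).range := by
    ext v
    constructor
    · rintro ⟨X, rfl⟩
      exact ⟨_, (differential_eq_fderiv_localRep hf p hz X).symm⟩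
    · rintro ⟨X, rfl⟩
      refine ⟨(deriv (chartChange p ((chartAt ℂ p).symm z)) z)⁻¹ * X,
        (differential_eq_fderiv_localRep hf p hz _).trans ?_⟩
      rw [mul_inv_cancel_left₀ h0]
      rfl
  rw [normalSpaceAt, normalSpace, normalSpace, h1, h2]
  rfl

variable [FiniteDimensional ℝ E]

theorem fundFormAt_eq {f : M → E} (hf : ContMDiff 𝓘(ℝ, ℂ) 𝓘(ℝ, E) ∞ f) (p : M) {z : ℂ}
    (hz : z ∈ (chartAt ℂ p).target) (X Y : ℂ) : fundForm (localRep f p) 1 ![X, Y] z =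
      fundFormAt f 1 ((chartAt ℂ p).symm z)
        ![deriv (chartChange p ((chartAt ℂ p).symm z)) z * X,
          deriv (chartChange p ((chartAt ℂ p).symm z)) z * Y] := by
  set q := (chartAt ℂ p).symm z with hq
  have ho : z ∈ chartOverlap p q := mem_chartOverlap_self hz
  have hN : normalSpace (localRep f q) (chartAt ℂ q q) = normalSpace (localRep f p) z :=
    normalSpaceAt_eq hf p hz
  set σ := chartChange p q
  have hσz : σ z = chartAt ℂ q q := rfl
  have hu := (contDiffOn_localRep hf q).contDiffAt
    ((chartAt ℂ q).open_target.mem_nhds (mem_chart_target ℂ q))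
  rw [fundFormAt, fundForm_one, fundForm_one, hN]
  simp only [Matrix.cons_val_zero, Matrix.cons_val_one]
  have hd2 : DifferentiableAt ℝ (fderiv ℝ (localRep f q)) (σ z) :=
    ((hu.fderiv_right (m := 1) (by norm_cast)).differentiableAt (by norm_num))
  have hσ1 := (chartChange_hasDerivAt ho).hasFDerivAt.restrictScalars ℝ
  have hσ2 : DifferentiableAt ℝ (deriv σ) z := by
    have := ((chartChange_contDiffOn p q).contDiffAt ((isOpen_chartOverlap p q).mem_nhds ho))
    have h2 : DifferentiableAt ℂ (deriv σ) z :=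
      (((chartChange_contDiffOn p q).differentiableOn (by simp)).deriv
        (isOpen_chartOverlap p q)).differentiableAt ((isOpen_chartOverlap p q).mem_nhds ho)
    exact h2.restrictScalars ℝ
  have hev : (fun w => fderiv ℝ (localRep f p) w X) =ᶠ[nhds z]
      fun w => fderiv ℝ (localRep f q) (σ w) (deriv σ w * X) := by
    filter_upwards [(isOpen_chartOverlap p q).mem_nhds ho] with w hw
    exact fderiv_localRep hw (((contDiffOn_localRep hf q).contDiffAt
      ((chartAt ℂ q).open_target.mem_nhds (chartChange_mem hw).1)).differentiableAt (by simp)) X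
  have h1 := (hd2.hasFDerivAt.comp z hσ1).clm_apply (hσ2.hasFDerivAt.mul_const X)
  have h2 := (h1.congr_of_eventuallyEq hev).fderiv
  have h3 : ∀ a b, fderiv ℝ (fun w => fderiv ℝ (localRep f q) w a) (chartAt ℂ q q) b =
      fderiv ℝ (fderiv ℝ (localRep f q)) (σ z) b a := fun a b => by
    rw [← hσz, fderiv_clm_apply hd2 (differentiableAt_const a)]
    simp
  rw [h2, h3]
  have h4 : ∀ a, (normalSpace (localRep f p) z).starProjection (fderiv ℝ (localRep f q) (σ z) a) =
      0 := fun a => by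
    rw [← hN]
    exact normalSpace_proj_tangent _ _ a
  simp [h4, mul_comm, σ]

end Charts

/-! ### The charts of the curve and of its associated family -/

section AssociateCharts

variable {M : Type*} [TopologicalSpace M] [ChartedSpace ℂ M] [IsManifold 𝓘(ℂ) ω M]
  {E : Type*} [NormedAddCommGroup E] [InnerProductSpace ℝ E]

theorem fderiv_localRep_of_contMDiffAt {f : M → E} {p : M} {z : ℂ}
    (hz : z ∈ (chartAt ℂ p).target) (hf : ContMDiffAt 𝓘(ℝ, ℂ) 𝓘(ℝ, E) ∞ f ((chartAt ℂ p).symm z))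
    (X : ℂ) : fderiv ℝ (localRep f p) z X = differential f ((chartAt ℂ p).symm z)
      (deriv (chartChange p ((chartAt ℂ p).symm z)) z * X) :=
  fderiv_localRep (mem_chartOverlap_self hz)
    ((contMDiffAt_iff_localRep.1 hf).2.differentiableAt (by simp)) X

omit [IsManifold 𝓘(ℂ) ω M] in
theorem mem_normalSpace {u : ℂ → E} {z : ℂ} {n : E} (h1 : ⟪u z, n⟫_ℝ = 0)
    (h2 : ∀ X, ⟪fderiv ℝ u z X, n⟫_ℝ = 0) : n ∈ normalSpace u z := by
  refine (Submodule.mem_orthogonal _ _).2 fun v hv => ?_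
  obtain ⟨a, ha, b, ⟨X, rfl⟩, rfl⟩ := Submodule.mem_sup.1 hv
  obtain ⟨t, rfl⟩ := Submodule.mem_span_singleton.1 ha
  rw [inner_add_left, inner_smul_left, h1]
  simpa using h2 X

section Curve

variable {g : M → E} {ι : E →ₗᵢ[ℝ] EuclideanSpace ℝ (Fin 7)}

omit [IsManifold 𝓘(ℂ) ω M] in
theorem IsPseudoholomorphicCurve.contMDiff [FiniteDimensional ℝ E]
    (hg : IsPseudoholomorphicCurve fun p => ι (g p)) : ContMDiff 𝓘(ℝ, ℂ) 𝓘(ℝ, E) ∞ g := by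
  have h := (ContinuousLinearMap.adjoint ι.toContinuousLinearMap).contMDiff.comp hg.smooth
  have e : g = ContinuousLinearMap.adjoint ι.toContinuousLinearMap ∘ fun p => ι (g p) := by
    funext p
    refine ext_inner_right ℝ fun v => ?_
    rw [Function.comp_apply, ContinuousLinearMap.adjoint_inner_left]
    exact (ι.inner_map_map _ _).symm
  rw [e]
  exact h

theorem IsPseudoholomorphicCurve.isPseudoholomorphicChart [FiniteDimensional ℝ E]
    (hg : IsPseudoholomorphicCurve fun p => ι (g p))
    (himm : ∀ p, Function.Injective (differential g p)) (p : M) :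
    IsPseudoholomorphicChart (chartAt ℂ p).target (localRep g p) ι where
  isOpen := (chartAt ℂ p).open_target
  smooth_u := contDiffOn_localRep hg.contMDiff p
  norm_u z _ := by
    have := hg.mem_sphere ((chartAt ℂ p).symm z)
    rwa [mem_sphere_zero_iff_norm, ι.norm_map] at this
  injective z hz X Y hXY := by
    rw [differential_eq_fderiv_localRep hg.contMDiff p hz,
      differential_eq_fderiv_localRep hg.contMDiff p hz] at hXY
    exact mul_left_cancel₀ (deriv_chartChange_ne_zero (mem_chartOverlap_self hz)) (himm _ hXY)
  complexLinear z hz X := by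
    have h1 : ∀ Y, ι (fderiv ℝ (localRep g p) z Y) =
        differential (fun p => ι (g p)) ((chartAt ℂ p).symm z)
          (deriv (chartChange p ((chartAt ℂ p).symm z)) z * Y) := fun Y => by
      rw [← differential_eq_fderiv_localRep hg.smooth p hz]
      have hd := ((contDiffOn_localRep hg.contMDiff p).contDiffAt
        ((chartAt ℂ p).open_target.mem_nhds hz)).differentiableAt (by simp)
      have := (ι.toContinuousLinearMap.hasFDerivAt.comp z hd.hasFDerivAt).fderiv
      exact (congrArg (fun L : ℂ →L[ℝ] EuclideanSpace ℝ (Fin 7) => L Y) this).symm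
    rw [h1, h1, mul_left_comm]
    exact eq_cayleyCross (hg.complexLinear _ _)

variable [FiniteDimensional ℝ E]

theorem IsPseudoholomorphicChart.fundForm_eq {U : Set ℂ} {u : ℂ → E}
    (h : IsPseudoholomorphicChart U u ι) {z : ℂ} (hz : z ∈ U) (X Y : ℂ) :
    fundForm u 1 ![X, Y] z = secondMap u z (X * Y) := by
  rw [fundForm_one]
  exact h.secondMap_mul hz X Y

/-- Where the curvature is less than `1`, the second fundamental form does not vanish. -/
theorem IsPseudoholomorphicCurve.secondMap_pos
    (hg : IsPseudoholomorphicCurve fun p => ι (g p))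
    (himm : ∀ p, Function.Injective (differential g p)) (hK : ∀ p, gaussCurvature g p < 1) (p : M)
    {z : ℂ} (hz : z ∈ (chartAt ℂ p).target) : 0 < ‖secondMap (localRep g p) z 1‖ ^ 2 := by
  set q := (chartAt ℂ p).symm z with hq
  have hc := hg.isPseudoholomorphicChart himm q
  have hzq := mem_chart_target ℂ q
  have h1 := hc.isIsotropicChart.gaussCurvature_eq hzq
  have h2 := fundFormAt_eq hg.contMDiff p hz 1 1
  rw [(hg.isPseudoholomorphicChart himm p).fundForm_eq hz, ← hq, fundFormAt, hc.fundForm_eq hzq,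
    mul_one, mul_one] at h2
  have h0 := deriv_chartChange_ne_zero (mem_chartOverlap_self hz)
  rw [h2, ← real_inner_self_eq_norm_sq, hc.isIsotropicChart.inner_W₂ _ hzq, mul_conj, ofReal_re]
  refine mul_pos ?_ (normSq_pos.2 (mul_ne_zero h0 h0))
  by_contra! h3
  have h4 := hK q
  rw [h1] at h4
  have h5 : 2 * ‖secondMap (localRep g q) (chartAt ℂ q q) 1‖ ^ 2 /
      (‖fderiv ℝ (localRep g q) (chartAt ℂ q q) 1‖ ^ 2) ^ 2 ≤ 0 :=
    div_nonpos_of_nonpos_of_nonneg (by linarith) (by positivity)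
  linarith

end Curve

section Associate

variable [FiniteDimensional ℝ E] {f h : M → E} {T : M → E →L[ℝ] E}

omit [IsManifold 𝓘(ℂ) ω M] in
theorem IsParallelNormalIsometry.inner_map_map (hT : IsParallelNormalIsometry f h T) (p : M)
    {n n' : E} (hn : n ∈ normalSpaceAt f p) (hn' : n' ∈ normalSpaceAt f p) :
    ⟪T p n, T p n'⟫_ℝ = ⟪n, n'⟫_ℝ := by
  let φ : normalSpaceAt f p →ₗᵢ[ℝ] E :=
    ⟨(T p : E →ₗ[ℝ] E) ∘ₗ (normalSpaceAt f p).subtype, fun ξ => hT.isometry p ξ ξ.2⟩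
  exact φ.inner_map_map ⟨n, hn⟩ ⟨n', hn'⟩

/-- A parallel isometry of the normal bundles preserves the derivatives of normal fields, up to
their tangential parts. -/
theorem IsParallelNormalIsometry.inner_fderiv (hT : IsParallelNormalIsometry f h T)
    (hf : ContMDiff 𝓘(ℝ, ℂ) 𝓘(ℝ, E) ∞ f) (hh : ContMDiff 𝓘(ℝ, ℂ) 𝓘(ℝ, E) ∞ h) (p : M)
    {v : ℂ → E} (hv : ContDiffOn ℝ ∞ v (chartAt ℂ p).target)
    (hvn : ∀ z ∈ (chartAt ℂ p).target, v z ∈ normalSpace (localRep f p) z) {z : ℂ}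
    (hz : z ∈ (chartAt ℂ p).target) {n : E} (hn : n ∈ normalSpace (localRep f p) z) (X : ℂ) :
    ⟪fderiv ℝ (fun w => localRep T p w (v w)) z X, localRep T p z n⟫_ℝ = ⟪fderiv ℝ v z X, n⟫_ℝ := by
  set q := (chartAt ℂ p).symm z with hq
  have hqs : q ∈ (chartAt ℂ p).source := (chartAt ℂ p).map_target hz
  have hzq : chartAt ℂ p q = z := (chartAt ℂ p).right_inv hz
  have hnhds := (chartAt ℂ p).open_target.mem_nhds hz
  let ζ : M → E := fun q => v (chartAt ℂ p q)
  have e1 : localRep ζ p =ᶠ[nhds z] v := by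
    filter_upwards [hnhds] with w hw
    simp [localRep, ζ, (chartAt ℂ p).right_inv hw]
  have e2 : localRep (fun q => T q (ζ q)) p =ᶠ[nhds z] fun w => localRep T p w (v w) := by
    filter_upwards [hnhds] with w hw
    simp [localRep, ζ, (chartAt ℂ p).right_inv hw]
  have hTs : ContDiffOn ℝ ∞ (localRep T p) (chartAt ℂ p).target := contDiffOn_localRep hT.smooth p
  have c1 : ContMDiffAt 𝓘(ℝ, ℂ) 𝓘(ℝ, E) ∞ ζ q := contMDiffAt_of_localRep hqs (by
    rw [hzq]
    exact (hv.contDiffAt hnhds).congr_of_eventuallyEq e1)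
  have c2 : ContMDiffAt 𝓘(ℝ, ℂ) 𝓘(ℝ, E) ∞ (fun q => T q (ζ q)) q := contMDiffAt_of_localRep hqs (by
    rw [hzq]
    exact ((hTs.clm_apply hv).contDiffAt hnhds).congr_of_eventuallyEq e2)
  have hN := normalSpaceAt_eq hf p hz
  have hN' := normalSpaceAt_eq hh p hz
  have hpar := hT.parallel q ζ c1 (by
    filter_upwards [(chartAt ℂ p).open_source.mem_nhds hqs] with q' hq'
    have := normalSpaceAt_eq hf p ((chartAt ℂ p).map_source hq')
    rw [(chartAt ℂ p).left_inv hq'] at this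
    rw [this]
    exact hvn _ ((chartAt ℂ p).map_source hq'))
    (deriv (chartChange p q) z * X)
  rw [← fderiv_localRep_of_contMDiffAt hz c1, ← fderiv_localRep_of_contMDiffAt hz c2,
    e1.fderiv_eq, e2.fderiv_eq] at hpar
  have hn' : n ∈ normalSpaceAt f q := by rwa [hN]
  have hTn : T q n ∈ normalSpaceAt h q := by
    rw [← hT.onto]
    exact ⟨n, hn', rfl⟩
  change ⟪_, T q n⟫_ℝ = _
  rw [← Submodule.starProjection_eq_self_iff.2 hTn, ← Submodule.inner_starProjection_left_eq_right,
    hpar, hT.inner_map_map q (Submodule.starProjection_apply_mem _ _) hn',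
    Submodule.inner_starProjection_left_eq_right, Submodule.starProjection_eq_self_iff.2 hn']

/-- The framed charts of the members of the associated family: the second fundamental form and the
coefficient of the third one are multiplied by `e^{iθ}`. -/
theorem IsAssociate.exists_framedChart {θ : ℝ} (hA : IsAssociate f θ h)
    (hf : ContMDiff 𝓘(ℝ, ℂ) 𝓘(ℝ, E) ∞ f) (p : M) {W₂ : ℂ → ℂ →ₗ[ℝ] E} {η : ℂ → E}
    {ρ₁ ρ₂ : ℂ → ℝ}
    (hc : IsFramedChart (chartAt ℂ p).target (localRep f p)
      (fun z => (fderiv ℝ (localRep f p) z : ℂ →ₗ[ℝ] E)) W₂ η ρ₁ ρ₂) :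
    ∃ (W₁' W₂' : ℂ → ℂ →ₗ[ℝ] E) (η' : ℂ → E),
      IsFramedChart (chartAt ℂ p).target (localRep h p) W₁' W₂' η' ρ₁ ρ₂ ∧
      ∀ z ∈ (chartAt ℂ p).target, thirdCoeff W₂' η' z = exp (θ * I) * thirdCoeff W₂ η z := by
  obtain ⟨hmin, hmet, T, hT, hα⟩ := hA
  have hh := hmin.smooth
  set e : ℂ := exp (θ * I) with he
  have hen : normSq e = 1 := by rw [normSq_eq_norm_sq, norm_exp_ofReal_mul_I, one_pow]
  have heX : ∀ X : ℂ, (Real.cos θ : ℂ) * X + (Real.sin θ : ℂ) * (I * X) = e * X := fun X => by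
    rw [he, exp_mul_I]
    push_cast
    ring
  have hηN : ∀ z ∈ (chartAt ℂ p).target, η z ∈ normalSpace (localRep f p) z := fun z hz =>
    mem_normalSpace (hc.inner_u_η z hz) (hc.inner_W₁_η z hz)
  have hTN : ∀ z ∈ (chartAt ℂ p).target, ∀ n ∈ normalSpace (localRep f p) z,
      localRep T p z n ∈ normalSpace (localRep h p) z := fun z hz n hn => by
    rw [← normalSpaceAt_eq hf p hz] at hn
    rw [← normalSpaceAt_eq hh p hz, ← hT.onto]
    exact ⟨n, hn, rfl⟩
  have hTi : ∀ z ∈ (chartAt ℂ p).target, ∀ n ∈ normalSpace (localRep f p) z,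
      ∀ n' ∈ normalSpace (localRep f p) z,
      ⟪localRep T p z n, localRep T p z n'⟫_ℝ = ⟪n, n'⟫_ℝ := fun z hz n hn n' hn' => by
    rw [← normalSpaceAt_eq hf p hz] at hn hn'
    exact hT.inner_map_map _ hn hn'
  have hsm := contDiffOn_localRep hh p
  have hTs : ContDiffOn ℝ ∞ (localRep T p) (chartAt ℂ p).target := contDiffOn_localRep hT.smooth p
  set W₂' : ℂ → ℂ →ₗ[ℝ] E := fun z =>
    ((localRep T p z : E →L[ℝ] E) : E →ₗ[ℝ] E) ∘ₗ W₂ z ∘ₗ LinearMap.mulLeft ℝ e with hW₂'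
  have hW₂'a : ∀ z c, W₂' z c = localRep T p z (W₂ z (e * c)) := fun _ _ => rfl
  refine ⟨fun z => (fderiv ℝ (localRep h p) z : ℂ →ₗ[ℝ] E), W₂', fun z => localRep T p z (η z), ?_,
    fun z hz => ?_⟩
  · exact
    { isOpen := hc.isOpen
      smooth_u := hsm
      norm_u := fun z _ => mem_sphere_zero_iff_norm.1 (hmin.mem_sphere _)
      deriv_u := fun z hz => hsm.hasDirDeriv hc.isOpen hz
      ρ₁_pos := hc.ρ₁_pos
      inner_W₁ := fun z hz c d => by
        change ⟪fderiv ℝ (localRep h p) z c, fderiv ℝ (localRep h p) z d⟫_ℝ = _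
        rw [differential_eq_fderiv_localRep hh p hz, differential_eq_fderiv_localRep hh p hz,
          ← hmet, ← differential_eq_fderiv_localRep hf p hz,
          ← differential_eq_fderiv_localRep hf p hz]
        exact hc.inner_W₁ z hz c d
      normal_W₁ := fun z hz c X => by
        have h1 := fundForm_one (localRep h p) ![c, X] z
        have h2 := fundForm_one (localRep f p) ![e * c, X] z
        rw [fundFormAt_eq hh p hz, hα, heX, mul_left_comm, ← fundFormAt_eq hf p hz, h2] at h1
        refine h1.symm.trans (congrArg (T _) ((hc.normal_W₁ z hz (e * c) X).trans ?_))
        rw [mul_assoc]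
        rfl
      inner_W₂ := fun z hz c d => by
        rw [hW₂'a, hW₂'a, hTi z hz _ (hc.W₂_mem hz _) _ (hc.W₂_mem hz _), hc.inner_W₂ z hz, map_mul,
          show e * c * (starRingEnd ℂ e * starRingEnd ℂ d) =
            e * starRingEnd ℂ e * (c * starRingEnd ℂ d) by ring, mul_conj, hen, ofReal_one, one_mul]
      finrank_eq := hc.finrank_eq
      ρ₂_pos := hc.ρ₂_pos
      smooth_η := hTs.clm_apply hc.smooth_η
      norm_η := fun z hz => by
        rw [← sq_eq_sq₀ (norm_nonneg _) zero_le_one, ← real_inner_self_eq_norm_sq,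
          hTi z hz _ (hηN z hz) _ (hηN z hz), real_inner_self_eq_norm_sq, hc.norm_η z hz]
      inner_u_η := fun z hz => by
        rw [real_inner_comm]
        exact (IsPseudoholomorphicChart.inner_normal _ _ (hTN z hz _ (hηN z hz))).1
      inner_W₁_η := fun z hz c => by
        rw [real_inner_comm]
        exact (IsPseudoholomorphicChart.inner_normal _ _ (hTN z hz _ (hηN z hz))).2 c
      inner_W₂_η := fun z hz c => by
        rw [hW₂'a, hTi z hz _ (hc.W₂_mem hz _) _ (hηN z hz), hc.inner_W₂_η z hz] }
  · have key : ∀ c, ⟪fderiv ℝ (fun w => W₂' w c) z 1, localRep T p z (η z)⟫_ℝ =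
        2 * (thirdCoeff W₂ η z * (e * c)).re := fun c => by
      have := hT.inner_fderiv hf hh p (hc.smooth_W₂ (e * c)) (fun w hw => hc.W₂_mem hw _) hz
        (hηN z hz) 1
      rw [hc.inner_η_fderiv_W₂ hz, mul_one] at this
      exact this
    rw [thirdCoeff, key, key]
    generalize thirdCoeff W₂ η z = ψ
    apply Complex.ext <;> simp <;> ring

end Associate

end AssociateCharts

/-! ### Surfaces modelled on a direct sum -/

section SumChart

variable {m : ℕ} {E F : Type*} [NormedAddCommGroup E] [InnerProductSpace ℝ E]
  [FiniteDimensional ℝ E] [NormedAddCommGroup F] [InnerProductSpace ℝ F] [FiniteDimensional ℝ F]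

/-- `v` is on `U` a conformal immersion into the unit sphere whose fundamental forms are at each
point, up to a linear isometry, those of the model direct sum with weights `a` and rotations `l`,
multiplied by the complex factors `modelFactor` of the scalar data `ρ₁, ρ₂, ψ`. -/
structure IsSumChart (a : Fin m → ℝ) (l : Fin m → ℂ) (U : Set ℂ) (v : ℂ → F) (ρ₁ ρ₂ : ℂ → ℝ)
    (ψ : ℂ → ℂ) : Prop where
  scalar : IsScalarData U ρ₁ ρ₂ ψ
  smooth : ContDiffOn ℝ ∞ v U
  norm_eq : ∀ z ∈ U, ‖v z‖ = 1
  inner_fderiv : ∀ z ∈ U, ∀ c d,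
    ⟪fderiv ℝ v z c, fderiv ℝ v z d⟫_ℝ = ρ₁ z * (c * starRingEnd ℂ d).re
  exists_fundForm_eq : ∀ z ∈ U, ∃ Ψ : (PiLp 2 fun _ : Fin m => ModelFiber) →ₗᵢ[ℝ] F,
    ∀ (s : ℕ) (X : Fin (s + 1) → ℂ), fundForm v s X z =
      transport Ψ (modelForm a l s) (modelFactor (ρ₁ z) (ρ₂ z) (ψ z) (s + 1)) (∏ i, X i)

theorem isSumChart_sumVec {U : Set ℂ} {ρ₁ ρ₂ : ℂ → ℝ} {ψ : ℂ → ℂ} {a : Fin m → ℝ} {l : Fin m → ℂ}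
    {u : Fin m → ℂ → E} {W₁ W₂ : Fin m → ℂ → ℂ →ₗ[ℝ] E} {η : Fin m → ℂ → E}
    (h : ∀ j, IsFramedChart U (u j) (W₁ j) (W₂ j) (η j) ρ₁ ρ₂) (ha : ∑ j, a j ^ 2 = 1)
    (hl : ∀ j, normSq (l j) = 1) (j₀ : Fin m) (hd : IsScalarData U ρ₁ ρ₂ ψ)
    (hκ : ∀ j, ∀ z ∈ U, thirdCoeff (W₂ j) (η j) z = l j * ψ z) :
    IsSumChart a l U (fun z => sumVec a fun j => u j z) ρ₁ ρ₂ ψ := by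
  have ho := isOsculating_sumSeq ha hl j₀ h hd hκ
  exact
  { scalar := hd
    smooth := ho.smooth_u
    norm_eq := ho.norm_u
    inner_fderiv := fun z hz c d => by
      rw [(ho.deriv_u z hz).2, (ho.deriv_u z hz).2, ho.inner_W_one z hz]
    exists_fundForm_eq := fun z hz =>
      ⟨sumFrameIsometry h hz, fun s X => fundForm_sumVec h ha hl j₀ hd hκ hz s X⟩ }

/-- The second Hopf differential of a framed surface in the five-sphere. -/
theorem IsFramedChart.hopfCoeff_two {U : Set ℂ} {u : ℂ → E} {W₁ W₂ : ℂ → ℂ →ₗ[ℝ] E} {η : ℂ → E}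
    {ρ₁ ρ₂ : ℂ → ℝ} (h : IsFramedChart U u W₁ W₂ η ρ₁ ρ₂)
    (hd : IsScalarData U ρ₁ ρ₂ (thirdCoeff W₂ η)) {z : ℂ} (hz : z ∈ U) :
    hopfCoeff u 2 z = thirdCoeff W₂ η z ^ 2 := by
  set ψ := thirdCoeff W₂ η with hψ
  have ho := isOsculating_cycSeq h hd (lam := 1) (by simp) fun z _ => (one_mul _).symm
  have hW : ∀ (r : ℕ) (_ : r < 6) c, cycSeq ρ₁ ρ₂ (fun z => 1 * ψ z) u W₁ W₂ η r z c =
      cycBase u W₁ W₂ η z r (cycCoeff (ρ₁ z) (ρ₂ z) (ψ z) 0 r * c) := fun r hr c => by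
    simpa using cycSeq_eq (ρ₁ := ρ₁) (ρ₂ := ρ₂) (u := u) (W₁ := W₁) (W₂ := W₂) (η := η) 0 r hr
      (fun z => 1 * ψ z) z c
  have hη : ∀ t : ℝ, t • η z ∈ (oscSpace u (cycSeq ρ₁ ρ₂ (fun z => 1 * ψ z) u W₁ W₂ η) 2 z)ᗮ := by
    refine fun t => Submodule.smul_mem _ _ ((Submodule.mem_orthogonal _ _).2 ?_)
    have hle : oscSpace u (cycSeq ρ₁ ρ₂ (fun z => 1 * ψ z) u W₁ W₂ η) 2 z ≤
        LinearMap.ker (innerₛₗ ℝ (η z)) := by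
      refine sup_le (sup_le ?_ ?_) ?_
      · refine (Submodule.span_singleton_le_iff_mem _ _).2 ?_
        rw [LinearMap.mem_ker, innerₛₗ_apply_apply, real_inner_comm]
        exact h.inner_u_η z hz
      · rintro _ ⟨c, rfl⟩
        rw [LinearMap.mem_ker, innerₛₗ_apply_apply, real_inner_comm, hW 1 (by norm_num)]
        exact h.inner_W₁_η z hz _
      · rintro _ ⟨c, rfl⟩
        rw [LinearMap.mem_ker, innerₛₗ_apply_apply, real_inner_comm, hW 2 (by norm_num)]
        exact h.inner_W₂_η z hz _
    intro x hx
    rw [real_inner_comm]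
    exact hle hx
  have hL : ∀ X : Fin 3 → ℂ, fundForm u 2 X z =
      (twoReSmul (η z) ∘ₗ LinearMap.mulLeft ℝ (ψ z)) (∏ i, X i) := fun X => by
    rw [ho.fundForm_eq hz, hW 3 (by norm_num)]
    have : cycBase u W₁ W₂ η z 3 (cycCoeff (ρ₁ z) (ρ₂ z) (ψ z) 0 3 * ∏ i, X i) =
        (2 * (ψ z * ∏ i, X i).re) • η z := by
      simp [cycBase, cycCoeff, twoReSmul_apply]
    rw [this, Submodule.starProjection_eq_self_iff.2 (hη _)]
    simp [twoReSmul_apply]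
  rw [hopfCoeff_of_fundForm_eq _ hL]
  simp only [LinearMap.comp_apply, LinearMap.mulLeft_apply, twoReSmul_apply, inner_smul_left,
    inner_smul_right, real_inner_self_eq_norm_sq, h.norm_η z hz, mul_one, mul_I_re, conj_trivial]
  conv_rhs => rw [← re_add_im (ψ z)]
  generalize (ψ z).re = x
  generalize (ψ z).im = y
  push_cast
  linear_combination (-(y : ℂ) ^ 2) * I_sq

variable {M : Type*} [TopologicalSpace M] [ChartedSpace ℂ M] {a : Fin m → ℝ} {l : Fin m → ℂ}
  {f : M → F} {p : M} {ρ₁ ρ₂ : ℂ → ℝ} {ψ : ℂ → ℂ}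

namespace IsSumChart

variable (h : IsSumChart a l (chartAt ℂ p).target (localRep f p) ρ₁ ρ₂ ψ)

include h

theorem inner_differential (c d : ℂ) : ⟪differential f p c, differential f p d⟫_ℝ =
    ρ₁ (chartAt ℂ p p) * (c * starRingEnd ℂ d).re :=
  h.inner_fderiv _ (mem_chart_target ℂ p) c d

theorem frame {e : Fin 2 → ℂ} (he : IsFrame f p e) (i j : Fin 2) :
    ρ₁ (chartAt ℂ p p) * (e i * starRingEnd ℂ (e j)).re = if i = j then 1 else 0 := by
  rw [← h.inner_differential]
  exact (orthonormal_iff_ite.1 he) i j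

theorem norm_differential_sq (c : ℂ) :
    ‖differential f p c‖ ^ 2 = ρ₁ (chartAt ℂ p p) * normSq c := by
  rw [← real_inner_self_eq_norm_sq, h.inner_differential, mul_conj, ofReal_re]

theorem normSq_factor {t : ℝ} (ht : ρ₂ (chartAt ℂ p p) = ρ₁ (chartAt ℂ p p) ^ 2 * t / 2) (s : ℕ) :
    normSq (modelFactor (ρ₁ (chartAt ℂ p p)) (ρ₂ (chartAt ℂ p p)) (ψ (chartAt ℂ p p)) (s + 1)) =
      modelConst (s + 1) * t ^ curvatureExponent s * ρ₁ (chartAt ℂ p p) ^ (s + 1) :=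
  normSq_modelFactor (h.scalar.ρ₁_pos _ (mem_chart_target ℂ p))
    (h.scalar.ρ₂_pos _ (mem_chart_target ℂ p)) ht (h.scalar.normSq_ψ _ (mem_chart_target ℂ p)) s

theorem fundFormNormSq_eq {t : ℝ} (ht : ρ₂ (chartAt ℂ p p) = ρ₁ (chartAt ℂ p p) ^ 2 * t / 2) (s : ℕ)
    {e : Fin 2 → ℂ} (he : IsFrame f p e) : fundFormNormSq f s p e =
      2 ^ s * (‖modelForm a l s 1‖ ^ 2 + ‖modelForm a l s I‖ ^ 2) * modelConst (s + 1) *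
        t ^ curvatureExponent s := by
  obtain ⟨Ψ, hΨ⟩ := h.exists_fundForm_eq _ (mem_chart_target ℂ p)
  have h0 := h.scalar.ρ₁_pos _ (mem_chart_target ℂ p)
  simp only [fundFormNormSq, fundFormAt, hΨ]
  rw [sum_norm_sq_prod_frame h0 (h.frame he), normSq_transport, h.normSq_factor ht]
  field_simp

theorem curvatureEllipse_eq {L : ℂ →ₗ[ℝ] F} {s : ℕ}
    (hL : ∀ X, fundForm (localRep f p) s X (chartAt ℂ p p) = L (∏ i, X i)) :
    curvatureEllipse f s p = L '' Metric.sphere 0 (√(ρ₁ (chartAt ℂ p p)) ^ (s + 1))⁻¹ := by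
  rw [← image_unit_eq_sphere L (h.scalar.ρ₁_pos _ (mem_chart_target ℂ p)), curvatureEllipse]
  ext v
  refine exists_congr fun Z => and_congr ?_ ?_
  · rw [← h.norm_differential_sq, pow_eq_one_iff_of_nonneg (norm_nonneg _) two_ne_zero]
  · rw [fundFormAt, hL, Finset.prod_const, Finset.card_univ, Fintype.card_fin]

theorem normalCurvature_eq [MeasurableSpace F] [BorelSpace F] {t : ℝ}
    (ht : ρ₂ (chartAt ℂ p p) = ρ₁ (chartAt ℂ p p) ^ 2 * t / 2) (s : ℕ) : normalCurvature f s p =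
      2 * (modelForm a l s).normDet * modelConst (s + 1) * t ^ curvatureExponent s := by
  obtain ⟨Ψ, hΨ⟩ := h.exists_fundForm_eq _ (mem_chart_target ℂ p)
  have h0 := h.scalar.ρ₁_pos _ (mem_chart_target ℂ p)
  have h1 : (√(ρ₁ (chartAt ℂ p p)) ^ (s + 1)) ^ 2 = ρ₁ (chartAt ℂ p p) ^ (s + 1) := by
    rw [← pow_mul, mul_comm, pow_mul, Real.sq_sqrt h0.le]
  rw [normalCurvature, h.curvatureEllipse_eq (hΨ s),
    measure_convexHull_image_sphere _ (by positivity),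
    normDet_transport, h.normSq_factor ht, inv_pow, h1]
  field_simp [Real.pi_ne_zero]

theorem hopfDifferential_eq (s : ℕ) {z : ℂ} (hz : z ∈ (chartAt ℂ p).target) :
    hopfDifferential f s p z = if s % 3 = 2 then
      4 * hopfForm (modelForm a l s) * (ψ z ^ 2) ^ ((s + 1) / 3) else 0 := by
  obtain ⟨Ψ, hΨ⟩ := h.exists_fundForm_eq z hz
  rw [hopfDifferential, hopfCoeff_of_fundForm_eq _ (hΨ s), ← hopfForm, hopfForm_transport]
  split_ifs with hs
  · rw [modelFactor_sq _ _ _ (show s + 1 = 3 * ((s + 1) / 3) by omega)]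
    ring
  · rw [hopfForm_modelForm a l hs, mul_zero]

theorem differentiableOn_hopfDifferential (s : ℕ) :
    DifferentiableOn ℂ (hopfDifferential f s p) (chartAt ℂ p).target := by
  refine DifferentiableOn.congr ?_ fun z hz => h.hopfDifferential_eq s hz
  split_ifs
  · exact ((h.scalar.holo.pow 2).pow _).const_mul _
  · exact differentiableOn_const 0

/-- Minimality: `e₀² + e₁² = 0` for an orthonormal frame. -/
theorem sum_fundFormAt_frame {e : Fin 2 → ℂ} (he : IsFrame f p e) :
    ∑ i, fundFormAt f 1 p ![e i, e i] = 0 := by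
  obtain ⟨Ψ, hΨ⟩ := h.exists_fundForm_eq _ (mem_chart_target ℂ p)
  have h1 := (frame_eq (h.scalar.ρ₁_pos _ (mem_chart_target ℂ p)) (h.frame he)).2
  have h2 : e 0 * e 0 + e 1 * e 1 = 0 := by
    rcases h1 with h1 | h1 <;> rw [h1] <;> linear_combination (e 0) ^ 2 * I_sq
  have h3 : ∀ i, ∏ j, (![e i, e i] : Fin (1 + 1) → ℂ) j = e i * e i := fun i => Fin.prod_univ_two _
  simp only [fundFormAt, hΨ, Fin.sum_univ_two, h3]
  rw [← map_add, h2, map_zero]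

end IsSumChart

theorem isMinimalSurface_of_isSumChart [IsManifold 𝓘(ℂ) ω M]
    (h : ∀ p, ∃ ρ₁ ρ₂ ψ, IsSumChart a l (chartAt ℂ p).target (localRep f p) ρ₁ ρ₂ ψ) :
    IsMinimalSurface f where
  smooth p := by
    obtain ⟨ρ₁, ρ₂, ψ, hp⟩ := h p
    exact contMDiffAt_of_localRep (mem_chart_source ℂ p)
      (hp.smooth.contDiffAt ((chartAt ℂ p).open_target.mem_nhds (mem_chart_target ℂ p)))
  mem_sphere p := by
    obtain ⟨ρ₁, ρ₂, ψ, hp⟩ := h p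
    have := hp.norm_eq _ (mem_chart_target ℂ p)
    rwa [localRep, Function.comp_apply, (chartAt ℂ p).left_inv (mem_chart_source ℂ p),
      ← mem_sphere_zero_iff_norm] at this
  immersion p := by
    obtain ⟨ρ₁, ρ₂, ψ, hp⟩ := h p
    refine (injective_iff_map_eq_zero _).2 fun c hc => ?_
    have := hp.norm_differential_sq c
    rw [hc] at this
    simpa [(hp.scalar.ρ₁_pos _ (mem_chart_target ℂ p)).ne'] using this
  minimal p e he := by
    obtain ⟨ρ₁, ρ₂, ψ, hp⟩ := h p
    exact hp.sum_fundFormAt_frame he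

end SumChart

/-! ### The direct sum of members of the associated family -/

section Associates

theorem injective_exp_sq {m : ℕ} {θ : Fin m → ℝ} (hθ : StrictMono θ)
    (hmem : ∀ j, θ j ∈ Set.Ico 0 Real.pi) : Function.Injective fun j => exp (θ j * I) ^ 2 := by
  intro i j hij
  simp only [← exp_nat_mul] at hij
  obtain ⟨n, hn⟩ := exp_eq_exp_iff_exists_int.1 hij
  have h1 : θ i = θ j + n * Real.pi := by
    have h2 : ((θ i : ℂ) - (θ j + n * Real.pi)) * (2 * I) = 0 := by
      push_cast at hn
      linear_combination hn
    have h3 := (mul_eq_zero.1 h2).resolve_right (mul_ne_zero two_ne_zero I_ne_zero)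
    exact_mod_cast sub_eq_zero.1 h3
  have hi := hmem i
  have hj := hmem j
  have h4 : |(n : ℝ)| < 1 := by
    rw [← mul_lt_iff_lt_one_left Real.pi_pos, ← abs_of_pos Real.pi_pos, ← abs_mul, abs_lt,
      abs_of_pos Real.pi_pos]
    constructor <;> linarith [hi.1, hi.2, hj.1, hj.2]
  have h5 : n = 0 := Int.abs_lt_one_iff.1 (by exact_mod_cast h4)
  rw [h5, Int.cast_zero, zero_mul, add_zero] at h1
  exact hθ.injective h1

variable {M : Type*} [TopologicalSpace M] [ChartedSpace ℂ M] [IsManifold 𝓘(ℂ) ω M]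

/-- The local description of the direct sum, in terms of invariants of the curve `g`: the metric is
`ρ₁ |dz|²`, `ρ₂` determines the curvature, and `ψ ^ 2` is the second Hopf differential. -/
theorem exists_isSumChart_directSumSurface {g : M → EuclideanSpace ℝ (Fin 6)}
    (hg : IsPseudoholomorphicCurveInS5 g) (himm : ∀ p, Function.Injective (differential g p))
    (hK : ∀ p, gaussCurvature g p < 1) {m : ℕ} {a : Fin m → ℝ} (ha : ∑ j, a j ^ 2 = 1)
    (ha0 : ∀ j, a j ≠ 0) {θ : Fin m → ℝ} (hθ : StrictMono θ)
    (hmem : ∀ j, θ j ∈ Set.Ico 0 Real.pi) {gθ : Fin m → M → EuclideanSpace ℝ (Fin 6)}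
    (hgθ : ∀ j, IsAssociate g (θ j) (gθ j)) (p : M) :
    ∃ ρ₁ ρ₂ ψ, IsSumChart a (fun j => exp (θ j * I)) (chartAt ℂ p).target
        (localRep (directSumSurface a gθ) p) ρ₁ ρ₂ ψ ∧
      (∀ c d, ⟪differential g p c, differential g p d⟫_ℝ =
        ρ₁ (chartAt ℂ p p) * (c * starRingEnd ℂ d).re) ∧
      ρ₂ (chartAt ℂ p p) = ρ₁ (chartAt ℂ p p) ^ 2 * (1 - gaussCurvature g p) / 2 ∧
      (∀ z ∈ (chartAt ℂ p).target, hopfDifferential g 2 p z = ψ z ^ 2) ∧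
      ∀ V : Submodule ℝ (SumSpace m),
        (∀ w ∈ (chartAt ℂ p).target, localRep (directSumSurface a gθ) p w ∈ V) → V = ⊤ := by
  obtain ⟨ι, hι⟩ := hg
  obtain ⟨j₀⟩ : Nonempty (Fin m) := by
    by_contra h
    rw [not_nonempty_iff] at h
    simp at ha
  obtain ⟨η, hc, hd⟩ := (hι.isPseudoholomorphicChart himm p).exists_framedChart
    finrank_euclideanSpace_fin fun z hz => hι.secondMap_pos himm hK p hz
  choose W₁ W₂ ζ h hκ using fun j => (hgθ j).exists_framedChart hι.contMDiff p hc
  have hl : ∀ j, normSq (exp (θ j * I)) = 1 := fun j => by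
    rw [normSq_eq_norm_sq, norm_exp_ofReal_mul_I, one_pow]
  have hp := mem_chart_target ℂ p
  refine ⟨_, _, _, isSumChart_sumVec h ha hl j₀ hd hκ, fun c d => hc.inner_W₁ _ hp c d, ?_,
    fun z hz => hc.hopfCoeff_two hd hz,
    fun V hV => eq_top_of_sumVec_mem h ha ha0 hl (injective_exp_sq hθ hmem) j₀ hd hκ hp hV⟩
  rw [hc.toIsIsotropicChart.gaussCurvature_eq hp]
  have h0 := (pow_ne_zero_iff two_ne_zero).1 (hc.ρ₁_pos _ hp).ne'
  field_simp
  ring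

end Associates

end

theorem mainTheorem6 {M : Type*} [TopologicalSpace M] [T2Space M] [SimplyConnectedSpace M]
    [ChartedSpace ℂ M] [IsManifold 𝓘(ℂ) ω M]
    (g : M → EuclideanSpace ℝ (Fin 6)) (hg : IsPseudoholomorphicCurveInS5 g)
    (hg_imm : ∀ p, Function.Injective (differential g p)) (hK : ∀ p, gaussCurvature g p < 1)
    (m : ℕ) (a : Fin m → ℝ) (ha : ∑ j, a j ^ 2 = 1) (ha0 : ∀ j, a j ≠ 0)
    (θ : Fin m → ℝ) (hθ : StrictMono θ) (hθ_mem : ∀ j, θ j ∈ Set.Ico 0 Real.pi)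
    (gθ : Fin m → M → EuclideanSpace ℝ (Fin 6)) (hgθ : ∀ j, IsAssociate g (θ j) (gθ j)) :
    IsMinimalSurface (directSumSurface a gθ) ∧
    IsSubstantial (directSumSurface a gθ) ∧
    SameMetric g (directSumSurface a gθ) ∧
    IsExceptional (directSumSurface a gθ) ∧
    (∃ b : ℕ → ℝ, ∀ s, 1 ≤ s → s ≤ 3 * m - 1 → 0 < b s ∧
      ∀ (p : M) (e : Fin 2 → ℂ), IsFrame (directSumSurface a gθ) p e →
        fundFormNormSq (directSumSurface a gθ) s p e =
          b s * (1 - gaussCurvature g p) ^ curvatureExponent s) ∧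
    (∃ c : ℕ → ℝ, ∀ s, 1 ≤ s → s < 3 * m - 1 → 0 < c s ∧
      ∀ p : M, normalCurvature (directSumSurface a gθ) s p =
        c s * (1 - gaussCurvature g p) ^ curvatureExponent s) ∧
    (∃ d : ℕ → ℂ, ∀ s, 1 ≤ s → s ≤ 3 * m - 1 →
      ∀ p : M, ∀ z ∈ (chartAt ℂ p).target,
        hopfDifferential (directSumSurface a gθ) s p z =
          if s % 3 = 2 then d s * hopfDifferential g 2 p z ^ ((s + 1) / 3) else 0) := by
  set l : Fin m → ℂ := fun j => exp (θ j * I) with hl_def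
  have key := exists_isSumChart_directSumSurface hg hg_imm hK ha ha0 hθ hθ_mem hgθ
  have hl : ∀ j, normSq (l j) = 1 := fun j => by
    rw [hl_def, normSq_eq_norm_sq, norm_exp_ofReal_mul_I, one_pow]
  have hinj : Function.Injective fun j => l j ^ 2 := injective_exp_sq hθ hθ_mem
  have hmin : IsMinimalSurface (directSumSurface a gθ) := isMinimalSurface_of_isSumChart fun p => by
    obtain ⟨ρ₁, ρ₂, ψ, h, -⟩ := key p
    exact ⟨ρ₁, ρ₂, ψ, h⟩
  refine ⟨hmin, fun V hV => ?_, fun p X Y => ?_, ⟨hmin, fun s _ _ p => ?_⟩,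
    ⟨fun s => 2 ^ s * (‖modelForm a l s 1‖ ^ 2 + ‖modelForm a l s I‖ ^ 2) * modelConst (s + 1),
      fun s hs hs' => ⟨?_, fun p e he => ?_⟩⟩,
    ⟨fun s => 2 * (modelForm a l s).normDet * modelConst (s + 1),
      fun s hs hs' => ⟨?_, fun p => ?_⟩⟩,
    ⟨fun s => 4 * hopfForm (modelForm a l s), fun s _ _ p z hz => ?_⟩⟩
  · obtain ⟨ι, hι⟩ := hg
    obtain ⟨p, -⟩ := hι.nonconstant
    obtain ⟨ρ₁, ρ₂, ψ, -, -, -, -, h⟩ := key p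
    exact h V fun w _ => hV _
  · obtain ⟨ρ₁, ρ₂, ψ, h, hm, -⟩ := key p
    rw [hm, h.inner_differential]
  · obtain ⟨ρ₁, ρ₂, ψ, h, -⟩ := key p
    exact h.differentiableOn_hopfDifferential s
  · have := modelForm_norm_pos ha0 hl hinj (s := s) (by omega)
    have := modelConst_pos (s + 1)
    positivity
  · obtain ⟨ρ₁, ρ₂, ψ, h, -, ht, -⟩ := key p
    exact h.fundFormNormSq_eq ht s he
  · -- the strict bound on `s` makes the curvature ellipse nondegenerate
    have h1 : 0 < (modelForm a l s).normDet :=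
      (modelForm a l s).normDet_nonneg.lt_of_ne' (((modelForm a l s).normDet_ne_zero_tfae.out 0 4).2
        (modelForm_injective ha0 hl hinj (by omega)))
    have := modelConst_pos (s + 1)
    positivity
  · obtain ⟨ρ₁, ρ₂, ψ, h, -, ht, -⟩ := key p
    exact h.normalCurvature_eq ht s
  · obtain ⟨ρ₁, ρ₂, ψ, h, -, -, hφ, -⟩ := key p
    rw [h.hopfDifferential_eq s hz, hφ z hz]
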